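/- **Conventions.** A graph $G$ is a finite set $V(G)$ of vertices and a finite set $H(G)$ of half-edges with a root map $r:H(G)\to V(G)$ and a fixed-point-free involution $h\mapsto\bar h$ on $H(G)$; an edge is a pair $\{h,\bar h\}$, and a point is a vertex or a half-edge. A morphism maps vertices to vertices and half-edges to half-edges and commutes with $r$ and $\bar{\phantom{h}}$. A harmonic morphism $f:G\to K$ is a morphism with a local degree $d_f\ge 1$ on points, constant on edges, such that $d_f(v)=\sum_{h'\in r^{-1}(v)\cap f^{-1}(h)}d_f(h')$ for every vertex $v$ of $G$ and every half-edge $h$ rooted at $f(v)$; it has degree $n$ if $\sum_{y\in f^{-1}(x)}d_f(y)=n$ for all points $x$ of $K$, and the dilation profile over $x$ is the multiset $(d_f(y))_{y\in f^{-1}(x)}$. A free double cover is a harmonic morphism of degree $2$ with local degree constantly $1$; $\iota$ denotes the involution exchanging the two points of each of its fibres. Fix a nonempty connected graph $K$. A *tower* $\tilde\Gamma\xrightarrow{\pi}\Gamma\xrightarrow{f}K$ is a free double cover $\pi$ followed by a harmonic morphism $f$ of degree $4$; it is *generic* if the dilation profile of $f$ is nowhere $(2,2)$ or $(4)$. Isomorphisms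 of towers are over the identity of $K$ and preserve local degrees. If $K$ carries edge lengths $\ell$, then $\Gamma$ and $\tilde\Gamma$ carry the edge lengths determined by $\ell(e)\,d(e)=\ell(\text{image of }e)$. **Tetragonal construction.** For a tower, let $\tilde P\to K$ be the graph whose points over $x\in K$ are the effective formal sums $D$ of points of $\tilde\Gamma$ with $\pi_*D=f^*x:=\sum_{y\in f^{-1}(x)}d_f(y)\,y$, with $r$, $\bar{\phantom{h}}$ and $\iota$ extended linearly. Writing $y^+,y^-$ for the preimages of $y\in\Gamma$ and $D=\sum_y(a_{y^+}y^++a_{y^-}y^-)$, the local degree at $D$ is $\prod_{y\in f^{-1}(x)}\binom{d_f(y)}{a_{y^+}}$. Two points $D,E$ of $\tilde P$ over $x$, with coefficients $a,b$, are equivalent if $\sum_{y\in f^{-1}(x)}(a_{y^+}-b_{y^+})$ is even. The quotient $\tilde K\to K$ of $\tilde P$ by this relation is the orientation double cover. The tower is *orientable* if $\tilde K\cong K\sqcup K$ over $K$. In that case, given such an isomorphism, the part $\tilde\Lambda_i$ of $\tilde P$ over the $i$-th copy of $K$ is stable under $\iota$; put $\Lambda_i=\tilde\Lambda_i/\iota$,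 with the local degrees over $K$ induced from $\tilde P$. The output of the construction consists of $\tilde\Lambda_i\to\Lambda_i\to K$, $i=1,2$. **Prym varieties.** A tropical abelian variety is a triple $(L,L',[\cdot,\cdot])$ of two lattices of equal finite rank and a non-degenerate pairing $L\times L'\to\mathbb R$. A polarization is an injective homomorphism $\xi:L'\to L$ such that $[\xi(\cdot),\cdot]$ is symmetric and positive definite, and it is principal if it is bijective. An isomorphism $(L_1,L_1',\xi_1)\to(L_2,L_2',\xi_2)$ of polarized tropical abelian varieties is a pair of isomorphisms $f^\#:L_2\to L_1$, $f_\#:L_1'\to L_2'$ with $[f^\#(\cdot),\cdot]_1=[\cdot,f_\#(\cdot)]_2$ and $\xi_1=f^\#\circ\xi_2\circ f_\#$. Let $\Omega^1$ denote integral harmonic $1$-forms, with the integration pairing $[de,e]=\ell(e)$, $[de,e']=0$ for distinct edges $e,e'$, against $H_1(\,\cdot\,,\mathbb Z)$. For a free double cover $\pi:\tilde\Gamma\to\Gamma$, $$\operatorname{Prym}(\tilde\Gamma/\Gamma)=\big((\operatorname{Coker}(\pi^*:\Omega^1(\Gamma)\to\Omega^1(\tilde\Gamma)))^{\mathrm{tf}},\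 \operatorname{Ker}(\pi_*:H_1(\tilde\Gamma,\mathbb Z)\to H_1(\Gamma,\mathbb Z)),\ [\cdot,\cdot]\big),$$ where $\mathrm{tf}$ denotes the torsion-free quotient, with polarization $\zeta=\xi/2$, where $\xi$ is the composition $\operatorname{Ker}\pi_*\hookrightarrow H_1(\tilde\Gamma,\mathbb Z)\cong\Omega^1(\tilde\Gamma)\twoheadrightarrow(\operatorname{Coker}\pi^*)^{\mathrm{tf}}$. **Theorem.** Let $\tilde\Gamma\to\Gamma\to K$ be an orientable generic tower. Then the two outputs $\tilde\Lambda_i\to\Lambda_i\to K$, $i=1,2$, of the tetragonal construction are again orientable generic towers, and the following hold. 1. (Triality) For $i=1,2$, the two outputs of the tetragonal construction applied to $\tilde\Lambda_i\to\Lambda_i\to K$ are, in some order, isomorphic to the towers $\tilde\Gamma\to\Gamma\to K$ and $\tilde\Lambda_{3-i}\to\Lambda_{3-i}\to K$. 2. If moreover $\tilde\Gamma$, $\tilde\Lambda_1$ and $\tilde\Lambda_2$ are connected and $K$ is a tree, then for all positive edge lengths on $K$ the Prym varieties are tropical abelian varieties, $\zeta$ exists and is a principal polarization on each of them, and there are isomorphisms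 of principally polarized tropical abelian varieties $$\operatorname{Prym}(\tilde\Gamma/\Gamma)\cong\operatorname{Prym}(\tilde\Lambda_1/\Lambda_1)\cong\operatorname{Prym}(\tilde\Lambda_2/\Lambda_2).$$ -/

import Mathlib

universe u

namespace TropDonagi

open scoped Classical

noncomputable section

/-! ## Finite sets over each other -/

/-- Push-forward of a formal sum `∑ D(a) a` along a map of finite sets, extending `a ↦ g a`
linearly. -/
def push {A B M : Type*} [Fintype A] [AddCommMonoid M] (g : A → B) (D : A → M) : B → M :=
  fun b => ∑ a with g a = b, D a

/-- The pull-back `f^*(x) = ∑_{y ∈ f⁻¹(x)} d(y) y` of a point `x`, where `d` is a local degree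
function. -/
def pull {B C : Type*} (f : B → C) (d : B → ℕ) (x : C) : B → ℕ :=
  fun y => if f y = x then d y else 0

section lemmas

variable {A B C M : Type*} [Fintype A] [AddCommMonoid M]

theorem push_push [Fintype B] (g : A → B) (k : B → C) (D : A → M) :
    push k (push g D) = push (k ∘ g) D := by
  funext c
  simp only [push, Function.comp]
  rw [← Finset.sum_fiberwise_of_maps_to (s := {a | k (g a) = c}) (t := {b | k b = c}) (g := g)]
  · refine Finset.sum_congr rfl fun b hb => Finset.sum_congr ?_ fun _ _ => rfl
    ext a
    simp only [Finset.mem_filter, Finset.mem_univ, true_and] at hb ⊢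
    constructor
    · rintro rfl; exact ⟨hb, rfl⟩
    · exact fun h => h.2
  · intro a ha
    simpa using ha

theorem sum_push [Fintype B] (g : A → B) (D : A → M) : ∑ b, push g D b = ∑ a, D a := by
  simp only [push]
  exact Finset.sum_fiberwise _ _ _

theorem push_involutive (s : A → A) (hs : ∀ a, s (s a) = a) (D : A → M) (a : A) :
    push s D a = D (s a) := by
  have : (Finset.univ.filter fun b => s b = a) = {s a} := by
    ext b
    simp only [Finset.mem_filter, Finset.mem_univ, true_and, Finset.mem_singleton]
    constructor
    · rintro rfl; exact (hs b).symm
    · rintro rfl; exact hs a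
  simp [push, this]

theorem push_push_involutive (s : A → A) (hs : ∀ a, s (s a) = a) (D : A → M) :
    push s (push s D) = D := by
  funext a
  rw [push_involutive s hs, push_involutive s hs, hs]

end lemmas

/-- Fibrewise sections, for maps `π : A → B` and `f : B → C` of finite sets and a local degree
function `d` for `f`: the effective `D : A → ℕ` with `π_*(D) = f^*(x)` for some `x`. The point `x`
is recorded together with `D`; it is determined by `D` as soon as the fibre over `x` is
nonempty. -/
def Sections {A B C : Type*} [Fintype A] (π : A → B) (f : B → C) (d : B → ℕ) :=
  {p : C × (A → ℕ) // push π p.2 = pull f d p.1}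

section sections

variable {A B C : Type*} [Fintype A] {π : A → B} {f : B → C} {d : B → ℕ}

theorem Sections.le (p : Sections π f d) (a : A) : p.1.2 a ≤ d (π a) := by
  have h1 : p.1.2 a ≤ push π p.1.2 (π a) := by
    unfold push
    exact Finset.single_le_sum (f := p.1.2) (fun _ _ => Nat.zero_le _) (by simp)
  have h2 : push π p.1.2 (π a) ≤ d (π a) := by
    rw [p.2]; unfold pull; split_ifs <;> simp
  exact h1.trans h2

instance [Finite C] : Finite (Sections π f d) := by
  have : Finite (Set.Iic (fun a => d (π a))) := (Set.finite_Iic (fun a : A => d (π a))).to_subtype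
  let F : Sections π f d → C × Set.Iic (fun a => d (π a)) := fun p => (p.1.1, ⟨p.1.2, p.le⟩)
  refine Finite.of_injective F fun p q h => ?_
  have h1 : p.1.1 = q.1.1 := (Prod.ext_iff.mp h).1
  have h2 : p.1.2 = q.1.2 := congrArg Subtype.val (Prod.ext_iff.mp h).2
  exact Subtype.ext (Prod.ext h1 h2)

/-- Two sections `D = ∑ a_{y⁺} y⁺ + a_{y⁻} y⁻` and `E = ∑ b_{y⁺} y⁺ + b_{y⁻} y⁻` over the same
point are identified if `∑_y (a_{y⁺} - b_{y⁺})` is even. Here `s` is the labelling `y ↦ y⁺` of one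
preimage of each `y`; the parity does not depend on it. Terms outside the fibre vanish. -/
def paritySetoid [Fintype B] (π : A → B) (f : B → C) (d : B → ℕ) : Setoid (Sections π f d) where
  r p q := p.1.1 = q.1.1 ∧ ∀ s : B → A, (∀ y, π (s y) = y) →
    Even (∑ y, ((p.1.2 (s y) : ℤ) - (q.1.2 (s y) : ℤ)))
  iseqv :=
    { refl := fun p => ⟨rfl, fun s _ => by simp⟩
      symm := fun {p q} h => ⟨h.1.symm, fun s hs => by
        have := (h.2 s hs).neg
        rw [← Finset.sum_neg_distrib] at this
        simpa using this⟩
      trans := fun {p q r} h h' => ⟨h.1.trans h'.1, fun s hs => by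
        have := (h.2 s hs).add (h'.2 s hs)
        rw [← Finset.sum_add_distrib] at this
        simpa using this⟩ }

/-- The local degree `∏_{y ∈ f⁻¹(x)} binom(d(y), a_{y⁺})` of a section over `x`, when `π` has no
dilation and exactly two points `y⁺, y⁻` over each `y`; `s` is a labelling `y ↦ y⁺`. -/
def sectionDegree [Fintype B] (s : B → A) (p : Sections π f d) : ℕ :=
  ∏ y with f y = p.1.1, (d y).choose (p.1.2 (s y))

end sections

/-! ## Graphs and harmonic morphisms -/

/-- Finite graphs given by vertices, half-edges, a root map and a fixed-point-free involution. -/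
structure Graph : Type (u + 1) where
  V : Type u
  H : Type u
  [finV : Finite V]
  [finH : Finite H]
  root : H → V
  bar : H → H
  bar_bar : ∀ h, bar (bar h) = h
  bar_ne : ∀ h, bar h ≠ h

namespace Graph

attribute [instance] finV finH

instance (G : Graph.{u}) : Fintype G.V := Fintype.ofFinite _
instance (G : Graph.{u}) : Fintype G.H := Fintype.ofFinite _

/-- Morphisms of graphs (no edge is contracted). -/
structure Hom (G K : Graph.{u}) where
  onV : G.V → K.V
  onH : G.H → K.H
  root_comm : ∀ h, onV (G.root h) = K.root (onH h)
  bar_comm : ∀ h, onH (G.bar h) = K.bar (onH h)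

/-- Isomorphisms of graphs. -/
structure Iso (G K : Graph.{u}) where
  onV : G.V ≃ K.V
  onH : G.H ≃ K.H
  root_comm : ∀ h, onV (G.root h) = K.root (onH h)
  bar_comm : ∀ h, onH (G.bar h) = K.bar (onH h)

/-- A morphism of graphs together with a local degree function on vertices and half-edges. -/
structure WHom (G K : Graph.{u}) extends Hom G K where
  degV : G.V → ℕ
  degH : G.H → ℕ

/-- `(f, d_f)` is a harmonic morphism. -/
structure WHom.IsHarmonic {G K : Graph.{u}} (f : WHom G K) : Prop where
  degV_pos : ∀ v, 0 < f.degV v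
  degH_pos : ∀ h, 0 < f.degH h
  degH_bar : ∀ h, f.degH (G.bar h) = f.degH h
  balance : ∀ (v : G.V) (h : K.H), K.root h = f.onV v →
    f.degV v = ∑ h' with G.root h' = v ∧ f.onH h' = h, f.degH h'

/-- All fibres have total degree `n`. -/
def WHom.HasDegree {G K : Graph.{u}} (f : WHom G K) (n : ℕ) : Prop :=
  (∀ x, ∑ y with f.onV y = x, f.degV y = n) ∧ (∀ x, ∑ y with f.onH y = x, f.degH y = n)

/-- The local degree function is constant equal to one. -/
def WHom.IsFree {G K : Graph.{u}} (f : WHom G K) : Prop :=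
  (∀ v, f.degV v = 1) ∧ (∀ h, f.degH h = 1)

/-- Two vertices are joined by an edge. -/
def Adj (G : Graph.{u}) (v w : G.V) : Prop := ∃ h, G.root h = v ∧ G.root (G.bar h) = w

/-- The graph is nonempty and any two vertices are joined by a path. -/
def Connected (G : Graph.{u}) : Prop :=
  Nonempty G.V ∧ ∀ v w, Relation.ReflTransGen G.Adj v w

/-- The first homology `H₁(G, ℤ)`. A half-edge `h` stands for the edge `{h, bar h}` oriented from
`root h` to `root (bar h)`, and a chain `∑ b_e e` is recorded by its coefficients on all oriented
edges, `b (bar h) = - b h`, which avoids the choice of an orientation. The condition at `v` says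
that the boundary vanishes.

The integral harmonic one-forms `∑ a_e de` are given by exactly the same condition on the
coefficients, so the same submodule is used for `Ω¹(G)`, and the canonical isomorphism
`H₁(G, ℤ) → Ω¹(G)`, `e ↦ de`, is the identity. -/
def cycles (G : Graph.{u}) : Submodule ℤ (G.H → ℤ) where
  carrier := {a | (∀ h, a (G.bar h) = - a h) ∧ ∀ v, ∑ h with G.root h = v, a h = 0}
  add_mem' {a b} ha hb := by
    refine ⟨fun h => ?_, fun v => ?_⟩
    · simp only [Pi.add_apply, ha.1, hb.1]; ring
    · simp only [Pi.add_apply, Finset.sum_add_distrib, ha.2, hb.2, add_zero]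
  zero_mem' := by simp
  smul_mem' c a ha := by
    refine ⟨fun h => ?_, fun v => ?_⟩
    · simp only [Pi.smul_apply, ha.1, smul_neg]
    · simp only [Pi.smul_apply, ← Finset.smul_sum, ha.2, smul_zero]

/-- A tree: a connected graph without nonzero cycles. -/
def IsTree (G : Graph.{u}) : Prop := G.Connected ∧ G.cycles = ⊥

/-- Edge lengths, making a graph into a tropical curve. -/
structure EdgeLength (G : Graph.{u}) where
  len : G.H → ℝ
  len_pos : ∀ h, 0 < len h
  len_bar : ∀ h, len (G.bar h) = len h

/-- The trivial double cover `K ⊔ K` of `K`. -/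
def twoCopies (K : Graph.{u}) : Graph.{u} where
  V := K.V × Fin 2
  H := K.H × Fin 2
  root h := (K.root h.1, h.2)
  bar h := (K.bar h.1, h.2)
  bar_bar h := by simp [K.bar_bar]
  bar_ne h := fun e => K.bar_ne h.1 (congrArg Prod.fst e)

/-- The equivalence relation of being in the same orbit of an involution. -/
def orbitSetoid {X : Type*} (s : X → X) (hs : ∀ x, s (s x) = x) : Setoid X where
  r x y := y = x ∨ y = s x
  iseqv :=
    { refl := fun _ => Or.inl rfl
      symm := by
        rintro x y (rfl | rfl)
        · exact Or.inl rfl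
        · exact Or.inr (hs x).symm
      trans := by
        rintro x y z (rfl | rfl) (rfl | rfl)
        · exact Or.inl rfl
        · exact Or.inr rfl
        · exact Or.inr rfl
        · exact Or.inl (hs x) }

/-- The quotient of a graph by an involution which does not flip an edge. -/
def quotient (G : Graph.{u}) (s : Hom G G) (hV : ∀ v, s.onV (s.onV v) = v)
    (hH : ∀ h, s.onH (s.onH h) = h) (hs : ∀ h, G.bar h ≠ s.onH h) : Graph.{u} where
  V := Quotient (orbitSetoid s.onV hV)
  H := Quotient (orbitSetoid s.onH hH)
  root := Quotient.map' G.root (by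
    rintro x y (rfl | rfl)
    · exact Or.inl rfl
    · exact Or.inr (s.root_comm x).symm)
  bar := Quotient.map' G.bar (by
    rintro x y (rfl | rfl)
    · exact Or.inl rfl
    · exact Or.inr (s.bar_comm x).symm)
  bar_bar := by
    rintro ⟨h⟩
    exact congrArg (Quotient.mk (orbitSetoid s.onH hH)) (G.bar_bar h)
  bar_ne := by
    rintro ⟨h⟩ e
    rcases Quotient.exact e with e | e
    · exact G.bar_ne h e.symm
    · apply hs h
      have e' : h = s.onH (G.bar h) := e
      rw [e', hH, ← e']

end Graph

/-! ## Towers -/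

/-- The data of a pair of covers `Gt → G → K` with an involution `swap` on the top graph. -/
structure PreTower (K : Graph.{u}) where
  Gt : Graph.{u}
  G : Graph.{u}
  π : Graph.WHom Gt G
  swap : Graph.Hom Gt Gt
  f : Graph.WHom G K

/-- A tower: `π` is a free double cover, `swap` is the involution exchanging the two points of
every fibre of `π`, and `f` is harmonic of degree `4`. -/
structure Tower (K : Graph.{u}) extends PreTower K where
  π_harmonic : π.IsHarmonic
  π_free : π.IsFree
  π_degree : π.HasDegree 2
  π_swapV : ∀ v, π.onV (swap.onV v) = π.onV v
  π_swapH : ∀ h, π.onH (swap.onH h) = π.onH h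
  swapV_ne : ∀ v, swap.onV v ≠ v
  swapH_ne : ∀ h, swap.onH h ≠ h
  f_harmonic : f.IsHarmonic
  f_degree : f.HasDegree 4

/-- Isomorphisms of towers over the identity of `K`. -/
structure PreTower.Iso {K : Graph.{u}} (S T : PreTower K) where
  top : Graph.Iso S.Gt T.Gt
  mid : Graph.Iso S.G T.G
  π_commV : ∀ v, T.π.onV (top.onV v) = mid.onV (S.π.onV v)
  π_commH : ∀ h, T.π.onH (top.onH h) = mid.onH (S.π.onH h)
  f_commV : ∀ v, T.f.onV (mid.onV v) = S.f.onV v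
  f_commH : ∀ h, T.f.onH (mid.onH h) = S.f.onH h
  swap_commV : ∀ v, T.swap.onV (top.onV v) = top.onV (S.swap.onV v)
  swap_commH : ∀ h, T.swap.onH (top.onH h) = top.onH (S.swap.onH h)
  π_degV : ∀ v, T.π.degV (top.onV v) = S.π.degV v
  π_degH : ∀ h, T.π.degH (top.onH h) = S.π.degH h
  f_degV : ∀ v, T.f.degV (mid.onV v) = S.f.degV v
  f_degH : ∀ h, T.f.degH (mid.onH h) = S.f.degH h

namespace Tower

variable {K : Graph.{u}} (T : Tower K)

/-- The dilation profile of `f` over a vertex of `K`. -/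
def profileV (x : K.V) : Multiset ℕ :=
  (Finset.univ.filter fun y => T.f.onV y = x).val.map T.f.degV

/-- The dilation profile of `f` over a half-edge of `K`. -/
def profileH (x : K.H) : Multiset ℕ :=
  (Finset.univ.filter fun y => T.f.onH y = x).val.map T.f.degH

/-- The dilation profile is nowhere `(2, 2)` or `(4)`. -/
def Generic : Prop :=
  (∀ x, T.profileV x ≠ {2, 2} ∧ T.profileV x ≠ {4}) ∧
  (∀ x, T.profileH x ≠ {2, 2} ∧ T.profileH x ≠ {4})

end Tower

/-! Elementary facts on fibres of degree two. -/

section fibres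

variable {A B : Type*} [Fintype A] {π : A → B} {s : A → A}

theorem fibre_eq (h2 : ∀ y, (Finset.univ.filter fun a => π a = y).card = 2)
    (hs : ∀ a, π (s a) = π a) (hne : ∀ a, s a ≠ a) (a : A) :
    (Finset.univ.filter fun b => π b = π a) = {a, s a} := by
  symm
  apply Finset.eq_of_subset_of_card_le
  · intro b hb
    simp only [Finset.mem_insert, Finset.mem_singleton] at hb
    rcases hb with rfl | rfl <;> simp [hs]
  · rw [h2, Finset.card_pair (hne a).symm]

theorem fibre_invol (h2 : ∀ y, (Finset.univ.filter fun a => π a = y).card = 2)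
    (hs : ∀ a, π (s a) = π a) (hne : ∀ a, s a ≠ a) (a : A) : s (s a) = a := by
  have h : s (s a) ∈ (Finset.univ.filter fun b => π b = π a) := by simp [hs]
  rw [fibre_eq h2 hs hne] at h
  simp only [Finset.mem_insert, Finset.mem_singleton] at h
  rcases h with h | h
  · exact h
  · exact absurd h (hne _)

theorem fibre_surj (h2 : ∀ y, (Finset.univ.filter fun a => π a = y).card = 2) :
    Function.Surjective π := by
  intro y
  have : (Finset.univ.filter fun a => π a = y).Nonempty := by
    rw [← Finset.card_pos, h2]; norm_num
  obtain ⟨a, ha⟩ := this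
  exact ⟨a, by simpa using ha⟩

variable {C : Type*} {f : B → C} {d : B → ℕ}

theorem section_add (h2 : ∀ y, (Finset.univ.filter fun a => π a = y).card = 2)
    (hs : ∀ a, π (s a) = π a) (hne : ∀ a, s a ≠ a) (p : Sections π f d) (a : A) :
    p.1.2 a + p.1.2 (s a) = pull f d p.1.1 (π a) := by
  rw [← p.2]
  simp only [push]
  rw [fibre_eq h2 hs hne, Finset.sum_pair (hne a).symm]

end fibres

namespace Tower

variable {K : Graph.{u}} (T : Tower K)

theorem cardV (y : T.G.V) : (Finset.univ.filter fun a => T.π.onV a = y).card = 2 := by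
  have := T.π_degree.1 y
  simpa [T.π_free.1] using this

theorem cardH (y : T.G.H) : (Finset.univ.filter fun a => T.π.onH a = y).card = 2 := by
  have := T.π_degree.2 y
  simpa [T.π_free.2] using this

theorem swap_swapV (v : T.Gt.V) : T.swap.onV (T.swap.onV v) = v :=
  fibre_invol T.cardV T.π_swapV T.swapV_ne v

theorem swap_swapH (h : T.Gt.H) : T.swap.onH (T.swap.onH h) = h :=
  fibre_invol T.cardH T.π_swapH T.swapH_ne h

theorem surjV : Function.Surjective T.π.onV := fibre_surj T.cardV
theorem surjH : Function.Surjective T.π.onH := fibre_surj T.cardH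

/-- Unique lifting of half-edges along the free cover `π`. -/
theorem existsUnique_lift (v : T.Gt.V) (h : T.G.H) (hv : T.G.root h = T.π.onV v) :
    ∃! h', T.Gt.root h' = v ∧ T.π.onH h' = h := by
  have := T.π_harmonic.balance v h hv
  simp only [T.π_free.1, T.π_free.2, Finset.sum_const, smul_eq_mul, mul_one] at this
  obtain ⟨a, ha⟩ := Finset.card_eq_one.mp this.symm
  refine ⟨a, ?_, fun b hb => ?_⟩
  · have : a ∈ ({a} : Finset _) := by simp
    rw [← ha] at this
    simpa using this
  · have : b ∈ (Finset.univ.filter fun h' => T.Gt.root h' = v ∧ T.π.onH h' = h) := by simpa using hb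
    rw [ha] at this
    simpa using this

/-! ## The tetragonal construction -/

theorem push_root_pull (h : K.H) :
    push T.G.root (pull T.f.onH T.f.degH h) = pull T.f.onV T.f.degV (K.root h) := by
  funext v
  simp only [push, pull]
  split_ifs with hv
  · rw [T.f_harmonic.balance v h hv.symm, ← Finset.sum_filter, Finset.filter_filter]
  · refine Finset.sum_eq_zero fun h' hh' => ?_
    simp only [Finset.mem_filter, Finset.mem_univ, true_and] at hh'
    rw [if_neg]
    rintro rfl
    exact hv (by rw [← hh', T.f.root_comm])

theorem push_bar_pull (h : K.H) :
    push T.G.bar (pull T.f.onH T.f.degH h) = pull T.f.onH T.f.degH (K.bar h) := by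
  funext h'
  rw [push_involutive _ T.G.bar_bar]
  simp only [pull, T.f.bar_comm, T.f_harmonic.degH_bar]
  congr 1
  apply propext
  constructor
  · rintro rfl; rw [K.bar_bar]
  · intro e; rw [e, K.bar_bar]

/-- The graph `P̃` of fibrewise sections. Root map and involution are
`∑ a_h h ↦ ∑ a_h r(h)` and `∑ a_h h ↦ ∑ a_h bar(h)`. -/
def donagi : Graph.{u} where
  V := Sections T.π.onV T.f.onV T.f.degV
  H := Sections T.π.onH T.f.onH T.f.degH
  root p := ⟨(K.root p.1.1, push T.Gt.root p.1.2), by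
    have e : T.π.onV ∘ T.Gt.root = T.G.root ∘ T.π.onH := funext T.π.root_comm
    rw [push_push, e, ← push_push, p.2, T.push_root_pull]⟩
  bar p := ⟨(K.bar p.1.1, push T.Gt.bar p.1.2), by
    have e : T.π.onH ∘ T.Gt.bar = T.G.bar ∘ T.π.onH := funext T.π.bar_comm
    rw [push_push, e, ← push_push, p.2, T.push_bar_pull]⟩
  bar_bar p := by
    refine Subtype.ext (Prod.ext (K.bar_bar _) ?_)
    exact push_push_involutive _ T.Gt.bar_bar _
  bar_ne p e := K.bar_ne p.1.1 (congrArg (fun q => q.1.1) e)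

/-- The involution `∑ a_h h ↦ ∑ a_h ι(h)` on `P̃` induced by the involution `ι` of the double
cover. -/
def donagiSwap : Graph.Hom T.donagi T.donagi where
  onV p := ⟨(p.1.1, push T.swap.onV p.1.2), by
    have e : T.π.onV ∘ T.swap.onV = T.π.onV := funext T.π_swapV
    rw [push_push, e]; exact p.2⟩
  onH p := ⟨(p.1.1, push T.swap.onH p.1.2), by
    have e : T.π.onH ∘ T.swap.onH = T.π.onH := funext T.π_swapH
    rw [push_push, e]; exact p.2⟩
  root_comm p := by
    refine Subtype.ext (Prod.ext rfl ?_)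
    change push T.swap.onV (push T.Gt.root p.1.2) = push T.Gt.root (push T.swap.onH p.1.2)
    rw [push_push, push_push]
    exact congrArg (fun g => push g p.1.2) (funext T.swap.root_comm)
  bar_comm p := by
    refine Subtype.ext (Prod.ext rfl ?_)
    change push T.swap.onH (push T.Gt.bar p.1.2) = push T.Gt.bar (push T.swap.onH p.1.2)
    rw [push_push, push_push]
    exact congrArg (fun g => push g p.1.2) (funext T.swap.bar_comm)

theorem donagiSwap_swapV (p : T.donagi.V) : T.donagiSwap.onV (T.donagiSwap.onV p) = p :=
  Subtype.ext (Prod.ext rfl (push_push_involutive _ T.swap_swapV _))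

theorem donagiSwap_swapH (p : T.donagi.H) : T.donagiSwap.onH (T.donagiSwap.onH p) = p :=
  Subtype.ext (Prod.ext rfl (push_push_involutive _ T.swap_swapH _))

/-- The local degree function of `P̃ → K` on vertices, for an arbitrary labelling `y ↦ y⁺`. -/
def donagiDegV : T.donagi.V → ℕ := sectionDegree (Function.surjInv T.surjV)

/-- The local degree function of `P̃ → K` on half-edges, for an arbitrary labelling `y ↦ y⁺`. -/
def donagiDegH : T.donagi.H → ℕ := sectionDegree (Function.surjInv T.surjH)

end Tower

section swap

variable {A B C : Type*} [Fintype A] [Fintype B] {π : A → B} {s : A → A} {f : B → C} {d : B → ℕ}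

theorem sectionDegree_swap (h2 : ∀ y, (Finset.univ.filter fun a => π a = y).card = 2)
    (hs : ∀ a, π (s a) = π a) (hne : ∀ a, s a ≠ a) (l : B → A) (hl : ∀ y, π (l y) = y)
    (p q : Sections π f d) (hx : q.1.1 = p.1.1) (hq : q.1.2 = push s p.1.2) :
    sectionDegree l q = sectionDegree l p := by
  unfold sectionDegree
  rw [hx]
  refine Finset.prod_congr rfl fun y hy => ?_
  have h := section_add h2 hs hne p (l y)
  simp only [Finset.mem_filter, Finset.mem_univ, true_and] at hy
  rw [hl, pull, if_pos hy] at h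
  rw [hq, push_involutive s (fibre_invol h2 hs hne)]
  exact Nat.choose_symm_of_eq_add (by omega)

theorem parity_swap (h2 : ∀ y, (Finset.univ.filter fun a => π a = y).card = 2)
    (hs : ∀ a, π (s a) = π a) (hne : ∀ a, s a ≠ a)
    (h4 : ∀ x, ∑ y with f y = x, d y = 4)
    (p q : Sections π f d) (hx : q.1.1 = p.1.1) (hq : q.1.2 = push s p.1.2) :
    paritySetoid π f d q p := by
  refine ⟨hx, fun l hl => ?_⟩
  have key : ∀ y, ((q.1.2 (l y) : ℤ) - (p.1.2 (l y) : ℤ))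
      = (pull f d p.1.1 y : ℤ) - 2 * (p.1.2 (l y) : ℤ) := by
    intro y
    have h := section_add h2 hs hne p (l y)
    rw [hl] at h
    rw [hq, push_involutive s (fibre_invol h2 hs hne), ← h]
    push_cast; ring
  have h4' : ∑ y, (pull f d p.1.1 y : ℤ) = 4 := by
    have := h4 p.1.1
    rw [Finset.sum_filter] at this
    exact_mod_cast this
  rw [Finset.sum_congr rfl fun y _ => key y, Finset.sum_sub_distrib, h4', ← Finset.mul_sum]
  exact (by decide : Even (4 : ℤ)).sub (even_two_mul _)

end swap

namespace Tower

variable {K : Graph.{u}} (T : Tower K)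

/-! ## The orientation double cover -/

theorem parity_root (p q : T.donagi.H)
    (h : paritySetoid T.π.onH T.f.onH T.f.degH p q) :
    paritySetoid T.π.onV T.f.onV T.f.degV (T.donagi.root p) (T.donagi.root q) := by
  refine ⟨congrArg K.root h.1, fun s hs => ?_⟩
  have hl : ∀ e : T.G.H, ∃! e', T.Gt.root e' = s (T.G.root e) ∧ T.π.onH e' = e :=
    fun e => T.existsUnique_lift _ e (hs _).symm
  choose l hl hu using fun e => (hl e).exists.elim fun a ha =>
    (⟨a, ha, fun b hb => (hl e).unique hb ha⟩ :
      ∃ a, (T.Gt.root a = s (T.G.root e) ∧ T.π.onH a = e) ∧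
        ∀ b, (T.Gt.root b = s (T.G.root e) ∧ T.π.onH b = e) → b = a)
  have key : ∀ D : T.Gt.H → ℕ,
      ∑ y, ((push T.Gt.root D (s y) : ℕ) : ℤ) = ∑ e, (D (l e) : ℤ) := by
    intro D
    have h1 : ∀ y, push T.Gt.root D (s y) = push T.G.root (fun e => D (l e)) y := by
      intro y
      simp only [push]
      symm
      refine Finset.sum_bij (fun e _ => l e) ?_ ?_ ?_ ?_
      · intro e he
        simp only [Finset.mem_filter, Finset.mem_univ, true_and] at he ⊢
        rw [(hl e).1, he]
      · intro e _ e' _ hee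
        rw [← (hl e).2, hee, (hl e').2]
      · intro b hb
        simp only [Finset.mem_filter, Finset.mem_univ, true_and] at hb
        have hr : T.G.root (T.π.onH b) = y := by rw [← T.π.root_comm, hb, hs]
        refine ⟨T.π.onH b, by simpa using hr, ?_⟩
        exact (hu _ b ⟨by rw [hr, hb], rfl⟩).symm
      · intro _ _; rfl
    have h2 := sum_push T.G.root (fun e => D (l e))
    simp only [h1]
    exact_mod_cast h2
  have := h.2 l fun e => (hl e).2
  rw [Finset.sum_sub_distrib] at this ⊢
  change Even (∑ y, ((push T.Gt.root p.1.2 (s y) : ℕ) : ℤ) -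
    ∑ y, ((push T.Gt.root q.1.2 (s y) : ℕ) : ℤ))
  rw [key, key]
  exact this

theorem parity_bar (p q : T.donagi.H)
    (h : paritySetoid T.π.onH T.f.onH T.f.degH p q) :
    paritySetoid T.π.onH T.f.onH T.f.degH (T.donagi.bar p) (T.donagi.bar q) := by
  refine ⟨congrArg K.bar h.1, fun s hs => ?_⟩
  have := h.2 (fun e => T.Gt.bar (s (T.G.bar e))) fun e => by
    rw [T.π.bar_comm, hs, T.G.bar_bar]
  let σ : T.G.H ≃ T.G.H := ⟨T.G.bar, T.G.bar, T.G.bar_bar, T.G.bar_bar⟩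
  rw [← Equiv.sum_comp σ] at this
  convert this using 3 with y
  all_goals
    change (((push T.Gt.bar _ (s y)) : ℕ) : ℤ) = _
    rw [push_involutive _ T.Gt.bar_bar]
    simp [σ, T.G.bar_bar]

/-- The orientation double cover `K̃` of `K`: the quotient of `P̃` by the parity relation in
every fibre. -/
def orientationCover : Graph.{u} where
  V := Quotient (paritySetoid T.π.onV T.f.onV T.f.degV)
  H := Quotient (paritySetoid T.π.onH T.f.onH T.f.degH)
  root := Quotient.map' T.donagi.root T.parity_root
  bar := Quotient.map' T.donagi.bar T.parity_bar
  bar_bar := by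
    rintro ⟨h⟩
    exact congrArg (Quotient.mk (paritySetoid T.π.onH T.f.onH T.f.degH)) (T.donagi.bar_bar h)
  bar_ne := by
    rintro ⟨h⟩ e
    exact K.bar_ne _ (Quotient.exact e).1

/-- The covering map `K̃ → K`. -/
def orientationProj : Graph.Hom T.orientationCover K where
  onV := Quotient.lift (fun p => p.1.1) fun _ _ h => h.1
  onH := Quotient.lift (fun p => p.1.1) fun _ _ h => h.1
  root_comm := by rintro ⟨h⟩; rfl
  bar_comm := by rintro ⟨h⟩; rfl

/-- A trivialization of the orientation double cover: an isomorphism `K̃ ≅ K ⊔ K` over `K`. -/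
structure Orientation extends Graph.Iso T.orientationCover K.twoCopies where
  overV : ∀ q, (onV q).1 = T.orientationProj.onV q
  overH : ∀ q, (onH q).1 = T.orientationProj.onH q

/-- The tower is orientable: its orientation double cover is trivial. -/
def Orientable : Prop := Nonempty T.Orientation

/-! ## The two output towers -/

section output

variable {T} (θ : T.Orientation)

/-- The index of the copy of `K` to which a vertex of `P̃` is mapped. -/
def indexV (p : T.donagi.V) : Fin 2 :=
  (θ.onV (Quotient.mk (paritySetoid T.π.onV T.f.onV T.f.degV) p)).2

/-- The index of the copy of `K` to which a half-edge of `P̃` is mapped. -/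
def indexH (p : T.donagi.H) : Fin 2 :=
  (θ.onH (Quotient.mk (paritySetoid T.π.onH T.f.onH T.f.degH) p)).2

theorem index_root (p : T.donagi.H) : indexV θ (T.donagi.root p) = indexH θ p :=
  congrArg Prod.snd (θ.root_comm (Quotient.mk (paritySetoid T.π.onH T.f.onH T.f.degH) p))

theorem index_bar (p : T.donagi.H) : indexH θ (T.donagi.bar p) = indexH θ p :=
  (congrArg Prod.snd (θ.bar_comm (Quotient.mk (paritySetoid T.π.onH T.f.onH T.f.degH) p)) :)

theorem index_swapV (p : T.donagi.V) : indexV θ (T.donagiSwap.onV p) = indexV θ p := by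
  unfold indexV
  exact congrArg (fun q => (θ.onV q).2) (Quotient.sound
    (parity_swap T.cardV T.π_swapV T.swapV_ne T.f_degree.1 p (T.donagiSwap.onV p) rfl rfl))

theorem index_swapH (p : T.donagi.H) : indexH θ (T.donagiSwap.onH p) = indexH θ p := by
  unfold indexH
  exact congrArg (fun q => (θ.onH q).2) (Quotient.sound
    (parity_swap T.cardH T.π_swapH T.swapH_ne T.f_degree.2 p (T.donagiSwap.onH p) rfl rfl))

/-- The part `C̃_i` of `P̃` over the `i`-th copy of `K`. -/
def sheet (i : Fin 2) : Graph.{u} where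
  V := {p : T.donagi.V // indexV θ p = i}
  H := {p : T.donagi.H // indexH θ p = i}
  finV := Subtype.finite
  finH := Subtype.finite
  root p := ⟨T.donagi.root p.1, (index_root θ p.1).trans p.2⟩
  bar p := ⟨T.donagi.bar p.1, (index_bar θ p.1).trans p.2⟩
  bar_bar p := Subtype.ext (T.donagi.bar_bar p.1)
  bar_ne p e := T.donagi.bar_ne p.1 (congrArg Subtype.val e)

/-- The involution of `P̃` restricted to `C̃_i`. -/
def sheetSwap (i : Fin 2) : Graph.Hom (sheet θ i) (sheet θ i) where
  onV p := ⟨T.donagiSwap.onV p.1, (index_swapV θ p.1).trans p.2⟩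
  onH p := ⟨T.donagiSwap.onH p.1, (index_swapH θ p.1).trans p.2⟩
  root_comm p := Subtype.ext (T.donagiSwap.root_comm p.1)
  bar_comm p := Subtype.ext (T.donagiSwap.bar_comm p.1)

theorem sheetSwap_swapV (i : Fin 2) (p : (sheet θ i).V) :
    (sheetSwap θ i).onV ((sheetSwap θ i).onV p) = p := Subtype.ext (T.donagiSwap_swapV p.1)

theorem sheetSwap_swapH (i : Fin 2) (p : (sheet θ i).H) :
    (sheetSwap θ i).onH ((sheetSwap θ i).onH p) = p := Subtype.ext (T.donagiSwap_swapH p.1)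

/-- The quotient `C_i` of `C̃_i` by the involution. -/
def sheetQuotient (i : Fin 2) : Graph.{u} :=
  (sheet θ i).quotient (sheetSwap θ i) (sheetSwap_swapV θ i) (sheetSwap_swapH θ i)
    (fun h e => K.bar_ne h.1.1.1 (congrArg (fun q => q.1.1.1) e))

/-- The `i`-th output tower `C̃_i → C_i → K` of the tetragonal construction. The cover
`C̃_i → C_i` carries the local degree `1` and `C_i → K` the local degree of `P̃ → K`; this is the
correct choice whenever the involution on `C̃_i` is free, which is the case for towers whose
dilation profile is nowhere `(2, 2)` or `(4)`. -/
def output (i : Fin 2) : PreTower K where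
  Gt := sheet θ i
  G := sheetQuotient θ i
  π :=
    { onV := Quotient.mk _
      onH := Quotient.mk _
      root_comm := fun _ => rfl
      bar_comm := fun _ => rfl
      degV := fun _ => 1
      degH := fun _ => 1 }
  swap := sheetSwap θ i
  f :=
    { onV := Quotient.lift (fun p => p.1.1.1) (by rintro p q (rfl | rfl) <;> rfl)
      onH := Quotient.lift (fun p => p.1.1.1) (by rintro p q (rfl | rfl) <;> rfl)
      root_comm := by rintro ⟨h⟩; rfl
      bar_comm := by rintro ⟨h⟩; rfl
      degV := Quotient.lift (fun p => T.donagiDegV p.1) (by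
        rintro p q (rfl | rfl)
        · rfl
        · exact (sectionDegree_swap T.cardV T.π_swapV T.swapV_ne _
            (Function.surjInv_eq T.surjV) p.1 (T.donagiSwap.onV p.1) rfl rfl).symm)
      degH := Quotient.lift (fun p => T.donagiDegH p.1) (by
        rintro p q (rfl | rfl)
        · rfl
        · exact (sectionDegree_swap T.cardH T.π_swapH T.swapH_ne _
            (Function.surjInv_eq T.surjH) p.1 (T.donagiSwap.onH p.1) rfl rfl).symm) }

end output

end Tower

/-! ## Tropical abelian varieties -/

/-- The data of two abelian groups with a real-valued pairing. -/
structure Pairing : Type (u + 1) where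
  L : Type u
  L' : Type u
  [instL : AddCommGroup L]
  [instL' : AddCommGroup L']
  pair : L →ₗ[ℤ] L' →ₗ[ℤ] ℝ

namespace Pairing

attribute [instance] instL instL'

/-- A tropical abelian variety: two lattices of the same rank with a pairing which is
non-degenerate (over the real numbers: its matrix in any bases is invertible). -/
structure IsTAV (X : Pairing.{u}) : Prop where
  freeL : Module.Free ℤ X.L
  freeL' : Module.Free ℤ X.L'
  finiteL : Module.Finite ℤ X.L
  finiteL' : Module.Finite ℤ X.L'
  rank_eq : Module.finrank ℤ X.L = Module.finrank ℤ X.L'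
  nondegenerate : ∀ (n : ℕ) (b : Module.Basis (Fin n) ℤ X.L) (b' : Module.Basis (Fin n) ℤ X.L'),
    (Matrix.of fun i j => X.pair (b i) (b' j)).det ≠ 0

/-- `ξ` is a polarization: it is injective and `[ξ(·), ·]` is symmetric and positive definite
(over the real numbers: its Gram matrix in any basis is positive definite). -/
structure IsPolarization (X : Pairing.{u}) (ξ : X.L' →ₗ[ℤ] X.L) : Prop where
  injective : Function.Injective ξ
  symm : ∀ a b, X.pair (ξ a) b = X.pair (ξ b) a
  posDef : ∀ (n : ℕ) (b : Module.Basis (Fin n) ℤ X.L'),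
    (Matrix.of fun i j => X.pair (ξ (b i)) (b j)).PosDef

/-- `ξ` is a principal polarization. -/
def IsPrincipal (X : Pairing.{u}) (ξ : X.L' →ₗ[ℤ] X.L) : Prop :=
  X.IsPolarization ξ ∧ Function.Bijective ξ

/-- Isomorphisms `(f^#, f_#)` of polarized tropical abelian varieties. -/
structure PolarizedIso (X Y : Pairing.{u}) (ξX : X.L' →ₗ[ℤ] X.L) (ξY : Y.L' →ₗ[ℤ] Y.L) where
  upper : Y.L ≃ₗ[ℤ] X.L
  lower : X.L' ≃ₗ[ℤ] Y.L'
  adjoint : ∀ a b, X.pair (upper a) b = Y.pair a (lower b)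
  polarization : ∀ b, ξX b = upper (ξY (lower b))

end Pairing

/-! ## Prym varieties -/

/-- The integration pairing `[∑ a_e de, ∑ b_e e] = ∑_e a_e b_e ℓ(e)`. Every edge is counted by its
two half-edges, whence the factor `1/2`. -/
def Graph.intPair (G : Graph.{u}) (w : G.H → ℝ) : G.cycles →ₗ[ℤ] G.cycles →ₗ[ℤ] ℝ :=
  LinearMap.mk₂ ℤ (fun a b => (1 / 2) * ∑ h, (a.1 h : ℝ) * (b.1 h : ℝ) * w h)
    (fun a b c => by
      simp only [Submodule.coe_add, Pi.add_apply, Int.cast_add]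
      rw [← mul_add, ← Finset.sum_add_distrib]
      congr 1; exact Finset.sum_congr rfl fun h _ => by ring)
    (fun r a b => by
      simp only [Submodule.coe_smul, Pi.smul_apply, smul_eq_mul, Int.cast_mul, zsmul_eq_mul]
      rw [mul_left_comm, Finset.mul_sum (a := (r : ℝ))]
      congr 1; exact Finset.sum_congr rfl fun h _ => by ring)
    (fun a b c => by
      simp only [Submodule.coe_add, Pi.add_apply, Int.cast_add]
      rw [← mul_add, ← Finset.sum_add_distrib]
      congr 1; exact Finset.sum_congr rfl fun h _ => by ring)
    (fun r a b => by
      simp only [Submodule.coe_smul, Pi.smul_apply, smul_eq_mul, Int.cast_mul, zsmul_eq_mul]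
      rw [mul_left_comm, Finset.mul_sum (a := (r : ℝ))]
      congr 1; exact Finset.sum_congr rfl fun h _ => by ring)

namespace Tower

variable {K : Graph.{u}} (T : Tower K)

/-- The edge lengths on `G`, determined by `ℓ(e) · d_f(e) = ℓ(f(e))`. -/
def len (ℓ : K.EdgeLength) (h : T.G.H) : ℝ := ℓ.len (T.f.onH h) / T.f.degH h

/-- The edge lengths on `Gt`, determined by `ℓ(e) · d_π(e) = ℓ(π(e))`. -/
def lenTop (ℓ : K.EdgeLength) (h : T.Gt.H) : ℝ := T.len ℓ (T.π.onH h) / T.π.degH h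

/-- The push-forward `π_* : H₁(Gt, ℤ) → H₁(G, ℤ)`. -/
def pushCycles : T.Gt.cycles →ₗ[ℤ] T.G.cycles where
  toFun c := ⟨push T.π.onH c.1, by
    constructor
    · intro h
      have h1 : push T.π.onH c.1 (T.G.bar h) = push T.G.bar (push T.π.onH c.1) h :=
        (push_involutive _ T.G.bar_bar _ _).symm
      have e : T.G.bar ∘ T.π.onH = T.π.onH ∘ T.Gt.bar := (funext T.π.bar_comm).symm
      rw [h1, push_push, e, ← push_push]
      simp only [push, ← Finset.sum_neg_distrib]
      refine Finset.sum_congr rfl fun a _ => ?_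
      change push T.Gt.bar c.1 a = _
      rw [push_involutive _ T.Gt.bar_bar, c.2.1]
    · intro v
      change push T.G.root (push T.π.onH c.1) v = 0
      have e : T.G.root ∘ T.π.onH = T.π.onV ∘ T.Gt.root := (funext T.π.root_comm).symm
      rw [push_push, e, ← push_push]
      simp only [push]
      exact Finset.sum_eq_zero fun a _ => c.2.2 a⟩
  map_add' a b := Subtype.ext (funext fun h => by simp [push, Finset.sum_add_distrib])
  map_smul' r a := Subtype.ext (funext fun h => by simp [push, Finset.mul_sum])

/-- The pull-back `π^* : Ω¹(G) → Ω¹(Gt)` of one-forms along the free cover `π`,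
`de ↦ ∑_{e' ∈ π⁻¹(e)} de'`. -/
def pullForms : T.G.cycles →ₗ[ℤ] T.Gt.cycles where
  toFun c := ⟨fun h => c.1 (T.π.onH h), by
    constructor
    · intro h
      change c.1 (T.π.onH (T.Gt.bar h)) = - c.1 (T.π.onH h)
      rw [T.π.bar_comm, c.2.1]
    · intro v
      rw [← c.2.2 (T.π.onV v)]
      refine Finset.sum_bij (fun h _ => T.π.onH h) ?_ ?_ ?_ ?_
      · intro h hh
        simp only [Finset.mem_filter, Finset.mem_univ, true_and] at hh ⊢
        rw [← T.π.root_comm, hh]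
      · intro a ha b hb hab
        simp only [Finset.mem_filter, Finset.mem_univ, true_and] at ha hb
        exact (T.existsUnique_lift v (T.π.onH a) (by rw [← T.π.root_comm, ha])).unique
          ⟨ha, rfl⟩ ⟨hb, hab.symm⟩
      · intro b hb
        simp only [Finset.mem_filter, Finset.mem_univ, true_and] at hb
        obtain ⟨a, ha, -⟩ := T.existsUnique_lift v b hb
        exact ⟨a, by simpa using ha.1, ha.2⟩
      · intro _ _; rfl⟩
  map_add' a b := rfl
  map_smul' r a := rfl

/-- The integration pairing on the top graph, in the second variable restricted to `Ker π_*`. -/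
def kerPair (ℓ : K.EdgeLength) :
    T.Gt.cycles →ₗ[ℤ] LinearMap.ker T.pushCycles →ₗ[ℤ] ℝ :=
  (T.Gt.intPair (T.lenTop ℓ)).compl₂ (LinearMap.ker T.pushCycles).subtype

theorem kerPair_pull (ℓ : K.EdgeLength) :
    LinearMap.range T.pullForms ≤ LinearMap.ker (T.kerPair ℓ) := by
  rintro _ ⟨a, rfl⟩
  rw [LinearMap.mem_ker]
  ext c
  have hc : push T.π.onH c.1.1 = 0 := congrArg Subtype.val (LinearMap.mem_ker.mp c.2)
  change (1 / 2 : ℝ) * ∑ h, (a.1 (T.π.onH h) : ℝ) * (c.1.1 h : ℝ) * T.lenTop ℓ h = 0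
  have : ∑ h, (a.1 (T.π.onH h) : ℝ) * (c.1.1 h : ℝ) * T.lenTop ℓ h = 0 := by
    rw [← Finset.sum_fiberwise (g := T.π.onH)]
    refine Finset.sum_eq_zero fun y _ => ?_
    have h0 : ∑ h with T.π.onH h = y, (c.1.1 h : ℝ) = 0 := by
      have := congrFun hc y
      simp only [push, Pi.zero_apply] at this
      exact_mod_cast this
    calc _ = ∑ h with T.π.onH h = y, (a.1 y : ℝ) * T.len ℓ y * (c.1.1 h : ℝ) := by
          refine Finset.sum_congr rfl fun h hh => ?_
          simp only [Finset.mem_filter, Finset.mem_univ, true_and] at hh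
          simp only [lenTop, T.π_free.2, hh]
          ring
      _ = 0 := by rw [← Finset.mul_sum, h0, mul_zero]
  rw [this, mul_zero]

/-- The cokernel of `π^*`. -/
abbrev Coker : Type u := T.Gt.cycles ⧸ LinearMap.range T.pullForms

/-- The pairing on the cokernel of `π^*`. -/
def cokerPair (ℓ : K.EdgeLength) :
    T.Coker →ₗ[ℤ] LinearMap.ker T.pushCycles →ₗ[ℤ] ℝ :=
  (LinearMap.range T.pullForms).liftQ (T.kerPair ℓ) (T.kerPair_pull ℓ)

theorem cokerPair_torsion (ℓ : K.EdgeLength) :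
    Submodule.torsion ℤ T.Coker ≤ LinearMap.ker (T.cokerPair ℓ) := by
  intro x hx
  obtain ⟨r, hr⟩ := (Submodule.mem_torsion_iff x).mp hx
  rw [LinearMap.mem_ker]
  ext c
  have h1 : (r : ℤ) • T.cokerPair ℓ x c = 0 := by
    have h2 : (r : ℤ) • x = 0 := hr
    have h3 : T.cokerPair ℓ ((r : ℤ) • x) c = 0 := by rw [h2]; simp
    simpa using h3
  have hr0 : (r : ℤ) ≠ 0 := nonZeroDivisors.ne_zero r.2
  rcases smul_eq_zero.mp h1 with h | h
  · exact absurd h hr0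
  · exact h

/-- The Prym variety `((Coker π^*)^tf, Ker π_*, [·, ·])` of the double cover `π : Gt → G`. -/
def prym (ℓ : K.EdgeLength) : Pairing.{u} where
  L := T.Coker ⧸ Submodule.torsion ℤ T.Coker
  L' := LinearMap.ker T.pushCycles
  pair := (Submodule.torsion ℤ T.Coker).liftQ (T.cokerPair ℓ) (T.cokerPair_torsion ℓ)

/-- The induced polarization `Ker π_* → H₁(Gt, ℤ) = Ω¹(Gt) → (Coker π^*)^tf`. -/
def inducedPolarization (ℓ : K.EdgeLength) : (T.prym ℓ).L' →ₗ[ℤ] (T.prym ℓ).L :=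
  (Submodule.torsion ℤ T.Coker).mkQ ∘ₗ (LinearMap.range T.pullForms).mkQ ∘ₗ
    (LinearMap.ker T.pushCycles).subtype

/-- The Prym variety is a tropical abelian variety, and `ζ` is half of the induced polarization and
is a principal polarization. (As the target of `ζ` is torsion free, there is at most one
such `ζ`.) -/
def IsPrymPolarization (ℓ : K.EdgeLength) (ζ : (T.prym ℓ).L' →ₗ[ℤ] (T.prym ℓ).L) : Prop :=
  (T.prym ℓ).IsTAV ∧ (2 : ℤ) • ζ = T.inducedPolarization ℓ ∧ (T.prym ℓ).IsPrincipal ζ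

end Tower

end

end TropDonagi

namespace TropDonagi

/-! ## The four-dimensional cube -/

/-! The mechanism is the triality of the root system `D₄`, made explicit by a Hadamard matrix. Over
a point `x` of `K`, list the points of `f⁻¹(x)` with multiplicity as four labels and lift the labels
to `Γ̃`: this is a frame (`IsFrame`). The sections over `x` are the images of the vertices of a cube
`{±1}⁴`, and local degrees count the vertices lying over a section (`sum_cube_eq`). Dilation only
makes labels coincide, so all dilation profiles are treated at once. The points of `Γ̃` over `x`
play the role of the vectors `±eᵢ`, the two sheets that of the even and the odd vertices of the
cube.

The eight even vertices are the rows of the Hadamard matrix `had` and their complements, so the rows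
label the fibre of the even sheet, again by a frame (`IsSheet.isFrame`). Half the Hadamard matrix is
an orthogonal involution which exchanges the vectors with the even vertices and permutes the odd
ones. Hence a section of the even sheet is either the pencil of sections through a point of `Γ̃`
(`vec`) or the set of neighbours of an odd section (`adj`). The two kinds have opposite parities
(`not_parity_vec_adj`), their local degrees are those of the original objects (`degree_vec`,
`degree_adj`), and both are preserved by root, bar and swap because dual frames are functorial
(`DualFrame.map`). This gives orientability and triality. Genericity enters as the absence of
swap-invariant sections (`NoFixed`), which is inherited by the outputs.

For the Prym varieties, let `ι` be the deck involution. If `Γ̃` is connected, every anti-invariant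
cycle is of the form `b - ι b` (`exists_sub_swap`), and `b + ι b` vanishes in the torsion-free
cokernel; so the induced polarization is divisible by two, and its half is automatically principal.
It remains to find an isometry of the lattices of anti-invariant cycles. The incidence
correspondence between half-edges of `Γ̃` and sections, together with its transpose, gives two maps
of these lattices which are adjoint for the length pairings (`intPair_incidenceMap`) and compose to
multiplication by four. Over a tree both are divisible by two, since a chain on a tree which is a
cycle modulo two is even (`even_of_even`). Their halves are inverse to each other and adjoint, hence
isometries. -/

/-- The Hadamard matrix of order four, with entries in `Bool`. -/
def had : Fin 4 → Fin 4 → Bool :=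
  ![![false, false, false, false], ![false, true, false, true],
    ![false, false, true, true], ![false, true, true, false]]

/-- The number of `true` entries is even. -/
def evenB (b : Fin 4 → Bool) : Bool := !(b 0 ^^ b 1 ^^ b 2 ^^ b 3)

/-- Change the `i`-th entry. -/
def flipAt (b : Fin 4 → Bool) (i : Fin 4) : Fin 4 → Bool := fun k => b k ^^ decide (k = i)

/-- For odd `ρ`, the row `had j` or its complement is adjacent to `ρ`; this tells which. -/
def near (ρ : Fin 4 → Bool) (j : Fin 4) : Bool :=
  ((had j 0 ^^ ρ 0) && (had j 1 ^^ ρ 1)) || ((had j 2 ^^ ρ 2) && (had j 3 ^^ ρ 3))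

/-- The sign of a Boolean. -/
def sgn (t : Bool) : ℤ := if t then -1 else 1

theorem sgn_xor (a b : Bool) : sgn (a ^^ b) = sgn a * sgn b := by
  cases a <;> cases b <;> rfl

theorem xor_xor_cancel (a b : Bool) : (a ^^ (a ^^ b)) = b := by
  cases a <;> cases b <;> rfl

theorem had_symm (i j : Fin 4) : had i j = had j i := by revert i j; decide

theorem evenB_had (j : Fin 4) (t : Bool) : evenB (fun i => had j i ^^ t) = true := by
  revert j t; decide

theorem evenB_had_col (i : Fin 4) (t : Bool) : evenB (fun j => had j i ^^ t) = true := by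
  revert i t; decide

/-- There are eight even vertices, and the four rows with their complements are eight distinct ones.
-/
theorem exists_had (b : Fin 4 → Bool) (hb : evenB b = true) :
    ∃ j t, b = fun i => had j i ^^ t := by
  revert b; decide

theorem had_inj (j j' : Fin 4) (t t' : Bool)
    (h : (fun i => had j i ^^ t) = fun i => had j' i ^^ t') : j = j' ∧ t = t' := by
  revert j j' t t'; decide

/-- Rows are even, so an odd `ρ` differs from a row in one or three places. It is three exactly when
one of the pairs `{0, 1}`, `{2, 3}` consists of disagreements, which is what `near` tests; the
complement of the row is then the neighbour. -/
theorem near_flip (ρ : Fin 4 → Bool) (h : evenB ρ = false) (j : Fin 4) :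
    ∃ i, (fun k => had j k ^^ near ρ j) = flipAt ρ i := by
  revert ρ j; decide

theorem evenB_not (b : Fin 4 → Bool) : evenB (fun i => !b i) = evenB b := by
  revert b; decide

theorem evenB_xor_had (b : Fin 4 → Bool) (j : Fin 4) :
    evenB b = evenB fun i => b i ^^ had j i := by
  revert b j; decide

theorem near_odd (ρ : Fin 4 → Bool) (h : evenB ρ = false) : evenB (near ρ) = false := by
  revert ρ; decide

/-- In signs, `near` is multiplication by half the Hadamard matrix, which is symmetric and
orthogonal and hence an involution. -/
theorem near_near (ρ : Fin 4 → Bool) (h : evenB ρ = false) : near (near ρ) = ρ := by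
  revert ρ; decide

theorem near_not (ρ : Fin 4 → Bool) (h : evenB ρ = false) :
    near (fun i => !ρ i) = fun j => !near ρ j := by
  revert ρ; decide

theorem evenB_iff (b b' : Fin 4 → Bool) :
    (evenB b = evenB b') ↔ Even (∑ i, (if b i = b' i then (0 : ℤ) else 1)) := by
  revert b b'; decide

theorem sum_sgn_had (i k : Fin 4) :
    ∑ j, sgn (had j k) * sgn (had j i) = if k = i then 4 else 0 := by
  revert i k; decide

theorem sum_sgn_flipAt (b : Fin 4 → Bool) (k : Fin 4) :
    ∑ i, sgn (flipAt b i k) = 2 * sgn (b k) := by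
  revert b k; decide

/-! ### Reindexing of sums over the even and the odd vertices of the cube. -/

section sums

variable {M : Type*} [AddCommMonoid M] (g : (Fin 4 → Bool) → M)

theorem sum_even : ∑ b with evenB b = true, g b = ∑ j, ∑ t, g (fun i => had j i ^^ t) := by
  rw [← Fintype.sum_prod_type' (fun j t => g (fun i => had j i ^^ t))]
  symm
  refine Finset.sum_bij (fun q _ => fun i => had q.1 i ^^ q.2) ?_ ?_ ?_ ?_
  · intro q _
    simpa using evenB_had q.1 q.2
  · intro q _ q' _ h
    exact Prod.ext (had_inj _ _ _ _ h).1 (had_inj _ _ _ _ h).2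
  · intro b hb
    obtain ⟨j, t, h⟩ := exists_had b (by simpa using hb)
    exact ⟨(j, t), by simp, h.symm⟩
  · intro _ _; rfl

/-- Of each row and its complement exactly one has `i`-th entry `ε`, namely the twist by `had j i ^^
ε`. This is where columns of the Hadamard matrix come in as vertices of the dual cube. -/
theorem sum_even_at (i : Fin 4) (ε : Bool) :
    ∑ b with evenB b = true ∧ b i = ε, g b = ∑ j, g (fun k => had j k ^^ (had j i ^^ ε)) := by
  rw [← Finset.filter_filter, Finset.sum_filter, sum_even]
  refine Finset.sum_congr rfl fun j _ => ?_
  rw [Finset.sum_eq_single (had j i ^^ ε)]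
  · rw [if_pos (xor_xor_cancel _ _)]
  · intro t _ ht
    rw [if_neg]
    rintro rfl
    exact ht (xor_xor_cancel _ _).symm
  · simp

theorem sum_near (ρ : Fin 4 → Bool) (h : evenB ρ = false) :
    ∑ j, g (fun k => had j k ^^ near ρ j) = ∑ i, g (flipAt ρ i) := by
  choose e he using near_flip ρ h
  have hinj : Function.Injective e := by
    intro j j' hj
    have := (he j).trans ((congrArg (flipAt ρ) hj).trans (he j').symm)
    exact (had_inj _ _ _ _ this).1
  rw [← Equiv.sum_comp (Equiv.ofBijective e (Finite.injective_iff_bijective.mp hinj))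
    (fun i => g (flipAt ρ i))]
  exact Finset.sum_congr rfl fun j _ => congrArg g (he j)

theorem sum_odd_near :
    ∑ ρ with evenB ρ = false, g (near ρ) = ∑ t with evenB t = false, g t := by
  refine Finset.sum_nbij' near near ?_ ?_ ?_ ?_ ?_
  · intro ρ hρ; simpa using near_odd ρ (by simpa using hρ)
  · intro ρ hρ; simpa using near_odd ρ (by simpa using hρ)
  · intro ρ hρ; exact near_near ρ (by simpa using hρ)
  · intro ρ hρ; exact near_near ρ (by simpa using hρ)
  · intro _ _; rfl

end sums

end TropDonagi

namespace TropDonagi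

open scoped Classical

noncomputable section

/-! ## Free double covers of finite sets -/

section doubleCover

variable {A B C : Type*} [Fintype A] {π : A → B} {s : A → A}

theorem eq_or_eq_swap (h2 : ∀ y, (Finset.univ.filter fun a => π a = y).card = 2)
    (hs : ∀ a, π (s a) = π a) (hne : ∀ a, s a ≠ a) {a b : A} (h : π b = π a) :
    b = a ∨ b = s a := by
  have hb : b ∈ (Finset.univ.filter fun c => π c = π a) := by simpa using h
  rw [fibre_eq h2 hs hne] at hb
  simpa using hb

theorem push_double (h2 : ∀ y, (Finset.univ.filter fun a => π a = y).card = 2)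
    (hs : ∀ a, π (s a) = π a) (hne : ∀ a, s a ≠ a) {M : Type*} [AddCommMonoid M] (D : A → M)
    (a : A) : push π D (π a) = D a + D (s a) := by
  simp only [push]
  rw [fibre_eq h2 hs hne, Finset.sum_pair (hne a).symm]

theorem ext_of_push (h2 : ∀ y, (Finset.univ.filter fun a => π a = y).card = 2)
    (hs : ∀ a, π (s a) = π a) (hne : ∀ a, s a ≠ a) (l : B → A) (hl : ∀ y, π (l y) = y)
    {D E : A → ℕ} (h : push π D = push π E) (h' : ∀ y, D (l y) = E (l y)) : D = E := by
  funext a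
  rcases eq_or_eq_swap h2 hs hne (hl (π a)).symm with e | e
  · rw [e]; exact h' _
  · have h3 := congrFun h (π (l (π a)))
    rw [push_double h2 hs hne, push_double h2 hs hne, ← e, h'] at h3
    omega

/-- The number of ways to lift a labelled divisor to a given effective divisor. -/
theorem card_lifts [Fintype B] (h2 : ∀ y, (Finset.univ.filter fun a => π a = y).card = 2)
    (hs : ∀ a, π (s a) = π a) (hne : ∀ a, s a ≠ a) (l : B → A) (hl : ∀ y, π (l y) = y)
    {I : Type*} [Fintype I] (m : I → B) (D : A → ℕ)
    (hD : push π D = push m fun _ => 1) :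
    (Finset.univ.filter fun σ : I → A => (∀ i, π (σ i) = m i) ∧ push σ (fun _ => 1) = D).card =
      ∏ y, (push m (fun _ => 1) y).choose (D (l y)) := by
  have hm : ∀ y, push m (fun _ => 1) y = (Finset.univ.filter fun i => m i = y).card := by
    intro y; simp [push]
  have key : (Fintype.piFinset fun y =>
      Finset.powersetCard (D (l y)) (Finset.univ.filter fun i => m i = y)).card =
      ∏ y, (push m (fun _ => 1) y).choose (D (l y)) := by
    rw [Fintype.card_piFinset]
    exact Finset.prod_congr rfl fun y _ => by rw [Finset.card_powersetCard, hm]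
  rw [← key]
  -- Over each `y` a lift is the choice of those labels which go to `l y`; there must be `D (l y)`
  -- of them, and the others go to the conjugate point.
  refine Finset.card_bij'
    (fun σ _ y => Finset.univ.filter fun i => m i = y ∧ σ i = l y)
    (fun g _ i => if i ∈ g (m i) then l (m i) else s (l (m i))) ?_ ?_ ?_ ?_
  · intro σ hσ
    simp only [Finset.mem_filter, Finset.mem_univ, true_and] at hσ
    rw [Fintype.mem_piFinset]
    intro y
    rw [Finset.mem_powersetCard]
    refine ⟨fun i hi => ?_, ?_⟩
    · simp only [Finset.mem_filter, Finset.mem_univ, true_and] at hi ⊢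
      exact hi.1
    · rw [← hσ.2]
      simp only [push, Finset.sum_const, smul_eq_mul, mul_one]
      congr 1
      ext i
      simp only [Finset.mem_filter, Finset.mem_univ, true_and, and_iff_right_iff_imp]
      intro e
      rw [← hσ.1, e, hl]
  · intro g hg
    rw [Fintype.mem_piFinset] at hg
    simp only [Finset.mem_powersetCard] at hg
    simp only [Finset.mem_filter, Finset.mem_univ, true_and]
    have hπ : ∀ i, π (if i ∈ g (m i) then l (m i) else s (l (m i))) = m i := by
      intro i; split_ifs <;> simp [hs, hl]
    refine ⟨hπ, ext_of_push h2 hs hne l hl ?_ fun y => ?_⟩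
    · rw [push_push, hD]
      exact congrArg (fun k => push k fun _ => 1) (funext hπ)
    · simp only [push, Finset.sum_const, smul_eq_mul, mul_one]
      rw [← (hg y).2]
      congr 1
      ext i
      simp only [Finset.mem_filter, Finset.mem_univ, true_and]
      constructor
      · intro e
        have hi : m i = y := by rw [← hπ i, e, hl]
        subst hi
        by_contra hc
        rw [if_neg hc] at e
        exact hne _ e
      · intro hi
        have hy : m i = y := by simpa using (hg y).1 hi
        subst hy
        rw [if_pos hi]
  · intro σ hσ
    simp only [Finset.mem_filter, Finset.mem_univ, true_and] at hσ
    funext i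
    simp only [Finset.mem_filter, Finset.mem_univ, true_and]
    split_ifs with e
    · exact e.symm
    · rcases eq_or_eq_swap h2 hs hne (a := l (m i)) (b := σ i) (by rw [hσ.1, hl]) with e' | e'
      · exact absurd e' e
      · exact e'.symm
  · intro g hg
    rw [Fintype.mem_piFinset] at hg
    simp only [Finset.mem_powersetCard] at hg
    funext y
    ext i
    simp only [Finset.mem_filter, Finset.mem_univ, true_and]
    constructor
    · rintro ⟨rfl, e⟩
      by_contra hc
      rw [if_neg hc] at e
      exact hne _ e
    · intro hi
      have hy : m i = y := by simpa using (hg y).1 hi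
      subst hy
      exact ⟨rfl, if_pos hi⟩

end doubleCover

/-! ## Frames -/

/-- The fibrewise structure of a tower: `π` is two-to-one with deck transformation `s`, the fibres
of `f` have total degree four. -/
structure TetragonalFibres {A B C : Type*} [Fintype A] [Fintype B] (π : A → B) (s : A → A) (f : B → C)
    (d : B → ℕ) : Prop where
  card_fibre : ∀ y, (Finset.univ.filter fun a => π a = y).card = 2
  π_swap : ∀ a, π (s a) = π a
  swap_ne : ∀ a, s a ≠ a
  pos : ∀ y, 0 < d y
  total : ∀ x, ∑ y with f y = x, d y = 4

/-- No section is invariant under `s`. -/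
def NoFixed {A B C : Type*} [Fintype A] (π : A → B) (s : A → A) (f : B → C) (d : B → ℕ) : Prop :=
  ∀ p : Sections π f d, push s p.1.2 ≠ p.1.2

/-- A labelling of the pull-back of `x` by four labels, lifted to the double cover. -/
def IsFrame {A B C : Type*} (π : A → B) (f : B → C) (d : B → ℕ) (x : C) (l : Fin 4 → A) : Prop :=
  push (fun i => π (l i)) (fun _ => 1) = pull f d x

/-- Replace the lifts `l i` with `b i = true` by their conjugates. -/
def twist {A : Type*} (s : A → A) (l : Fin 4 → A) (b : Fin 4 → Bool) : Fin 4 → A :=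
  fun i => bif b i then s (l i) else l i

/-- The effective divisor `∑ i, twist s l b i`. -/
def cube {A : Type*} (s : A → A) (l : Fin 4 → A) (b : Fin 4 → Bool) : A → ℕ :=
  push (twist s l b) fun _ => 1

theorem push_one_apply {I A : Type*} [Fintype I] (σ : I → A) (a : A) :
    push σ (fun _ => 1) a = ∑ i, if σ i = a then 1 else 0 := by
  simp [push]

theorem sum_push_one {I A : Type*} [Fintype I] [Fintype A] {M : Type*} [CommSemiring M] (σ : I → A)
    (g : A → M) : ∑ a, ((push σ (fun _ => 1) a : ℕ) : M) * g a = ∑ i, g (σ i) := by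
  simp only [push_one_apply, Nat.cast_sum, Nat.cast_ite, Nat.cast_one, Nat.cast_zero,
    Finset.sum_mul, ite_mul, one_mul, zero_mul]
  rw [Finset.sum_comm]
  simp

/-- The signed indicator of a point. -/
def signedInd {A : Type*} (s : A → A) (a c : A) : ℤ :=
  (if a = c then 1 else 0) - (if a = s c then 1 else 0)

section frames

variable {A B C : Type*} [Fintype A] [Fintype B] {π : A → B} {s : A → A} {f : B → C} {d : B → ℕ}
  {x : C} {l : Fin 4 → A}

omit [Fintype B] in
theorem Sections.ext' {p q : Sections π f d} (h1 : p.1.1 = q.1.1) (h2 : p.1.2 = q.1.2) : p = q :=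
  Subtype.ext (Prod.ext h1 h2)

/-- The involution on sections. -/
def secSwap (h : TetragonalFibres π s f d) (p : Sections π f d) : Sections π f d :=
  ⟨(p.1.1, push s p.1.2), by
    have e : π ∘ s = π := funext h.π_swap
    rw [push_push, e]; exact p.2⟩

namespace TetragonalFibres

variable (h : TetragonalFibres π s f d)
include h

theorem swap_swap (a : A) : s (s a) = a := fibre_invol h.card_fibre h.π_swap h.swap_ne a

theorem surj : Function.Surjective π := fibre_surj h.card_fibre

theorem eq_or {a b : A} (e : π b = π a) : b = a ∨ b = s a :=
  eq_or_eq_swap h.card_fibre h.π_swap h.swap_ne e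

theorem swap_eq_iff (a b : A) : s a = b ↔ a = s b := by
  constructor
  · rintro rfl; exact (h.swap_swap a).symm
  · rintro rfl; exact h.swap_swap b

theorem apply_add (p : Sections π f d) (a : A) : p.1.2 a + p.1.2 (s a) = pull f d p.1.1 (π a) :=
  section_add h.card_fibre h.π_swap h.swap_ne p a

theorem secSwap_swap (p : Sections π f d) : secSwap h (secSwap h p) = p :=
  Sections.ext' rfl (push_push_involutive s h.swap_swap p.1.2)

theorem secSwap_apply (p : Sections π f d) (a : A) : (secSwap h p).1.2 a = p.1.2 (s a) :=
  push_involutive s h.swap_swap p.1.2 a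

/-- The sums `D(a) + D(s a)` are prescribed by the base point, so the differences determine a
section. Differences are the coordinates in which the cube is linear. -/
theorem ext_signed {p q : Sections π f d} (h1 : p.1.1 = q.1.1)
    (h2 : ∀ a, (p.1.2 a : ℤ) - p.1.2 (s a) = q.1.2 a - q.1.2 (s a)) : p = q := by
  refine Sections.ext' h1 (funext fun a => ?_)
  have e1 := h.apply_add p a
  have e2 := h.apply_add q a
  rw [h1] at e1
  have := h2 a
  omega

/-- Each `y` over `x` is repeated `d y` times; the total degree four is the number of labels. -/
theorem exists_frame (x : C) : ∃ l, IsFrame π f d x l := by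
  have hc : Fintype.card (Σ y : {y // f y = x}, Fin (d y)) = 4 := by
    rw [Fintype.card_sigma]
    simp only [Fintype.card_fin]
    rw [← h.total x, ← Finset.sum_subtype_eq_sum_filter]
    simp
  let e := (Fintype.equivFinOfCardEq hc).symm
  refine ⟨fun i => Function.surjInv h.surj (e i).1, ?_⟩
  funext y
  rw [push_one_apply]
  simp only [Function.surjInv_eq]
  rw [Equiv.sum_comp e (fun q => if (q.1 : B) = y then 1 else 0), Fintype.sum_sigma]
  unfold pull
  split_ifs with hy
  · rw [Finset.sum_eq_single ⟨y, hy⟩]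
    · simp
    · intro b _ hb
      exact Finset.sum_eq_zero fun _ _ => if_neg fun hb' => hb (Subtype.ext hb')
    · simp
  · refine Finset.sum_eq_zero fun b _ => Finset.sum_eq_zero fun _ _ => if_neg ?_
    rintro rfl
    exact hy b.2

theorem π_twist (l : Fin 4 → A) (b : Fin 4 → Bool) (i : Fin 4) : π (twist s l b i) = π (l i) := by
  unfold twist; cases b i <;> simp [h.π_swap]

theorem isFrame_twist (hl : IsFrame π f d x l) (b : Fin 4 → Bool) :
    IsFrame π f d x (twist s l b) := by
  unfold IsFrame
  simp only [h.π_twist]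
  exact hl

theorem push_cube (hl : IsFrame π f d x l) (b : Fin 4 → Bool) :
    push π (cube s l b) = pull f d x := by
  unfold cube
  rw [push_push, ← hl]
  exact congrArg (fun k => push k fun _ => 1) (funext fun i => h.π_twist l b i)

theorem twist_twist (l : Fin 4 → A) (b c : Fin 4 → Bool) :
    twist s (twist s l b) c = twist s l fun i => b i ^^ c i := by
  funext i
  simp only [twist]
  cases hb : b i <;> cases hc : c i <;> simp [h.swap_swap]

theorem cube_twist (l : Fin 4 → A) (b c : Fin 4 → Bool) :
    cube s (twist s l b) c = cube s l fun i => b i ^^ c i := by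
  unfold cube; rw [h.twist_twist]

theorem push_swap_cube (l : Fin 4 → A) (b : Fin 4 → Bool) :
    push s (cube s l b) = cube s l fun i => !b i := by
  unfold cube
  rw [push_push]
  congr 1
  funext i
  simp only [Function.comp, twist]
  cases hb : b i <;> simp [h.swap_swap]

/-- Antisymmetrization makes a vertex of the cube linear in its signs, so that orthogonality of the
Hadamard matrix can be applied. -/
theorem cube_sub (l : Fin 4 → A) (b : Fin 4 → Bool) (a : A) :
    (cube s l b a : ℤ) - cube s l b (s a) = ∑ i, sgn (b i) * signedInd s (l i) a := by
  unfold cube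
  rw [push_one_apply, push_one_apply]
  push_cast
  rw [← Finset.sum_sub_distrib]
  refine Finset.sum_congr rfl fun i _ => ?_
  unfold twist sgn signedInd
  cases b i
  · simp
  · simp only [if_true, cond_true, h.swap_eq_iff, h.swap_swap]
    ring

theorem twist_injective (l : Fin 4 → A) : Function.Injective (twist s l) := by
  intro b c e
  funext i
  have := congrFun e i
  unfold twist at this
  cases hb : b i <;> cases hc : c i <;> simp [hb, hc, h.swap_ne, (h.swap_ne _).symm] at this ⊢

theorem exists_twist (l : Fin 4 → A) (σ : Fin 4 → A) (hσ : ∀ i, π (σ i) = π (l i)) :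
    ∃ b, σ = twist s l b := by
  refine ⟨fun i => decide (σ i ≠ l i), funext fun i => ?_⟩
  unfold twist
  by_cases e : σ i = l i
  · simp [e]
  · simpa [e] using (h.eq_or (hσ i)).resolve_left e

theorem sum_twist {M : Type*} [AddCommMonoid M] (l : Fin 4 → A) (g : (Fin 4 → A) → M) :
    ∑ b, g (twist s l b) = ∑ σ with ∀ i, π (σ i) = π (l i), g σ := by
  refine Finset.sum_bij (fun b _ => twist s l b) ?_ ?_ ?_ ?_
  · intro b _
    simp [h.π_twist]
  · intro b _ c _ e
    exact h.twist_injective l e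
  · intro σ hσ
    obtain ⟨b, e⟩ := h.exists_twist l σ (by simpa using hσ)
    exact ⟨b, by simp, e.symm⟩
  · intro _ _; rfl

/-- The local degree of a section counts the vertices of the cube lying over it. -/
theorem sum_cube_eq (m : B → A) (hm : ∀ y, π (m y) = y) (p : Sections π f d)
    (hl : IsFrame π f d p.1.1 l) :
    ∑ b, (if cube s l b = p.1.2 then 1 else 0) = sectionDegree m p := by
  refine (h.sum_twist l (fun σ => if push σ (fun _ => 1) = p.1.2 then 1 else 0)).trans ?_
  rw [← Finset.sum_filter, Finset.filter_filter, Finset.sum_const, smul_eq_mul, mul_one]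
  trans ∏ y, (push (fun i => π (l i)) (fun _ => 1) y).choose (p.1.2 (m y))
  · convert card_lifts h.card_fibre h.π_swap h.swap_ne m hm (fun i => π (l i)) p.1.2
      (p.2.trans hl.symm)
  unfold sectionDegree
  rw [Finset.prod_filter]
  refine Finset.prod_congr rfl fun y _ => ?_
  rw [hl]
  unfold pull
  split_ifs with hy
  · rfl
  -- Outside the fibre both arguments vanish and the factor is `Nat.choose 0 0`.
  · have := h.apply_add p (m y)
    rw [hm, pull, if_neg hy] at this
    rw [show p.1.2 (m y) = 0 by omega]
    rfl

omit h in
theorem sectionDegree_pos (m : B → A) (hm : ∀ y, π (m y) = y) (p : Sections π f d) :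
    0 < sectionDegree m p := by
  refine Finset.prod_pos fun y hy => Nat.choose_pos ?_
  have := p.le (m y)
  rwa [hm] at this

theorem exists_cube (p : Sections π f d) (hl : IsFrame π f d p.1.1 l) :
    ∃ b, cube s l b = p.1.2 := by
  have h0 := sectionDegree_pos _ (Function.surjInv_eq h.surj) p
  rw [← h.sum_cube_eq _ (Function.surjInv_eq h.surj) p hl] at h0
  obtain ⟨b, -, hb⟩ := Finset.exists_ne_zero_of_sum_ne_zero h0.ne'
  exact ⟨b, by simpa using hb⟩

/-- Double counting of pairs of a vertex over `p` and a label lifted to `a`. There are `p.1.2 a`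
such labels for each vertex; on the other hand the `d (π a)` labels over `π a` contribute equally.
-/
theorem sum_cube_at (m : B → A) (hm : ∀ y, π (m y) = y) (p : Sections π f d)
    (hl : IsFrame π f d p.1.1 l) (i : Fin 4) (a : A) (ha : π (l i) = π a) :
    (∑ b, if cube s l b = p.1.2 ∧ twist s l b i = a then 1 else 0) * d (π a) =
      sectionDegree m p * p.1.2 a := by
  let N : Fin 4 → ℕ := fun j => ∑ b, if cube s l b = p.1.2 ∧ twist s l b j = a then 1 else 0
  have hN : ∀ j, N j = ∑ σ with ∀ i, π (σ i) = π (l i),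
      if push σ (fun _ => 1) = p.1.2 ∧ σ j = a then 1 else 0 := fun j =>
    h.sum_twist l (fun σ => if push σ (fun _ => 1) = p.1.2 ∧ σ j = a then 1 else 0)
  -- Transposing two labels with the same image in `B` permutes the lifts without changing their
  -- divisor.
  have hsymm : ∀ j, π (l j) = π a → N j = N i := by
    intro j hj
    rw [hN, hN]
    have hperm : ∀ k, π (l (Equiv.swap i j k)) = π (l k) := by
      intro k
      rcases eq_or_ne k i with rfl | hki
      · rw [Equiv.swap_apply_left, hj, ha]
      rcases eq_or_ne k j with rfl | hkj
      · rw [Equiv.swap_apply_right, hj, ha]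
      · rw [Equiv.swap_apply_of_ne_of_ne hki hkj]
    have hpush : ∀ σ : Fin 4 → A,
        push (fun k => σ (Equiv.swap i j k)) (fun _ => 1) = push σ (fun _ => 1) := by
      intro σ
      funext c
      rw [push_one_apply, push_one_apply]
      exact Equiv.sum_comp (Equiv.swap i j) (fun k => if σ k = c then 1 else 0)
    refine Finset.sum_nbij' (fun σ k => σ (Equiv.swap i j k)) (fun σ k => σ (Equiv.swap i j k))
      ?_ ?_ ?_ ?_ ?_
    · intro σ hσ
      simp only [Finset.mem_filter, Finset.mem_univ, true_and] at hσ ⊢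
      exact fun k => (hσ _).trans (hperm k)
    · intro σ hσ
      simp only [Finset.mem_filter, Finset.mem_univ, true_and] at hσ ⊢
      exact fun k => (hσ _).trans (hperm k)
    · intro σ _; funext k; simp
    · intro σ _; funext k; simp
    · intro σ _
      simp only [hpush, Equiv.swap_apply_left]
  have h1 : ∑ j, (if π (l j) = π a then N j else 0) = N i * d (π a) := by
    have h2 : d (π a) = ∑ j, if π (l j) = π a then 1 else 0 := by
      rw [← push_one_apply (fun j => π (l j)), hl]
      unfold pull
      rw [if_pos]
      have h3 := congrFun hl (π a)
      rw [push_one_apply] at h3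
      by_contra hc
      rw [pull, if_neg hc] at h3
      have := (Finset.sum_eq_zero_iff.mp h3) i (Finset.mem_univ _)
      simp [ha] at this
    rw [h2, Finset.mul_sum]
    refine Finset.sum_congr rfl fun j _ => ?_
    split_ifs with hj
    · rw [hsymm j hj, mul_one]
    · simp
  have h2 : ∀ j, (if π (l j) = π a then N j else 0) = N j := by
    intro j
    split_ifs with hj
    · rfl
    · symm
      refine Finset.sum_eq_zero fun b _ => if_neg ?_
      rintro ⟨-, rfl⟩
      exact hj (h.π_twist l b j).symm
  rw [← h1, Finset.sum_congr rfl fun j _ => h2 j, Finset.sum_comm, ← h.sum_cube_eq m hm p hl,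
    Finset.sum_mul]
  refine Finset.sum_congr rfl fun b _ => ?_
  by_cases hb : cube s l b = p.1.2
  · simp only [hb, true_and, if_true, one_mul]
    rw [← hb, cube, push_one_apply]
  · simp [hb]

/-- The parity relation in terms of a frame. -/
theorem parity_iff (p q : Sections π f d) (hx : p.1.1 = q.1.1) {b c : Fin 4 → Bool}
    (hp : cube s l b = p.1.2) (hq : cube s l c = q.1.2) :
    paritySetoid π f d p q ↔ evenB b = evenB c := by
  have key : ∀ m : B → A, (∀ y, π (m y) = y) →
      (Even (∑ y, ((p.1.2 (m y) : ℤ) - (q.1.2 (m y) : ℤ))) ↔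
        Even (∑ i, (if b i = c i then (0 : ℤ) else 1))) := by
    intro m hm
    -- Label `i` contributes only at `y = π (l i)`, so the sum counts the labels whose lift is the
    -- marked preimage. Flipping a label therefore changes it by one.
    have h1 : ∀ b, ∑ y, (cube s l b (m y) : ℤ) =
        ∑ i, if twist s l b i = m (π (l i)) then 1 else 0 := by
      intro b
      simp only [cube, push_one_apply]
      push_cast
      rw [Finset.sum_comm]
      refine Finset.sum_congr rfl fun i _ => ?_
      rw [Finset.sum_eq_single (π (l i))]
      · intro y _ hy
        rw [if_neg]
        intro e
        apply hy
        rw [← hm y, ← e, h.π_twist]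
      · simp
    rw [Finset.sum_sub_distrib, ← hp, ← hq, h1, h1, ← Finset.sum_sub_distrib]
    rw [← Int.even_sub, ← Finset.sum_sub_distrib]
    refine Finset.even_sum _ fun i _ => ?_
    unfold twist
    have hmi : m (π (l i)) = l i ∨ m (π (l i)) = s (l i) := h.eq_or (hm _)
    have n1 := h.swap_ne (l i)
    have n2 := (h.swap_ne (l i)).symm
    rcases hmi with e | e <;> rw [e] <;> cases b i <;> cases c i <;> simp [n1, n2]
  rw [evenB_iff]
  constructor
  · intro e
    exact (key _ (Function.surjInv_eq h.surj)).mp (e.2 _ (Function.surjInv_eq h.surj))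
  · intro e
    exact ⟨hx, fun m hm => (key m hm).mpr e⟩

end TetragonalFibres

end frames

end

end TropDonagi

namespace TropDonagi

open scoped Classical

set_option linter.unusedSectionVars false

noncomputable section

/-! ## Sheets of sections -/

/-- The map `e` embeds `A'` as one parity class of sections in every fibre, and `A' → B' → C` with
`s'` and `d'` is the structure induced on it. -/
structure IsSheet {A B C A' B' : Type*} [Fintype A] [Fintype B] (π : A → B) (s : A → A) (f : B → C)
    (d : B → ℕ) (m : B → A) (e : A' → Sections π f d) (π' : A' → B') (s' : A' → A') (f' : B' → C)
    (d' : B' → ℕ) : Prop where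
  inj : Function.Injective e
  mem_iff : ∀ p q, (e p).1.1 = q.1.1 → (q ∈ Set.range e ↔ paritySetoid π f d (e p) q)
  nonempty : ∀ x, ∃ p, (e p).1.1 = x
  e_swap : ∀ p, (e (s' p)).1 = ((e p).1.1, push s (e p).1.2)
  π_surj : Function.Surjective π'
  π_eq_iff : ∀ p q, π' p = π' q ↔ q = p ∨ q = s' p
  f_π : ∀ p, f' (π' p) = (e p).1.1
  d_π : ∀ p, d' (π' p) = sectionDegree m (e p)
  m_sec : ∀ y, π (m y) = y

/-- The labels `l'` of a sheet are the sections of the cube on `l` given by the rows of the Hadamard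
matrix. -/
structure DualFrame {A B C A' : Type*} [Fintype A] {π : A → B} {f : B → C}
    {d : B → ℕ} (s : A → A) (e : A' → Sections π f d) (x : C) (l : Fin 4 → A) (l' : Fin 4 → A') :
    Prop where
  frame : IsFrame π f d x l
  dual : ∀ j, (e (l' j)).1 = (x, cube s l (had j))

section

variable {A B C A' B' : Type*} [Fintype A] [Fintype B] [Fintype A'] [Fintype B'] {π : A → B}
  {s : A → A} {f : B → C} {d : B → ℕ} {m : B → A} {e : A' → Sections π f d} {π' : A' → B'}
  {s' : A' → A'} {f' : B' → C} {d' : B' → ℕ} {x : C} {l : Fin 4 → A} {l' : Fin 4 → A'}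

theorem IsFrame.over (hl : IsFrame π f d x l) (i : Fin 4) : f (π (l i)) = x := by
  by_contra hc
  have h3 := congrFun hl (π (l i))
  rw [push_one_apply, pull, if_neg hc] at h3
  simpa using (Finset.sum_eq_zero_iff.mp h3) i (Finset.mem_univ _)

theorem TetragonalFibres.exists_label (h : TetragonalFibres π s f d) (hl : IsFrame π f d x l)
    (a : A) (ha : f (π a) = x) : ∃ i ε, (bif ε then s (l i) else l i) = a := by
  have h1 := congrFun hl (π a)
  rw [push_one_apply, pull, if_pos ha] at h1
  have h2 := h.pos (π a)
  rw [← h1] at h2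
  obtain ⟨i, -, hi⟩ := Finset.exists_ne_zero_of_sum_ne_zero h2.ne'
  have hi' : π (l i) = π a := by simpa using hi
  rcases h.eq_or hi' with e | e
  · exact ⟨i, false, e⟩
  · exact ⟨i, true, by simp [e, h.swap_swap]⟩

/-- The section of the cube on a frame. -/
def TetragonalFibres.vertex (h : TetragonalFibres π s f d) (hl : IsFrame π f d x l)
    (b : Fin 4 → Bool) : Sections π f d := ⟨(x, cube s l b), h.push_cube hl b⟩

namespace IsSheet

variable (H : IsSheet π s f d m e π' s' f' d') (h : TetragonalFibres π s f d)
include H h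

/-- The sheet is one parity class and contains the row `had 0`, which is even; so in a dual frame it
is always the even one. -/
theorem mem_range_iff (D : DualFrame s e x l l') (b : Fin 4 → Bool) (p : Sections π f d)
    (hp : p.1 = (x, cube s l b)) : p ∈ Set.range e ↔ evenB b = true := by
  have hp1 : p.1.1 = x := congrArg Prod.fst hp
  have h0 : (e (l' 0)).1.1 = x := congrArg Prod.fst (D.dual 0)
  rw [H.mem_iff (l' 0) p (h0.trans hp1.symm),
    h.parity_iff (l := l) (b := had 0) (c := b) _ _ (h0.trans hp1.symm)
      (congrArg Prod.snd (D.dual 0)).symm (congrArg Prod.snd hp).symm]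
  rw [eq_comm]
  rfl

/-- If `b` represents `e p` in some frame, twisting that frame by `b` moves `e p` to the zero row.
All rows are even, so the other three lie on the same sheet. -/
theorem exists_dualFrame_at (p : A') (x : C) (hp : (e p).1.1 = x) :
    ∃ l l', DualFrame s e x l l' ∧ l' 0 = p := by
  obtain ⟨l, hl⟩ := h.exists_frame x
  obtain ⟨b, hb⟩ := h.exists_cube (e p) (hp ▸ hl)
  have hl2 := h.isFrame_twist hl b
  have : ∀ j, ∃ q, (e q).1 = (x, cube s (twist s l b) (had j)) := by
    intro j
    rw [h.cube_twist]
    have := (H.mem_iff p (h.vertex hl fun i => b i ^^ had j i) hp).mpr (by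
      rw [h.parity_iff (l := l) (b := b) (c := fun i => b i ^^ had j i) _ _ hp hb rfl]
      exact evenB_xor_had b j)
    obtain ⟨q, hq⟩ := this
    exact ⟨q, by rw [hq]; rfl⟩
  choose l' hl' using this
  have h0 : (fun i => b i ^^ had 0 i) = b := funext fun i => by fin_cases i <;> simp [had]
  have h1 : cube s (twist s l b) (had 0) = (e p).1.2 := by rw [h.cube_twist, h0, hb]
  exact ⟨_, l', ⟨hl2, hl'⟩, H.inj (Subtype.ext ((hl' 0).trans (Prod.ext hp.symm h1)))⟩

theorem exists_dualFrame (x : C) : ∃ l l', DualFrame s e x l l' := by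
  obtain ⟨p, hp⟩ := H.nonempty x
  obtain ⟨l, l', D, -⟩ := H.exists_dualFrame_at h p x hp
  exact ⟨l, l', D⟩

theorem e_twist (D : DualFrame s e x l l') (t : Fin 4 → Bool) (j : Fin 4) :
    (e (twist s' l' t j)).1 = (x, cube s l fun i => had j i ^^ t j) := by
  unfold twist
  cases t j
  · simp [D.dual]
  · simp [H.e_swap, D.dual, h.push_swap_cube]

theorem twist_eq_iff (D : DualFrame s e x l l') (t : Fin 4 → Bool) (j : Fin 4) (p : A') :
    twist s' l' t j = p ↔ (x, cube s l fun i => had j i ^^ t j) = (e p).1 := by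
  rw [← H.e_twist h D]
  exact ⟨fun hh => by rw [hh], fun hh => H.inj (Subtype.ext hh)⟩

theorem cube_apply (D : DualFrame s e x l l') (t : Fin 4 → Bool) (p : A') :
    cube s' l' t p = ∑ j, if (x, cube s l fun i => had j i ^^ t j) = (e p).1 then 1 else 0 := by
  unfold cube
  rw [push_one_apply]
  exact Finset.sum_congr rfl fun j _ => if_congr (H.twist_eq_iff h D t j p) rfl rfl

theorem swap_ne (hn : NoFixed π s f d) (p : A') : s' p ≠ p := fun hp =>
  hn (e p) (congrArg Prod.snd ((H.e_swap p).symm.trans (congrArg (fun q => (e q).1) hp)))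

/-- Labels `l' j` over `π' p` correspond to rows or complements representing `e p`: a row and its
complement never do so at the same time, since the swap has no fixed point. These are all the
vertices over `e p`, odd ones being excluded by parity, and their number is the local degree. -/
theorem isFrame (hn : NoFixed π s f d) (D : DualFrame s e x l l') : IsFrame π' f' d' x l' := by
  funext y
  obtain ⟨p, rfl⟩ := H.π_surj y
  have hsw : ∀ q, s' (s' q) = q := fun q => H.inj (Subtype.ext (by
    rw [H.e_swap, H.e_swap]
    exact Prod.ext rfl (push_push_involutive s h.swap_swap _)))
  have h1 : ∀ j, (if π' (l' j) = π' p then 1 else 0) =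
      ∑ t, if (x, cube s l fun i => had j i ^^ t) = (e p).1 then 1 else 0 := by
    intro j
    have h2 : ∀ t, ((x, cube s l fun i => had j i ^^ t) = (e p).1) ↔
        (bif t then s' (l' j) else l' j) = p := fun t => (H.twist_eq_iff h D (fun _ => t) j p).symm
    simp only [h2, Fintype.sum_bool, cond_true, cond_false, H.π_eq_iff]
    have h3 := H.swap_ne h hn (l' j)
    by_cases e1 : l' j = p
    · subst e1; simp [h3]
    · by_cases e2 : s' (l' j) = p
      · subst e2; simp [h3.symm]
      · rw [if_neg, if_neg e1, if_neg e2]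
        rintro (rfl | rfl)
        · exact e1 rfl
        · exact e2 rfl
  rw [push_one_apply, Finset.sum_congr rfl fun j _ => h1 j,
    ← sum_even (fun b => if (x, cube s l b) = (e p).1 then 1 else 0)]
  unfold pull
  rw [H.f_π, H.d_π]
  split_ifs with hx
  · rw [← h.sum_cube_eq m H.m_sec (e p) (hx ▸ D.frame), Finset.sum_filter]
    refine Finset.sum_congr rfl fun b _ => ?_
    by_cases hb : cube s l b = (e p).1.2
    · have hb' : (e p).1 = (x, cube s l b) := Prod.ext hx hb.symm
      rw [if_pos ((H.mem_range_iff h D b _ hb').mp ⟨p, rfl⟩), if_pos hb'.symm, if_pos hb]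
    · rw [if_neg hb, if_neg (c := (x, cube s l b) = (e p).1), ite_self]
      exact fun hb' => hb (congrArg Prod.snd hb')
  · exact Finset.sum_eq_zero fun b _ => if_neg fun hb' => hx (congrArg Prod.fst hb').symm

/-- A sheet again has tetragonal fibres. -/
theorem tetragonalFibres (hn : NoFixed π s f d) : TetragonalFibres π' s' f' d' where
  card_fibre := by
    intro y
    obtain ⟨p, rfl⟩ := H.π_surj y
    rw [← Finset.card_pair (H.swap_ne h hn p).symm]
    congr 1
    ext q
    simp [eq_comm (b := π' p), H.π_eq_iff]
  π_swap := fun p => ((H.π_eq_iff _ _).mpr (Or.inr rfl)).symm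
  swap_ne := H.swap_ne h hn
  pos := by
    intro y
    obtain ⟨p, rfl⟩ := H.π_surj y
    rw [H.d_π]
    exact TetragonalFibres.sectionDegree_pos m H.m_sec _
  total := by
    intro x
    obtain ⟨l, l', D⟩ := H.exists_dualFrame h x
    have h1 := H.isFrame h hn D
    have h2 := sum_push (fun i => π' (l' i)) (fun _ => 1)
    rw [h1] at h2
    simpa [pull, Finset.sum_filter] using h2

end IsSheet

/-! ### Sections of a sheet arising from points and from sections of the opposite parity. -/

/-- For a point `a`, the divisor of all sections in the sheet through `a`. -/
def vecSec (π : A → B) (d : B → ℕ) (m : B → A) (e : A' → Sections π f d) (a : A) : A' → ℕ :=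
  fun p => sectionDegree m (e p) * (e p).1.2 a / d (π a)

/-- For a section `E`, the divisor of all sections in the sheet adjacent to `E`. -/
def adjSec (s : A → A) (e : A' → Sections π f d) (E : Sections π f d) : A' → ℕ :=
  fun p => ∑ a, if (e p).1.1 = E.1.1 ∧
    (∀ c, (e p).1.2 c + (if a = c then 1 else 0) = E.1.2 c + (if s a = c then 1 else 0))
    then E.1.2 a else 0

namespace IsSheet

variable (H : IsSheet π s f d m e π' s' f' d') (h : TetragonalFibres π s f d)
include H h

theorem apply_eq_zero (p : A') (a : A) (hp : f (π a) ≠ (e p).1.1) : (e p).1.2 a = 0 := by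
  have := h.apply_add (e p) a
  rw [pull, if_neg hp] at this
  omega

/-- The twist by column `i` selects from each row and its complement the vertex whose `i`-th lift is
`a`; `sum_cube_at` then counts these vertices over `p`. In particular the division in `vecSec` is
exact. -/
theorem vecSec_mul (D : DualFrame s e x l l') (i : Fin 4) (ε : Bool) (a : A)
    (ha : (bif ε then s (l i) else l i) = a) (p : A') :
    cube s' l' (fun j => had j i ^^ ε) p * d (π a) = sectionDegree m (e p) * (e p).1.2 a := by
  have hπ : π (l i) = π a := by subst ha; cases ε <;> simp [h.π_swap]
  rw [H.cube_apply h D, ← sum_even_at (fun b => if (x, cube s l b) = (e p).1 then 1 else 0) i ε]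
  by_cases hx : (e p).1.1 = x
  · have hl : IsFrame π f d (e p).1.1 l := by rw [hx]; exact D.frame
    refine Eq.trans ?_ (h.sum_cube_at m H.m_sec (e p) hl i a hπ)
    refine congrArg (· * d (π a)) ?_
    rw [Finset.sum_filter]
    refine Finset.sum_congr rfl fun b _ => ?_
    have hbi : twist s l b i = a ↔ b i = ε := by
      subst ha
      unfold twist
      have n1 := h.swap_ne (l i)
      cases b i <;> cases ε <;> simp [n1, n1.symm]
    rw [hbi]
    by_cases hb : cube s l b = (e p).1.2
    · have hb' : (e p).1 = (x, cube s l b) := Prod.ext hx hb.symm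
      simp [hb', (H.mem_range_iff h D b _ hb').mp ⟨p, rfl⟩]
    · rw [if_neg (c := (x, cube s l b) = (e p).1) fun hb' => hb (congrArg Prod.snd hb')]
      simp [hb]
  · rw [H.apply_eq_zero h, mul_zero, Finset.sum_eq_zero, zero_mul]
    · exact fun b _ => if_neg fun hb' => hx (congrArg Prod.fst hb').symm
    · rw [← hπ, D.frame.over]
      exact fun hx' => hx hx'.symm

theorem vecSec_eq (D : DualFrame s e x l l') (i : Fin 4) (ε : Bool) (a : A)
    (ha : (bif ε then s (l i) else l i) = a) :
    vecSec π d m e a = cube s' l' (fun j => had j i ^^ ε) := by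
  funext p
  unfold vecSec
  rw [← H.vecSec_mul h D i ε a ha p, Nat.mul_div_cancel _ (h.pos _)]

/-- The rows twisted by `near ρ` are the four neighbours of `ρ` in the cube, and each neighbour
arises by conjugating one of the four points of `E`. -/
theorem adjSec_eq (D : DualFrame s e x l l') (ρ : Fin 4 → Bool) (hρ : evenB ρ = false)
    (E : Sections π f d) (hE : E.1 = (x, cube s l ρ)) :
    adjSec s e E = cube s' l' (near ρ) := by
  funext p
  rw [H.cube_apply h D, sum_near (fun b => if (x, cube s l b) = (e p).1 then 1 else 0) ρ hρ]
  unfold adjSec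
  rw [hE]
  have h1 := sum_push_one (twist s l ρ) (fun a => if (e p).1.1 = x ∧
    (∀ c, (e p).1.2 c + (if a = c then 1 else 0) = cube s l ρ c + (if s a = c then 1 else 0))
    then (1 : ℕ) else 0)
  simp only [Nat.cast_id, mul_ite, mul_one, mul_zero] at h1
  refine h1.trans (Finset.sum_congr rfl fun i _ => if_congr ?_ rfl rfl)
  -- Flipping one coordinate trades a point for its conjugate; the additive form avoids subtraction
  -- of natural numbers.
  have h2 : ∀ c, cube s l (flipAt ρ i) c + (if twist s l ρ i = c then 1 else 0) =
      cube s l ρ c + (if s (twist s l ρ i) = c then 1 else 0) := by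
    intro c
    unfold cube
    rw [push_one_apply, push_one_apply, ← Finset.add_sum_erase _ _ (Finset.mem_univ i),
      ← Finset.add_sum_erase _ (fun k => if twist s l ρ k = c then 1 else 0)
        (Finset.mem_univ i)]
    have h3 : ∀ k ∈ Finset.univ.erase i, (if twist s l (flipAt ρ i) k = c then 1 else 0) =
        if twist s l ρ k = c then 1 else 0 := by
      intro k hk
      have hk' : k ≠ i := by simpa using hk
      rw [show twist s l (flipAt ρ i) k = twist s l ρ k by simp [twist, flipAt, hk']]
    have h4 : twist s l (flipAt ρ i) i = s (twist s l ρ i) := by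
      unfold twist flipAt
      cases ρ i <;> simp [h.swap_swap]
    rw [Finset.sum_congr rfl h3, h4]
    ring
  constructor
  · rintro ⟨hx, hc⟩
    refine (Prod.ext hx (funext fun c => ?_)).symm
    have := hc c
    have := h2 c
    change (e p).1.2 c = cube s l (flipAt ρ i) c
    omega
  · intro hc
    rw [← hc]
    exact ⟨rfl, h2⟩

theorem push_vecSec (hn : NoFixed π s f d) (a : A) :
    push π' (vecSec π d m e a) = pull f' d' (f (π a)) := by
  obtain ⟨l, l', D⟩ := H.exists_dualFrame h (f (π a))
  obtain ⟨i, ε, ha⟩ := h.exists_label D.frame a rfl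
  rw [H.vecSec_eq h D i ε a ha]
  exact (H.tetragonalFibres h hn).push_cube (H.isFrame h hn D) _

theorem exists_odd (D : DualFrame s e x l l') (E : Sections π f d) (hx : E.1.1 = x)
    (hE : E ∉ Set.range e) : ∃ ρ, evenB ρ = false ∧ E.1 = (x, cube s l ρ) := by
  obtain ⟨ρ, hρ⟩ := h.exists_cube E (hx ▸ D.frame)
  have hE' : E.1 = (x, cube s l ρ) := Prod.ext hx hρ.symm
  refine ⟨ρ, ?_, hE'⟩
  rw [H.mem_range_iff h D ρ E hE'] at hE
  simpa using hE

theorem push_adjSec (hn : NoFixed π s f d) (E : Sections π f d) (hE : E ∉ Set.range e) :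
    push π' (adjSec s e E) = pull f' d' E.1.1 := by
  obtain ⟨l, l', D⟩ := H.exists_dualFrame h E.1.1
  obtain ⟨ρ, hρ, hE'⟩ := H.exists_odd h D E rfl hE
  rw [H.adjSec_eq h D ρ hρ E hE']
  exact (H.tetragonalFibres h hn).push_cube (H.isFrame h hn D) _

/-- The section of the sheet attached to a point. -/
def vec (hn : NoFixed π s f d) (a : A) : Sections π' f' d' :=
  ⟨(f (π a), vecSec π d m e a), H.push_vecSec h hn a⟩

/-- The section of the sheet attached to a section of the opposite parity. -/
def adj (hn : NoFixed π s f d) (E : Sections π f d) (hE : E ∉ Set.range e) : Sections π' f' d' :=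
  ⟨(E.1.1, adjSec s e E), H.push_adjSec h hn E hE⟩

end IsSheet

end

end

end TropDonagi

namespace TropDonagi

open scoped Classical

set_option linter.unusedSectionVars false

noncomputable section

/-! ## Triality in a fibre -/

section

variable {A B C A' B' : Type*} [Fintype A] [Fintype B] [Fintype A'] [Fintype B'] {π : A → B}
  {s : A → A} {f : B → C} {d : B → ℕ} {m : B → A} {e : A' → Sections π f d} {π' : A' → B'}
  {s' : A' → A'} {f' : B' → C} {d' : B' → ℕ} {x : C} {l : Fin 4 → A} {l' : Fin 4 → A'}

theorem TetragonalFibres.signedInd_swap (h : TetragonalFibres π s f d) (a c : A) :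
    signedInd s (s a) c = - signedInd s a c := by
  unfold signedInd
  simp only [h.swap_eq_iff, h.swap_swap]
  ring

theorem TetragonalFibres.signedInd_bif (h : TetragonalFibres π s f d) (ε : Bool) (a c : A) :
    signedInd s (bif ε then s a else a) c = sgn ε * signedInd s a c := by
  cases ε
  · simp [sgn]
  · simp [sgn, h.signedInd_swap]

theorem TetragonalFibres.signedInd_self (h : TetragonalFibres π s f d) (a : A) :
    signedInd s a a = 1 := by
  simp [signedInd, (h.swap_ne a).symm]

theorem eq_of_signedInd {a c : A} (hac : signedInd s a c = 1) : a = c := by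
  unfold signedInd at hac
  by_contra hne
  rw [if_neg hne] at hac
  split_ifs at hac <;> omega

namespace IsSheet

variable (H : IsSheet π s f d m e π' s' f' d') (h : TetragonalFibres π s f d)
include H h

theorem sum_cube_signed (D : DualFrame s e x l l') (t : Fin 4 → Bool) (c : A) :
    ∑ p, (cube s' l' t p : ℤ) * (((e p).1.2 c : ℤ) - (e p).1.2 (s c)) =
      ∑ i, (∑ j, sgn (had j i ^^ t j)) * signedInd s (l i) c := by
  have h1 := sum_push_one (M := ℤ) (twist s' l' t)
    (fun p => (((e p).1.2 c : ℤ) - (e p).1.2 (s c)))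
  refine h1.trans ?_
  simp only [Finset.sum_mul]
  rw [Finset.sum_comm]
  refine Finset.sum_congr rfl fun j _ => ?_
  rw [H.e_twist h D]
  exact h.cube_sub l _ c

/-- Orthogonality of distinct columns of the Hadamard matrix. The point `a` can be read off the
right side, and the factor four is that of the composed correspondences on cycles. -/
theorem vecSec_signed (a c : A) :
    ∑ p, (vecSec π d m e a p : ℤ) * (((e p).1.2 c : ℤ) - (e p).1.2 (s c)) =
      4 * signedInd s a c := by
  obtain ⟨l, l', D⟩ := H.exists_dualFrame h (f (π a))
  obtain ⟨i, ε, ha⟩ := h.exists_label D.frame a rfl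
  rw [H.vecSec_eq h D i ε a ha, H.sum_cube_signed h D, ← ha, h.signedInd_bif]
  simp only [sgn_xor, ← mul_assoc, ← Finset.sum_mul, sum_sgn_had]
  simp [mul_assoc]

/-- In signs the four neighbours of a vertex of the cube add up to twice that vertex. -/
theorem adjSec_signed (E : Sections π f d) (hE : E ∉ Set.range e) (c : A) :
    ∑ p, (adjSec s e E p : ℤ) * (((e p).1.2 c : ℤ) - (e p).1.2 (s c)) =
      2 * ((E.1.2 c : ℤ) - E.1.2 (s c)) := by
  obtain ⟨l, l', D⟩ := H.exists_dualFrame h E.1.1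
  obtain ⟨ρ, hρ, hE'⟩ := H.exists_odd h D E rfl hE
  rw [H.adjSec_eq h D ρ hρ E hE', H.sum_cube_signed h D]
  have h1 : E.1.2 = cube s l ρ := congrArg Prod.snd hE'
  rw [h1, h.cube_sub, Finset.mul_sum]
  refine Finset.sum_congr rfl fun i _ => ?_
  rw [← mul_assoc, ← sum_sgn_flipAt]
  exact congrArg (· * _) (sum_near (fun b => sgn (b i)) ρ hρ)

variable (hn : NoFixed π s f d)

theorem vec_injective : Function.Injective (H.vec h hn) := by
  intro a b hab
  have h1 : vecSec π d m e a = vecSec π d m e b := congrArg (fun q => q.1.2) hab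
  have h2 := H.vecSec_signed h a b
  rw [h1, H.vecSec_signed h, h.signedInd_self] at h2
  exact eq_of_signedInd (s := s) (by omega)

theorem adj_injective {E F : Sections π f d} (hE : E ∉ Set.range e) (hF : F ∉ Set.range e)
    (hEF : H.adj h hn E hE = H.adj h hn F hF) : E = F := by
  have h1 : adjSec s e E = adjSec s e F := congrArg (fun q => q.1.2) hEF
  refine h.ext_signed (congrArg (fun q => q.1.1) hEF) fun c => ?_
  have h2 := H.adjSec_signed h E hE c
  rw [h1, H.adjSec_signed h F hF] at h2
  omega

theorem vec_cube (D : DualFrame s e x l l') (i : Fin 4) (ε : Bool) (a : A)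
    (ha : (bif ε then s (l i) else l i) = a) :
    (H.vec h hn a).1 = (x, cube s' l' (fun j => had j i ^^ ε)) := by
  refine Prod.ext ?_ (H.vecSec_eq h D i ε a ha)
  rw [← D.frame.over i, ← ha]
  cases ε <;> simp [vec, h.π_swap]

theorem adj_cube (D : DualFrame s e x l l') (ρ : Fin 4 → Bool) (hρ : evenB ρ = false)
    (E : Sections π f d) (hE : E ∉ Set.range e) (hE' : E.1 = (x, cube s l ρ)) :
    (H.adj h hn E hE).1 = (x, cube s' l' (near ρ)) :=
  Prod.ext (show E.1.1 = x from congrArg Prod.fst hE') (H.adjSec_eq h D ρ hρ E hE')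

/-- Every section of a sheet comes from a point or from a section of the opposite parity. -/
theorem vec_or_adj (p : Sections π' f' d') :
    (∃ a, H.vec h hn a = p) ∨ ∃ E hE, H.adj h hn E hE = p := by
  obtain ⟨l, l', D⟩ := H.exists_dualFrame h p.1.1
  obtain ⟨t, ht⟩ := (H.tetragonalFibres h hn).exists_cube p (H.isFrame h hn D)
  cases hev : evenB t
  · right
    -- Since `near` is an involution on odd vertices, the vertex `near t` is the one sent to `t`.
    let E : Sections π f d := h.vertex D.frame (near t)
    have hE : E ∉ Set.range e := by
      rw [H.mem_range_iff h D (near t) E rfl, near_odd t hev]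
      decide
    refine ⟨E, hE, Subtype.ext ?_⟩
    rw [H.adj_cube h hn D (near t) (near_odd t hev) E hE rfl, near_near t hev, ht]
  · left
    -- By symmetry of the matrix, an even vertex is also a column up to complement, hence comes from
    -- a label or its conjugate.
    obtain ⟨i, ε, hi⟩ := exists_had t hev
    refine ⟨bif ε then s (l i) else l i, Subtype.ext ?_⟩
    · rw [H.vec_cube h hn D i ε _ rfl]
      simp only [had_symm _ i]
      rw [← hi, ht]

theorem parity_vec_vec (a b : A) (hab : f (π a) = f (π b)) :
    paritySetoid π' f' d' (H.vec h hn a) (H.vec h hn b) := by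
  obtain ⟨l, l', D⟩ := H.exists_dualFrame h (f (π a))
  obtain ⟨i, ε, ha⟩ := h.exists_label D.frame a rfl
  obtain ⟨i', ε', hb⟩ := h.exists_label D.frame b hab.symm
  rw [(H.tetragonalFibres h hn).parity_iff _ _ hab
    (congrArg Prod.snd (H.vec_cube h hn D i ε a ha)).symm
    (congrArg Prod.snd (H.vec_cube h hn D i' ε' b hb)).symm,
    evenB_had_col, evenB_had_col]

theorem parity_adj_adj (E F : Sections π f d) (hE : E ∉ Set.range e) (hF : F ∉ Set.range e)
    (hEF : E.1.1 = F.1.1) :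
    paritySetoid π' f' d' (H.adj h hn E hE) (H.adj h hn F hF) := by
  obtain ⟨l, l', D⟩ := H.exists_dualFrame h E.1.1
  obtain ⟨ρ, hρ, hE'⟩ := H.exists_odd h D E rfl hE
  obtain ⟨ρ', hρ', hF'⟩ := H.exists_odd h D F hEF.symm hF
  rw [(H.tetragonalFibres h hn).parity_iff _ _ hEF
    (congrArg Prod.snd (H.adj_cube h hn D ρ hρ E hE hE')).symm
    (congrArg Prod.snd (H.adj_cube h hn D ρ' hρ' F hF hF')).symm, near_odd ρ hρ, near_odd ρ' hρ']

/-- In the dual frame points give columns up to complement, which are even, while `near` of an odd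
vertex is odd. -/
theorem not_parity_vec_adj (a : A) (E : Sections π f d) (hE : E ∉ Set.range e) :
    ¬ paritySetoid π' f' d' (H.vec h hn a) (H.adj h hn E hE) := by
  intro hc
  have hx : f (π a) = E.1.1 := hc.1
  obtain ⟨l, l', D⟩ := H.exists_dualFrame h (f (π a))
  obtain ⟨i, ε, ha⟩ := h.exists_label D.frame a rfl
  obtain ⟨ρ, hρ, hE'⟩ := H.exists_odd h D E hx.symm hE
  rw [(H.tetragonalFibres h hn).parity_iff _ _ hx
    (congrArg Prod.snd (H.vec_cube h hn D i ε a ha)).symm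
    (congrArg Prod.snd (H.adj_cube h hn D ρ hρ E hE hE')).symm, near_odd ρ hρ,
    evenB_had_col] at hc
  exact absurd hc (by decide)

theorem vec_ne_adj (a : A) (E : Sections π f d) (hE : E ∉ Set.range e) :
    H.vec h hn a ≠ H.adj h hn E hE := fun hc =>
  H.not_parity_vec_adj h hn a E hE (hc ▸ (paritySetoid π' f' d').refl _)

theorem vec_swap (a : A) :
    H.vec h hn (s a) = secSwap (H.tetragonalFibres h hn) (H.vec h hn a) := by
  obtain ⟨l, l', D⟩ := H.exists_dualFrame h (f (π a))
  obtain ⟨i, ε, ha⟩ := h.exists_label D.frame a rfl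
  have ha' : (bif !ε then s (l i) else l i) = s a := by
    rw [← ha]; cases ε <;> simp [h.swap_swap]
  refine Subtype.ext ?_
  change _ = ((H.vec h hn a).1.1, push s' (H.vec h hn a).1.2)
  rw [H.vec_cube h hn D i _ _ ha', H.vec_cube h hn D i ε a ha,
    (H.tetragonalFibres h hn).push_swap_cube]
  simp

theorem adj_swap (E : Sections π f d) (hE : E ∉ Set.range e)
    (hE2 : secSwap h E ∉ Set.range e) :
    H.adj h hn (secSwap h E) hE2 = secSwap (H.tetragonalFibres h hn) (H.adj h hn E hE) := by
  obtain ⟨l, l', D⟩ := H.exists_dualFrame h E.1.1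
  obtain ⟨ρ, hρ, hE'⟩ := H.exists_odd h D E rfl hE
  have hE3 : (secSwap h E).1 = (E.1.1, cube s l fun i => !ρ i) := by
    have h1 : E.1.2 = cube s l ρ := congrArg Prod.snd hE'
    rw [← h.push_swap_cube, ← h1]
    rfl
  refine Subtype.ext ?_
  change _ = ((H.adj h hn E hE).1.1, push s' (H.adj h hn E hE).1.2)
  rw [H.adj_cube h hn D _ (by rw [evenB_not, hρ]) _ hE2 hE3, H.adj_cube h hn D ρ hρ E hE hE',
    (H.tetragonalFibres h hn).push_swap_cube, near_not ρ hρ]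

theorem swap_notMem (E : Sections π f d) (hE : E ∉ Set.range e) : secSwap h E ∉ Set.range e := by
  rintro ⟨p, hp⟩
  refine hE ⟨s' p, Subtype.ext ?_⟩
  rw [H.e_swap, hp]
  exact congrArg Subtype.val (h.secSwap_swap E)

-- The swap acts on the sections of a sheet as it acts on points and on sections of the opposite
-- parity, freely in both cases. This is how genericity passes to the outputs.
include hn in
theorem noFixed : NoFixed π' s' f' d' := by
  intro p hp
  have hp' : secSwap (H.tetragonalFibres h hn) p = p := Sections.ext' rfl hp
  rcases H.vec_or_adj h hn p with ⟨a, rfl⟩ | ⟨E, hE, rfl⟩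
  · rw [← H.vec_swap h hn] at hp'
    exact h.swap_ne a (H.vec_injective h hn hp')
  · rw [← H.adj_swap h hn E hE (H.swap_notMem h E hE)] at hp'
    exact hn E (congrArg (fun q => q.1.2) (H.adj_injective h hn _ hE hp'))

/-- The degree counts dual vertices over `vec a`. Odd ones give sections of type `adj`, so only
columns and their complements contribute, one for each label lying over `π a`. -/
theorem degree_vec (m' : B' → A') (hm' : ∀ y, π' (m' y) = y) (a : A) :
    sectionDegree m' (H.vec h hn a) = d (π a) := by
  obtain ⟨l, l', D⟩ := H.exists_dualFrame h (f (π a))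
  have h' := H.tetragonalFibres h hn
  rw [← h'.sum_cube_eq m' hm' (H.vec h hn a) (H.isFrame h hn D),
    ← Finset.sum_filter_add_sum_filter_not Finset.univ (fun b => evenB b = true)]
  simp only [Bool.not_eq_true]
  rw [sum_even, ← sum_odd_near]
  have h0 : (∑ ρ with evenB ρ = false,
      if cube s' l' (near ρ) = (H.vec h hn a).1.2 then 1 else 0) = 0 := by
    refine Finset.sum_eq_zero fun ρ hρ => if_neg fun hc => ?_
    have hρ' : evenB ρ = false := by simpa using hρ
    let E : Sections π f d := h.vertex D.frame ρ
    have hE : E ∉ Set.range e := by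
      rw [H.mem_range_iff h D ρ E rfl, hρ']
      decide
    exact H.vec_ne_adj h hn a E hE (Subtype.ext (by
      rw [H.adj_cube h hn D ρ hρ' E hE rfl, hc]
      rfl))
  have h1 : ∀ i ε, (if cube s' l' (fun j => had i j ^^ ε) = (H.vec h hn a).1.2 then 1 else 0) =
      if (bif ε then s (l i) else l i) = a then 1 else 0 := by
    intro i ε
    simp only [had_symm i]
    have h2 := H.vec_cube h hn D i ε _ rfl
    refine if_congr ⟨fun hc => H.vec_injective h hn (Subtype.ext ?_), fun hc => ?_⟩ rfl rfl
    · rw [h2, hc]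
      rfl
    · rw [← hc]
      exact (congrArg Prod.snd h2).symm
  have h3 : d (π a) = ∑ i, if π (l i) = π a then 1 else 0 := by
    have := congrFun D.frame (π a)
    rw [push_one_apply, pull, if_pos rfl] at this
    exact this.symm
  rw [h0, add_zero, h3]
  refine Finset.sum_congr rfl fun i _ => ?_
  simp only [h1, Fintype.sum_bool, cond_true, cond_false]
  have n1 := h.swap_ne (l i)
  by_cases e1 : l i = a
  · subst e1; simp [n1]
  · by_cases e2 : s (l i) = a
    · subst e2; simp [n1.symm, h.π_swap]
    · rw [if_neg e1, if_neg e2, if_neg]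
      intro hc
      rcases h.eq_or hc.symm with e3 | e3
      · exact e1 e3.symm
      · exact e2 e3.symm

/-- Only odd vertices contribute on both sides, and `near` matches the odd vertices over `E` with
those over its image. -/
theorem degree_adj (m' : B' → A') (hm' : ∀ y, π' (m' y) = y) (E : Sections π f d)
    (hE : E ∉ Set.range e) : sectionDegree m' (H.adj h hn E hE) = sectionDegree m E := by
  obtain ⟨l, l', D⟩ := H.exists_dualFrame h E.1.1
  have h' := H.tetragonalFibres h hn
  rw [← h'.sum_cube_eq m' hm' (H.adj h hn E hE) (H.isFrame h hn D),
    ← h.sum_cube_eq m H.m_sec E D.frame,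
    ← Finset.sum_filter_add_sum_filter_not Finset.univ (fun b => evenB b = true),
    ← Finset.sum_filter_add_sum_filter_not (f := fun b => if cube s l b = E.1.2 then 1 else 0)
      Finset.univ (fun b => evenB b = true)]
  simp only [Bool.not_eq_true]
  rw [sum_even, ← sum_odd_near]
  have h1 : (∑ j, ∑ t, if cube s' l' (fun i => had j i ^^ t) = (H.adj h hn E hE).1.2
      then 1 else 0) = 0 := by
    refine Finset.sum_eq_zero fun i _ => Finset.sum_eq_zero fun ε _ => if_neg fun hc => ?_
    simp only [had_symm i] at hc
    have h2 := H.vec_cube h hn D i ε _ rfl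
    exact H.vec_ne_adj h hn _ E hE (Subtype.ext (by rw [h2, hc]; rfl))
  have h2 : (∑ b with evenB b = true, if cube s l b = E.1.2 then 1 else 0) = 0 := by
    refine Finset.sum_eq_zero fun b hb => if_neg fun hc => hE ?_
    rw [H.mem_range_iff h D b E (Prod.ext rfl hc.symm)]
    simpa using hb
  rw [h1, h2, zero_add, zero_add]
  refine Finset.sum_congr rfl fun ρ hρ => ?_
  have hρ' : evenB ρ = false := by simpa using hρ
  let F : Sections π f d := h.vertex D.frame ρ
  have hF : F ∉ Set.range e := by
    rw [H.mem_range_iff h D ρ F rfl, hρ']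
    decide
  have h3 := H.adj_cube h hn D ρ hρ' F hF rfl
  refine if_congr ⟨fun hc => ?_, fun hc => ?_⟩ rfl rfl
  · have : F = E := H.adj_injective h hn hF hE (Subtype.ext (by rw [h3, hc]; rfl))
    exact congrArg (fun q => q.1.2) this
  · have : F = E := Sections.ext' rfl hc
    refine (congrArg Prod.snd h3).symm.trans ?_
    change adjSec s e F = adjSec s e E
    rw [this]

end IsSheet

end

/-! ## Functoriality -/

/-- A morphism between fibrewise structures, carrying pull-backs of points to each other. -/
structure FibreMap {A B C A₂ B₂ C₂ : Type*} [Fintype A] [Fintype B] (π : A → B) (s : A → A)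
    (f : B → C) (d : B → ℕ) (π₂ : A₂ → B₂) (s₂ : A₂ → A₂) (f₂ : B₂ → C₂) (d₂ : B₂ → ℕ)
    (gA : A → A₂) (gB : B → B₂) (gC : C → C₂) : Prop where
  π_comm : ∀ a, π₂ (gA a) = gB (π a)
  s_comm : ∀ a, gA (s a) = s₂ (gA a)
  pull_comm : ∀ x, push gB (pull f d x) = pull f₂ d₂ (gC x)

theorem push_cube_comm {A A₂ : Type*} {s : A → A} {s₂ : A₂ → A₂} [Fintype A] (g : A → A₂)
    (hg : ∀ a, g (s a) = s₂ (g a)) (l : Fin 4 → A) (b : Fin 4 → Bool) :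
    push g (cube s l b) = cube s₂ (fun i => g (l i)) b := by
  unfold cube
  rw [push_push]
  refine congrArg (fun k => push k fun _ => 1) (funext fun i => ?_)
  simp only [Function.comp, twist]
  cases b i <;> simp [hg]

section

variable {A B C A' B' : Type*} [Fintype A] [Fintype B] [Fintype A'] [Fintype B'] {π : A → B}
  {s : A → A} {f : B → C} {d : B → ℕ} {m : B → A} {e : A' → Sections π f d} {π' : A' → B'}
  {s' : A' → A'} {f' : B' → C} {d' : B' → ℕ}
  {A₂ B₂ C₂ A₂' B₂' : Type*} [Fintype A₂] [Fintype B₂] [Fintype A₂'] [Fintype B₂'] {π₂ : A₂ → B₂}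
  {s₂ : A₂ → A₂} {f₂ : B₂ → C₂} {d₂ : B₂ → ℕ} {m₂ : B₂ → A₂} {e₂ : A₂' → Sections π₂ f₂ d₂}
  {π₂' : A₂' → B₂'} {s₂' : A₂' → A₂'} {f₂' : B₂' → C₂} {d₂' : B₂' → ℕ}
  {gA : A → A₂} {gB : B → B₂} {gC : C → C₂} {g' : A' → A₂'}
  (H : IsSheet π s f d m e π' s' f' d') (h : TetragonalFibres π s f d)
  (H₂ : IsSheet π₂ s₂ f₂ d₂ m₂ e₂ π₂' s₂' f₂' d₂') (h₂ : TetragonalFibres π₂ s₂ f₂ d₂)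
  (G : FibreMap π s f d π₂ s₂ f₂ d₂ gA gB gC)
  (hg : ∀ p, (e₂ (g' p)).1 = (gC (e p).1.1, push gA (e p).1.2))

include G in
theorem FibreMap.isFrame {x : C} {l : Fin 4 → A} (hl : IsFrame π f d x l) :
    IsFrame π₂ f₂ d₂ (gC x) fun i => gA (l i) := by
  unfold IsFrame
  rw [← G.pull_comm, ← hl, push_push]
  exact congrArg (fun k => push k fun _ => 1) (funext fun i => G.π_comm _)

-- Functoriality of dual frames reduces every compatibility with root and bar to the push-forward of
-- a cube.
include G hg in
theorem DualFrame.map {x : C} {l : Fin 4 → A} {l' : Fin 4 → A'} (D : DualFrame s e x l l') :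
    DualFrame s₂ e₂ (gC x) (fun i => gA (l i)) fun j => g' (l' j) where
  frame := G.isFrame D.frame
  dual j := by rw [hg, D.dual, push_cube_comm gA G.s_comm]

include H H₂ G hg in
theorem IsSheet.swap_comm (p : A') : g' (s' p) = s₂' (g' p) := by
  refine H₂.inj (Subtype.ext ?_)
  rw [hg, H.e_swap, H₂.e_swap, hg, push_push, push_push]
  exact Prod.ext rfl (congrArg (fun k => push k (e p).1.2) (funext G.s_comm))

-- The quotient of degrees in `vecSec` does not visibly commute with push-forward; in a dual frame
-- and its image both sides are the same column of the Hadamard matrix.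
include H h H₂ h₂ G hg in
theorem IsSheet.push_vecSec_comm (a : A) :
    push g' (vecSec π d m e a) = vecSec π₂ d₂ m₂ e₂ (gA a) := by
  obtain ⟨l, l', D⟩ := H.exists_dualFrame h (f (π a))
  obtain ⟨i, ε, ha⟩ := h.exists_label D.frame a rfl
  rw [H.vecSec_eq h D i ε a ha, push_cube_comm g' (H.swap_comm H₂ G hg),
    H₂.vecSec_eq h₂ (D.map G hg) i ε (gA a)]
  rw [← ha]
  cases ε <;> simp [G.s_comm]

include H h H₂ h₂ G hg in
theorem IsSheet.push_adjSec_comm (E : Sections π f d) (hE : E ∉ Set.range e)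
    (E₂ : Sections π₂ f₂ d₂) (hE₂ : E₂.1 = (gC E.1.1, push gA E.1.2)) :
    push g' (adjSec s e E) = adjSec s₂ e₂ E₂ := by
  obtain ⟨l, l', D⟩ := H.exists_dualFrame h E.1.1
  obtain ⟨ρ, hρ, hE'⟩ := H.exists_odd h D E rfl hE
  rw [H.adjSec_eq h D ρ hρ E hE', push_cube_comm g' (H.swap_comm H₂ G hg),
    H₂.adjSec_eq h₂ (D.map G hg) ρ hρ E₂]
  have h1 : E.1.2 = cube s l ρ := congrArg Prod.snd hE'
  rw [hE₂, ← push_cube_comm gA G.s_comm, ← h1]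

/-- The local degree of a section is the total local degree of the sections mapping to it. -/
theorem FibreMap.sum_degree [Fintype (Sections π f d)] (h : TetragonalFibres π s f d)
    (h₂ : TetragonalFibres π₂ s₂ f₂ d₂) (G : FibreMap π s f d π₂ s₂ f₂ d₂ gA gB gC)
    (hm : ∀ y, π (m y) = y) (hm₂ : ∀ y, π₂ (m₂ y) = y) (x : C) (q : Sections π₂ f₂ d₂)
    (hq : gC x = q.1.1) :
    sectionDegree m₂ q = ∑ p : Sections π f d,
      if p.1.1 = x ∧ push gA p.1.2 = q.1.2 then sectionDegree m p else 0 := by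
  -- Both degrees count vertices of one cube, because the image of a frame is a frame. The vertices
  -- over `q` are grouped by the section upstairs which they represent.
  obtain ⟨l, hl⟩ := h.exists_frame x
  rw [← h₂.sum_cube_eq m₂ hm₂ q (l := fun i => gA (l i)) (hq ▸ G.isFrame hl)]
  have h1 : ∀ p : Sections π f d, (if p.1.1 = x ∧ push gA p.1.2 = q.1.2 then sectionDegree m p
      else 0) = ∑ b, if h.vertex hl b = p ∧ push gA p.1.2 = q.1.2 then 1 else 0 := by
    intro p
    split_ifs with hp
    · rw [← h.sum_cube_eq m hm p (l := l) (by rw [hp.1]; exact hl)]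
      refine Finset.sum_congr rfl fun b _ => if_congr ⟨fun hb => ?_, fun hb => ?_⟩ rfl rfl
      · exact ⟨Sections.ext' hp.1.symm hb, hp.2⟩
      · exact congrArg (fun q => q.1.2) hb.1
    · symm
      refine Finset.sum_eq_zero fun b _ => if_neg fun hb => hp ⟨?_, hb.2⟩
      rw [← hb.1]
      rfl
  rw [Finset.sum_congr rfl fun p _ => h1 p, Finset.sum_comm]
  refine Finset.sum_congr rfl fun b _ => ?_
  rw [Finset.sum_eq_single (h.vertex hl b)]
  · refine if_congr ?_ rfl rfl
    rw [← push_cube_comm gA G.s_comm]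
    exact (and_iff_right rfl).symm
  · intro p _ hp
    exact if_neg fun hc => hp hc.1.symm
  · simp

end

end

end TropDonagi

namespace TropDonagi

open scoped Classical

set_option linter.unusedSectionVars false

noncomputable section

/-! ## Genericity -/

theorem Multiset.eq_of_even_of_sum_eq_four (M : Multiset ℕ) (hs : M.sum = 4)
    (hM : ∀ n ∈ M, 0 < n ∧ Even n) : M = {2, 2} ∨ M = {4} := by
  have h0 : ∀ N : Multiset ℕ, N.sum = 0 → (∀ n ∈ N, 0 < n ∧ Even n) → N = 0 := by
    intro N hN hN'
    refine Multiset.eq_zero_of_forall_notMem fun n hn => ?_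
    have := Multiset.le_sum_of_mem hn
    have := (hN' n hn).1
    omega
  obtain ⟨n, hn⟩ : ∃ n, n ∈ M := Multiset.exists_mem_of_ne_zero (by rintro rfl; simp at hs)
  obtain ⟨N, rfl⟩ := Multiset.exists_cons_of_mem hn
  rw [Multiset.sum_cons] at hs
  have hN := fun k hk => hM k (Multiset.mem_cons_of_mem hk)
  obtain ⟨hn0, r, hr⟩ := hM n hn
  obtain rfl | rfl : r = 1 ∨ r = 2 := by omega
  · obtain ⟨k, hk⟩ : ∃ k, k ∈ N := Multiset.exists_mem_of_ne_zero (by rintro rfl; simp at hs; omega)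
    obtain ⟨N', rfl⟩ := Multiset.exists_cons_of_mem hk
    rw [Multiset.sum_cons] at hs
    obtain ⟨hk0, q, hq⟩ := hN k hk
    obtain rfl : q = 1 := by omega
    left
    rw [h0 N' (by omega) fun j hj => hN j (Multiset.mem_cons_of_mem hj), hr, hq]
    rfl
  · right
    rw [h0 N (by omega) hN, hr]
    rfl

section

variable {A B C : Type*} [Fintype A] [Fintype B] {π : A → B} {s : A → A} {f : B → C} {d : B → ℕ}

/-- An invariant section has `D(a) = D(s a)`, so every `d y` in the fibre is even, and the only
partitions of four into even parts are `(2, 2)` and `(4)`. -/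
theorem TetragonalFibres.noFixed (h : TetragonalFibres π s f d)
    (hg : ∀ x, (Finset.univ.filter fun y => f y = x).val.map d ≠ {2, 2} ∧
      (Finset.univ.filter fun y => f y = x).val.map d ≠ {4}) : NoFixed π s f d := by
  intro p hp
  have h1 := Multiset.eq_of_even_of_sum_eq_four
    ((Finset.univ.filter fun y => f y = p.1.1).val.map d) (h.total p.1.1) (by
      intro n hn
      obtain ⟨y, hy, rfl⟩ := Multiset.mem_map.mp hn
      have hy' : f y = p.1.1 := by simpa using hy
      refine ⟨h.pos y, ?_⟩
      obtain ⟨a, rfl⟩ := h.surj y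
      have h2 := h.apply_add p a
      rw [pull, if_pos hy'] at h2
      have h3 := congrFun hp a
      rw [push_involutive s h.swap_swap] at h3
      exact ⟨p.1.2 a, by omega⟩)
  rcases h1 with h1 | h1
  · exact (hg _).1 h1
  · exact (hg _).2 h1

/-- If all local degrees over `x` are even, giving half of each to both preimages yields an
invariant section. -/
theorem TetragonalFibres.profile_ne (h : TetragonalFibres π s f d) (hn : NoFixed π s f d) (x : C) :
    (Finset.univ.filter fun y => f y = x).val.map d ≠ {2, 2} ∧
      (Finset.univ.filter fun y => f y = x).val.map d ≠ {4} := by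
  have key : ¬ ∀ n ∈ (Finset.univ.filter fun y => f y = x).val.map d, Even n := by
    intro he
    have he' : ∀ y, f y = x → Even (d y) := fun y hy =>
      he _ (Multiset.mem_map.mpr ⟨y, by simpa using hy, rfl⟩)
    let D : A → ℕ := fun a => if f (π a) = x then d (π a) / 2 else 0
    have hD : push π D = pull f d x := by
      funext y
      obtain ⟨a, rfl⟩ := h.surj y
      rw [push_double h.card_fibre h.π_swap h.swap_ne]
      simp only [D, h.π_swap, pull]
      split_ifs with hx
      · obtain ⟨r, hr⟩ := he' _ hx
        omega
      · rfl
    refine hn ⟨(x, D), hD⟩ (funext fun a => ?_)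
    rw [push_involutive s h.swap_swap]
    simp only [D, h.π_swap]
  constructor <;> intro hc <;> rw [hc] at key <;> exact key (by simp; try decide)

end

namespace Tower

variable {K : Graph.{u}} (T : Tower K)

theorem fibresV : TetragonalFibres T.π.onV T.swap.onV T.f.onV T.f.degV :=
  ⟨T.cardV, T.π_swapV, T.swapV_ne, T.f_harmonic.degV_pos, T.f_degree.1⟩

theorem fibresH : TetragonalFibres T.π.onH T.swap.onH T.f.onH T.f.degH :=
  ⟨T.cardH, T.π_swapH, T.swapH_ne, T.f_harmonic.degH_pos, T.f_degree.2⟩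

variable {T} in
theorem Generic.noFixedV (hT : T.Generic) : NoFixed T.π.onV T.swap.onV T.f.onV T.f.degV :=
  T.fibresV.noFixed hT.1

variable {T} in
theorem Generic.noFixedH (hT : T.Generic) : NoFixed T.π.onH T.swap.onH T.f.onH T.f.degH :=
  T.fibresH.noFixed hT.2

theorem generic_of_noFixed (hV : NoFixed T.π.onV T.swap.onV T.f.onV T.f.degV)
    (hH : NoFixed T.π.onH T.swap.onH T.f.onH T.f.degH) : T.Generic :=
  ⟨T.fibresV.profile_ne hV, T.fibresH.profile_ne hH⟩

theorem rootMap : FibreMap T.π.onH T.swap.onH T.f.onH T.f.degH T.π.onV T.swap.onV T.f.onV T.f.degV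
    T.Gt.root T.G.root K.root :=
  ⟨T.π.root_comm, fun a => (T.swap.root_comm a).symm, T.push_root_pull⟩

theorem barMap : FibreMap T.π.onH T.swap.onH T.f.onH T.f.degH T.π.onH T.swap.onH T.f.onH T.f.degH
    T.Gt.bar T.G.bar K.bar :=
  ⟨T.π.bar_comm, fun a => (T.swap.bar_comm a).symm, T.push_bar_pull⟩

/-! ## The output towers -/

variable {T} (θ : T.Orientation)

theorem indexV_eq_iff (p q : T.donagi.V) (hpq : p.1.1 = q.1.1) :
    indexV θ p = indexV θ q ↔ paritySetoid T.π.onV T.f.onV T.f.degV p q := by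
  constructor
  · intro hi
    exact Quotient.exact (θ.onV.injective
      (Prod.ext ((θ.overV (Quotient.mk _ p)).trans
        (hpq.trans (θ.overV (Quotient.mk _ q)).symm)) hi))
  · intro hi
    exact congrArg (fun r => (θ.onV r).2) (Quotient.sound hi)

theorem indexH_eq_iff (p q : T.donagi.H) (hpq : p.1.1 = q.1.1) :
    indexH θ p = indexH θ q ↔ paritySetoid T.π.onH T.f.onH T.f.degH p q := by
  constructor
  · intro hi
    exact Quotient.exact (θ.onH.injective
      (Prod.ext ((θ.overH (Quotient.mk _ p)).trans
        (hpq.trans (θ.overH (Quotient.mk _ q)).symm)) hi))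
  · intro hi
    exact congrArg (fun r => (θ.onH r).2) (Quotient.sound hi)

/-- The section underlying a vertex of a sheet. -/
def sheetValV (i : Fin 2) (p : (sheet θ i).V) : Sections T.π.onV T.f.onV T.f.degV := p.1

/-- The section underlying a half-edge of a sheet. -/
def sheetValH (i : Fin 2) (p : (sheet θ i).H) : Sections T.π.onH T.f.onH T.f.degH := p.1

theorem mem_sheetV (i : Fin 2) (p : T.donagi.V) :
    p ∈ Set.range (sheetValV θ i) ↔ indexV θ p = i :=
  ⟨by rintro ⟨q, rfl⟩; exact q.2, fun hp => ⟨⟨p, hp⟩, rfl⟩⟩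

theorem mem_sheetH (i : Fin 2) (p : T.donagi.H) :
    p ∈ Set.range (sheetValH θ i) ↔ indexH θ p = i :=
  ⟨by rintro ⟨q, rfl⟩; exact q.2, fun hp => ⟨⟨p, hp⟩, rfl⟩⟩

end Tower

theorem Fin.eq_or_eq_of_ne {i j : Fin 2} (hij : i ≠ j) (k : Fin 2) : i = k ∨ j = k := by omega

theorem TetragonalFibres.exists_not_parity {A B C : Type*} [Fintype A] [Fintype B] {π : A → B}
    {s : A → A} {f : B → C} {d : B → ℕ} (h : TetragonalFibres π s f d) (x : C) :
    ∃ p q : Sections π f d, p.1.1 = x ∧ q.1.1 = x ∧ ¬ paritySetoid π f d p q := by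
  obtain ⟨l, hl⟩ := h.exists_frame x
  refine ⟨h.vertex hl fun _ => false, h.vertex hl (flipAt (fun _ => false) 0), rfl, rfl, ?_⟩
  exact fun hc => absurd ((h.parity_iff (l := l) (b := fun _ => false)
    (c := flipAt (fun _ => false) 0) (h.vertex hl fun _ => false)
    (h.vertex hl (flipAt (fun _ => false) 0)) rfl rfl rfl).mp hc) (by decide)

namespace Tower

variable {K : Graph.{u}} {T : Tower K} (θ : T.Orientation)

theorem sheetV (i : Fin 2) : IsSheet T.π.onV T.swap.onV T.f.onV T.f.degV
    (Function.surjInv T.surjV) (sheetValV θ i) (output θ i).π.onV (output θ i).swap.onV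
    (output θ i).f.onV (output θ i).f.degV where
  inj := Subtype.val_injective
  mem_iff p q hpq := (mem_sheetV θ i q).trans
    ⟨fun hq => (indexV_eq_iff θ p.1 q hpq).mp (p.2.trans hq.symm),
      fun hq => ((indexV_eq_iff θ p.1 q hpq).mpr hq).symm.trans p.2⟩
  nonempty x := by
    obtain ⟨p, q, hp, hq, hpq⟩ := T.fibresV.exists_not_parity x
    replace hpq := fun hc => hpq ((indexV_eq_iff θ p q (hp.trans hq.symm)).mp hc)
    rcases Fin.eq_or_eq_of_ne hpq i with hi | hi
    · exact ⟨⟨p, hi⟩, hp⟩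
    · exact ⟨⟨q, hi⟩, hq⟩
  e_swap p := rfl
  π_surj := Quotient.mk_surjective
  π_eq_iff p q := ⟨Quotient.exact, fun hpq => Quotient.sound hpq⟩
  f_π p := rfl
  d_π p := rfl
  m_sec := Function.surjInv_eq T.surjV

theorem sheetH (i : Fin 2) : IsSheet T.π.onH T.swap.onH T.f.onH T.f.degH
    (Function.surjInv T.surjH) (sheetValH θ i) (output θ i).π.onH (output θ i).swap.onH
    (output θ i).f.onH (output θ i).f.degH where
  inj := Subtype.val_injective
  mem_iff p q hpq := (mem_sheetH θ i q).trans
    ⟨fun hq => (indexH_eq_iff θ p.1 q hpq).mp (p.2.trans hq.symm),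
      fun hq => ((indexH_eq_iff θ p.1 q hpq).mpr hq).symm.trans p.2⟩
  nonempty x := by
    obtain ⟨p, q, hp, hq, hpq⟩ := T.fibresH.exists_not_parity x
    replace hpq := fun hc => hpq ((indexH_eq_iff θ p q (hp.trans hq.symm)).mp hc)
    rcases Fin.eq_or_eq_of_ne hpq i with hi | hi
    · exact ⟨⟨p, hi⟩, hp⟩
    · exact ⟨⟨q, hi⟩, hq⟩
  e_swap p := rfl
  π_surj := Quotient.mk_surjective
  π_eq_iff p q := ⟨Quotient.exact, fun hpq => Quotient.sound hpq⟩
  f_π p := rfl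
  d_π p := rfl
  m_sec := Function.surjInv_eq T.surjH

theorem exists_lift_output (i : Fin 2) (v : (sheet θ i).V) (q : (sheetQuotient θ i).H)
    (hq : (sheetQuotient θ i).root q = (output θ i).π.onV v) :
    ∃ p : (sheet θ i).H, (sheet θ i).root p = v ∧ (output θ i).π.onH p = q := by
  obtain ⟨p, rfl⟩ := (sheetH θ i).π_surj q
  have hq' : (output θ i).π.onV ((sheet θ i).root p) = (output θ i).π.onV v := hq
  rcases ((sheetV θ i).π_eq_iff _ _).mp hq' with hv | hv
  · exact ⟨p, hv.symm, rfl⟩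
  · refine ⟨(output θ i).swap.onH p, ?_, ((sheetH θ i).π_eq_iff _ _).mpr (Or.inr ?_)⟩
    · rw [hv]
      exact ((output θ i).swap.root_comm p).symm
    · exact (sheetSwap_swapH θ i p).symm

/-- The bar map is bijective on sections, so `FibreMap.sum_degree` has a single nonzero term. -/
theorem degH_output_bar (i : Fin 2) (p : (sheet θ i).H) :
    sectionDegree (Function.surjInv T.surjH) (sheetValH θ i ((sheet θ i).bar p)) =
      sectionDegree (Function.surjInv T.surjH) (sheetValH θ i p) := by
  have : Fintype (Sections T.π.onH T.f.onH T.f.degH) := Fintype.ofFinite _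
  have hm := Function.surjInv_eq T.surjH
  refine (FibreMap.sum_degree T.fibresH T.fibresH T.barMap hm hm p.1.1.1 _ rfl).trans
    ((Finset.sum_eq_single (sheetValH θ i p) ?_ ?_).trans (if_pos ⟨rfl, rfl⟩))
  · intro q _ hqp
    refine if_neg fun hc => hqp (Sections.ext' hc.1 ?_)
    have := congrArg (push T.Gt.bar) hc.2
    rw [push_push_involutive _ T.Gt.bar_bar] at this
    exact this.trans (push_push_involutive _ T.Gt.bar_bar _)
  · simp

variable (hT : T.Generic)
include hT

theorem fibresV_output (i : Fin 2) : TetragonalFibres (output θ i).π.onV (output θ i).swap.onV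
    (output θ i).f.onV (output θ i).f.degV :=
  (sheetV θ i).tetragonalFibres T.fibresV hT.noFixedV

theorem fibresH_output (i : Fin 2) : TetragonalFibres (output θ i).π.onH (output θ i).swap.onH
    (output θ i).f.onH (output θ i).f.degH :=
  (sheetH θ i).tetragonalFibres T.fibresH hT.noFixedH

/-- Distinct lifts would be exchanged by the swap, which would then fix their common root. -/
theorem lift_output_unique (i : Fin 2) {p q : (sheet θ i).H}
    (hr : (sheet θ i).root p = (sheet θ i).root q)
    (hπ : (output θ i).π.onH p = (output θ i).π.onH q) : p = q := by
  rcases ((sheetH θ i).π_eq_iff _ _).mp hπ with hc | hc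
  · exact hc.symm
  · exfalso
    have h1 : (sheet θ i).root q = (output θ i).swap.onV ((sheet θ i).root p) := by
      rw [hc]
      exact ((output θ i).swap.root_comm p).symm
    exact (fibresV_output θ hT i).swap_ne _ (h1.symm.trans hr.symm)

/-- This is `FibreMap.sum_degree` for the root map: sections rooted at `E` lie on the sheet of `E`,
and by unique lifting they correspond to the half-edges of the quotient at `v`. -/
theorem balance_output (i : Fin 2) (v : (sheetQuotient θ i).V) (x : K.H)
    (hx : K.root x = (output θ i).f.onV v) : (output θ i).f.degV v =
      ∑ q with (sheetQuotient θ i).root q = v ∧ (output θ i).f.onH q = x,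
        (output θ i).f.degH q := by
  have : Fintype (Sections T.π.onH T.f.onH T.f.degH) := Fintype.ofFinite _
  obtain ⟨E, rfl⟩ := (sheetV θ i).π_surj v
  rw [(sheetV θ i).d_π, FibreMap.sum_degree T.fibresH T.fibresV T.rootMap
    (Function.surjInv_eq T.surjH) (Function.surjInv_eq T.surjV) x (sheetValV θ i E) hx,
    ← Finset.sum_filter]
  have hroot : ∀ p : Sections T.π.onH T.f.onH T.f.degH, p.1.1 = x →
      push T.Gt.root p.1.2 = (sheetValV θ i E).1.2 → T.donagi.root p = E.1 := by
    intro p hp hp'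
    refine Sections.ext' ?_ hp'
    rw [← show K.root x = E.1.1.1 from hx, ← hp]
    rfl
  have hidx : ∀ p : Sections T.π.onH T.f.onH T.f.degH, p.1.1 = x →
      push T.Gt.root p.1.2 = (sheetValV θ i E).1.2 → indexH θ p = i := by
    intro p hp hp'
    exact (index_root θ p).symm.trans ((congrArg (indexV θ) (hroot p hp hp')).trans E.2)
  refine Finset.sum_bij (fun p hp => (output θ i).π.onH ⟨p, hidx p
    (Finset.mem_filter.mp hp).2.1 (Finset.mem_filter.mp hp).2.2⟩) ?_ ?_ ?_ ?_
  · intro p hp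
    have hp' := (Finset.mem_filter.mp hp).2
    exact Finset.mem_filter.mpr ⟨Finset.mem_univ _,
      congrArg (output θ i).π.onV (Subtype.ext (hroot p hp'.1 hp'.2) :
        (sheet θ i).root ⟨p, hidx p hp'.1 hp'.2⟩ = E), hp'.1⟩
  · intro p hp q hq hpq
    have hp' := (Finset.mem_filter.mp hp).2
    have hq' := (Finset.mem_filter.mp hq).2
    refine congrArg Subtype.val (lift_output_unique θ hT i (Subtype.ext ?_) hpq)
    exact (hroot p hp'.1 hp'.2).trans (hroot q hq'.1 hq'.2).symm
  · intro q hq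
    have hq' := (Finset.mem_filter.mp hq).2
    obtain ⟨p, hp, rfl⟩ := exists_lift_output θ i E q hq'.1
    exact ⟨p.1, Finset.mem_filter.mpr ⟨Finset.mem_univ _, hq'.2,
      congrArg (fun r => r.1.1.2) hp⟩, rfl⟩
  · intro p hp
    rfl

/-- The outputs of the tetragonal construction are towers. -/
def outputTower (i : Fin 2) : Tower K where
  toPreTower := output θ i
  π_harmonic :=
    { degV_pos := fun _ => one_pos
      degH_pos := fun _ => one_pos
      degH_bar := fun _ => rfl
      balance := by
        intro v q hq
        obtain ⟨p, hp, hpq⟩ := exists_lift_output θ i v q hq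
        symm
        change ∑ q' with _ , 1 = 1
        rw [Finset.sum_const, smul_eq_mul, mul_one, Finset.card_eq_one]
        refine ⟨p, ?_⟩
        refine Finset.eq_singleton_iff_unique_mem.mpr
          ⟨Finset.mem_filter.mpr ⟨Finset.mem_univ _, hp, hpq⟩, fun q' hq' => ?_⟩
        have h1 := (Finset.mem_filter.mp hq').2
        exact lift_output_unique θ hT i (h1.1.trans hp.symm) (h1.2.trans hpq.symm) }
  π_free := ⟨fun _ => rfl, fun _ => rfl⟩
  π_degree := by
    refine ⟨fun y => ?_, fun y => ?_⟩
    · rw [← (fibresV_output θ hT i).card_fibre y, Finset.card_eq_sum_ones]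
      rfl
    · rw [← (fibresH_output θ hT i).card_fibre y, Finset.card_eq_sum_ones]
      rfl
  π_swapV := (fibresV_output θ hT i).π_swap
  π_swapH := (fibresH_output θ hT i).π_swap
  swapV_ne := (fibresV_output θ hT i).swap_ne
  swapH_ne := (fibresH_output θ hT i).swap_ne
  f_harmonic :=
    { degV_pos := (fibresV_output θ hT i).pos
      degH_pos := (fibresH_output θ hT i).pos
      degH_bar := by
        intro q
        obtain ⟨p, rfl⟩ := (sheetH θ i).π_surj q
        exact degH_output_bar θ i p
      balance := balance_output θ hT i }
  f_degree := ⟨(fibresV_output θ hT i).total, (fibresH_output θ hT i).total⟩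

theorem generic_output (i : Fin 2) : (outputTower θ hT i).Generic :=
  generic_of_noFixed _ ((sheetV θ i).noFixed T.fibresV hT.noFixedV)
    ((sheetH θ i).noFixed T.fibresH hT.noFixedH)

end Tower

end

end TropDonagi

namespace TropDonagi

open scoped Classical

set_option linter.unusedSectionVars false

noncomputable section

/-! ## Isomorphisms of towers -/

/-- The inverse of an isomorphism of graphs. -/
def Graph.Iso.symm {G K : Graph.{u}} (φ : Graph.Iso G K) : Graph.Iso K G where
  onV := φ.onV.symm
  onH := φ.onH.symm
  root_comm h := φ.onV.injective (by rw [φ.root_comm]; simp)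
  bar_comm h := φ.onH.injective (by rw [φ.bar_comm]; simp)

/-- The inverse of an isomorphism of towers. -/
def PreTower.Iso.symm {K : Graph.{u}} {S T : PreTower K} (φ : S.Iso T) : T.Iso S where
  top := φ.top.symm
  mid := φ.mid.symm
  π_commV v := φ.mid.onV.injective
    ((φ.π_commV _).symm.trans ((congrArg T.π.onV (φ.top.onV.apply_symm_apply v)).trans
      (φ.mid.onV.apply_symm_apply _).symm))
  π_commH v := φ.mid.onH.injective
    ((φ.π_commH _).symm.trans ((congrArg T.π.onH (φ.top.onH.apply_symm_apply v)).trans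
      (φ.mid.onH.apply_symm_apply _).symm))
  f_commV v := (φ.f_commV _).symm.trans (congrArg T.f.onV (φ.mid.onV.apply_symm_apply v))
  f_commH v := (φ.f_commH _).symm.trans (congrArg T.f.onH (φ.mid.onH.apply_symm_apply v))
  swap_commV v := φ.top.onV.injective
    ((φ.swap_commV _).symm.trans ((congrArg T.swap.onV (φ.top.onV.apply_symm_apply v)).trans
      (φ.top.onV.apply_symm_apply _).symm))
  swap_commH v := φ.top.onH.injective
    ((φ.swap_commH _).symm.trans ((congrArg T.swap.onH (φ.top.onH.apply_symm_apply v)).trans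
      (φ.top.onH.apply_symm_apply _).symm))
  π_degV v := (φ.π_degV _).symm.trans (congrArg T.π.degV (φ.top.onV.apply_symm_apply v))
  π_degH v := (φ.π_degH _).symm.trans (congrArg T.π.degH (φ.top.onH.apply_symm_apply v))
  f_degV v := (φ.f_degV _).symm.trans (congrArg T.f.degV (φ.mid.onV.apply_symm_apply v))
  f_degH v := (φ.f_degH _).symm.trans (congrArg T.f.degH (φ.mid.onH.apply_symm_apply v))

theorem exists_equiv_quotient {A B A₂ B₂ : Type*} {π : A → B} {s : A → A} {π₂ : A₂ → B₂}
    {s₂ : A₂ → A₂} (hπ : Function.Surjective π) (hπ₂ : Function.Surjective π₂)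
    (h : ∀ a b, π b = π a ↔ b = a ∨ b = s a) (h₂ : ∀ a b, π₂ b = π₂ a ↔ b = a ∨ b = s₂ a)
    (t : A ≃ A₂) (ht : ∀ a, t (s a) = s₂ (t a)) : ∃ m : B ≃ B₂, ∀ a, m (π a) = π₂ (t a) := by
  have key : ∀ a b, π₂ (t b) = π₂ (t a) ↔ π b = π a := by
    intro a b
    rw [h, h₂, ← ht, t.apply_eq_iff_eq, t.apply_eq_iff_eq]
  let m : B → B₂ := fun y => π₂ (t (Function.surjInv hπ y))
  have hm : ∀ a, m (π a) = π₂ (t a) := fun a => (key _ _).mpr (Function.surjInv_eq hπ _)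
  refine ⟨Equiv.ofBijective m ⟨fun y z hyz => ?_, fun y => ?_⟩, hm⟩
  · obtain ⟨a, rfl⟩ := hπ y
    obtain ⟨b, rfl⟩ := hπ z
    rw [hm, hm] at hyz
    exact (key _ _).mp hyz
  · obtain ⟨a, rfl⟩ := hπ₂ y
    exact ⟨π (t.symm a), by rw [hm]; simp⟩

namespace Tower

variable {K : Graph.{u}}

/-- An isomorphism of the top graphs of two towers, compatible with the involutions and the maps to
`K`, induces an isomorphism of towers. -/
theorem nonempty_iso (S T : Tower K) (t : Graph.Iso S.Gt T.Gt)
    (swapV : ∀ v, t.onV (S.swap.onV v) = T.swap.onV (t.onV v))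
    (swapH : ∀ v, t.onH (S.swap.onH v) = T.swap.onH (t.onH v))
    (fV : ∀ v, T.f.onV (T.π.onV (t.onV v)) = S.f.onV (S.π.onV v))
    (fH : ∀ v, T.f.onH (T.π.onH (t.onH v)) = S.f.onH (S.π.onH v))
    (degV : ∀ v, T.f.degV (T.π.onV (t.onV v)) = S.f.degV (S.π.onV v))
    (degH : ∀ v, T.f.degH (T.π.onH (t.onH v)) = S.f.degH (S.π.onH v)) :
    Nonempty (S.toPreTower.Iso T.toPreTower) := by
  have eqV : ∀ (U : Tower K) a b, U.π.onV b = U.π.onV a ↔ b = a ∨ b = U.swap.onV a := fun U a b =>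
    ⟨U.fibresV.eq_or, by rintro (rfl | rfl) <;> simp [U.π_swapV]⟩
  have eqH : ∀ (U : Tower K) a b, U.π.onH b = U.π.onH a ↔ b = a ∨ b = U.swap.onH a := fun U a b =>
    ⟨U.fibresH.eq_or, by rintro (rfl | rfl) <;> simp [U.π_swapH]⟩
  obtain ⟨mV, hmV⟩ := exists_equiv_quotient S.surjV T.surjV (eqV S) (eqV T) t.onV swapV
  obtain ⟨mH, hmH⟩ := exists_equiv_quotient S.surjH T.surjH (eqH S) (eqH T) t.onH swapH
  refine ⟨⟨t, ⟨mV, mH, fun y => ?_, fun y => ?_⟩, fun v => (hmV v).symm, fun v => (hmH v).symm,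
    fun y => ?_, fun y => ?_, fun v => (swapV v).symm, fun v => (swapH v).symm, fun v => ?_,
    fun v => ?_, fun y => ?_, fun y => ?_⟩⟩
  · obtain ⟨a, rfl⟩ := S.surjH y
    rw [← S.π.root_comm, hmV, t.root_comm, T.π.root_comm, hmH]
  · obtain ⟨a, rfl⟩ := S.surjH y
    rw [← S.π.bar_comm, hmH, t.bar_comm, T.π.bar_comm, hmH]
  · obtain ⟨a, rfl⟩ := S.surjV y
    exact (congrArg T.f.onV (hmV a)).trans (fV a)
  · obtain ⟨a, rfl⟩ := S.surjH y
    exact (congrArg T.f.onH (hmH a)).trans (fH a)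
  · rw [T.π_free.1, S.π_free.1]
  · rw [T.π_free.2, S.π_free.2]
  · obtain ⟨a, rfl⟩ := S.surjV y
    exact (congrArg T.f.degV (hmV a)).trans (degV a)
  · obtain ⟨a, rfl⟩ := S.surjH y
    exact (congrArg T.f.degH (hmH a)).trans (degH a)

/-! ## Orientability of the outputs -/

/-- An index on sections, constant exactly on parity classes, trivializes the orientation cover. -/
theorem orientable_of_index (T : Tower K) (iV : T.donagi.V → Fin 2) (iH : T.donagi.H → Fin 2)
    (hV : ∀ p q : T.donagi.V, p.1.1 = q.1.1 →
      (iV p = iV q ↔ paritySetoid T.π.onV T.f.onV T.f.degV p q))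
    (hH : ∀ p q : T.donagi.H, p.1.1 = q.1.1 →
      (iH p = iH q ↔ paritySetoid T.π.onH T.f.onH T.f.degH p q))
    (hroot : ∀ p, iV (T.donagi.root p) = iH p) (hbar : ∀ p, iH (T.donagi.bar p) = iH p) :
    T.Orientable := by
  let gV : T.orientationCover.V → K.V × Fin 2 :=
    Quotient.lift (fun p => (p.1.1, iV p)) fun p q hpq => Prod.ext hpq.1 ((hV p q hpq.1).mpr hpq)
  let gH : T.orientationCover.H → K.H × Fin 2 :=
    Quotient.lift (fun p => (p.1.1, iH p)) fun p q hpq => Prod.ext hpq.1 ((hH p q hpq.1).mpr hpq)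
  have bV : Function.Bijective gV := by
    constructor
    · rintro ⟨p⟩ ⟨q⟩ hpq
      have h1 : (p.1.1, iV p) = (q.1.1, iV q) := hpq
      exact Quotient.sound ((hV p q (Prod.ext_iff.mp h1).1).mp (Prod.ext_iff.mp h1).2)
    · rintro ⟨x, k⟩
      obtain ⟨p, q, hp, hq, hpq⟩ := T.fibresV.exists_not_parity x
      replace hpq := fun hc => hpq ((hV p q (hp.trans hq.symm)).mp hc)
      rcases Fin.eq_or_eq_of_ne hpq k with hk | hk
      · exact ⟨Quotient.mk _ p, Prod.ext hp hk⟩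
      · exact ⟨Quotient.mk _ q, Prod.ext hq hk⟩
  have bH : Function.Bijective gH := by
    constructor
    · rintro ⟨p⟩ ⟨q⟩ hpq
      have h1 : (p.1.1, iH p) = (q.1.1, iH q) := hpq
      exact Quotient.sound ((hH p q (Prod.ext_iff.mp h1).1).mp (Prod.ext_iff.mp h1).2)
    · rintro ⟨x, k⟩
      obtain ⟨p, q, hp, hq, hpq⟩ := T.fibresH.exists_not_parity x
      replace hpq := fun hc => hpq ((hH p q (hp.trans hq.symm)).mp hc)
      rcases Fin.eq_or_eq_of_ne hpq k with hk | hk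
      · exact ⟨Quotient.mk _ p, Prod.ext hp hk⟩
      · exact ⟨Quotient.mk _ q, Prod.ext hq hk⟩
  exact ⟨{
    onV := Equiv.ofBijective gV bV
    onH := Equiv.ofBijective gH bH
    root_comm := by
      rintro ⟨p⟩
      exact Prod.ext rfl (hroot p)
    bar_comm := by
      rintro ⟨p⟩
      exact Prod.ext rfl (hbar p)
    overV := by rintro ⟨p⟩; rfl
    overH := by rintro ⟨p⟩; rfl }⟩

section output

variable {T : Tower K} (θ : T.Orientation) (hT : T.Generic) (i : Fin 2)

/-- The section of the `i`-th output attached to a vertex of the top graph. -/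
def vecV (a : T.Gt.V) : (outputTower θ hT i).donagi.V :=
  (sheetV θ i).vec T.fibresV hT.noFixedV a

/-- The section of the `i`-th output attached to a half-edge of the top graph. -/
def vecH (a : T.Gt.H) : (outputTower θ hT i).donagi.H :=
  (sheetH θ i).vec T.fibresH hT.noFixedH a

theorem notMem_sheetV {E : T.donagi.V} (hE : indexV θ E ≠ i) : E ∉ Set.range (sheetValV θ i) :=
  fun hc => hE ((mem_sheetV θ i E).mp hc)

theorem notMem_sheetH {E : T.donagi.H} (hE : indexH θ E ≠ i) : E ∉ Set.range (sheetValH θ i) :=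
  fun hc => hE ((mem_sheetH θ i E).mp hc)

/-- The section of the `i`-th output attached to a vertex of the other output. -/
def adjV (E : T.donagi.V) (hE : indexV θ E ≠ i) : (outputTower θ hT i).donagi.V :=
  (sheetV θ i).adj T.fibresV hT.noFixedV E (notMem_sheetV θ i hE)

/-- The section of the `i`-th output attached to a half-edge of the other output. -/
def adjH (E : T.donagi.H) (hE : indexH θ E ≠ i) : (outputTower θ hT i).donagi.H :=
  (sheetH θ i).adj T.fibresH hT.noFixedH E (notMem_sheetH θ i hE)

theorem root_vec (a : T.Gt.H) :
    (outputTower θ hT i).donagi.root (vecH θ hT i a) = vecV θ hT i (T.Gt.root a) :=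
  Sections.ext' (show K.root (T.f.onH (T.π.onH a)) = T.f.onV (T.π.onV (T.Gt.root a)) by
      rw [T.π.root_comm, T.f.root_comm])
    ((sheetH θ i).push_vecSec_comm T.fibresH (sheetV θ i) T.fibresV T.rootMap (fun _ => rfl) a)

theorem bar_vec (a : T.Gt.H) :
    (outputTower θ hT i).donagi.bar (vecH θ hT i a) = vecH θ hT i (T.Gt.bar a) :=
  Sections.ext' (show K.bar (T.f.onH (T.π.onH a)) = T.f.onH (T.π.onH (T.Gt.bar a)) by
      rw [T.π.bar_comm, T.f.bar_comm])
    ((sheetH θ i).push_vecSec_comm T.fibresH (sheetH θ i) T.fibresH T.barMap (fun _ => rfl) a)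

theorem root_adj (E : T.donagi.H) (hE : indexH θ E ≠ i) :
    (outputTower θ hT i).donagi.root (adjH θ hT i E hE) =
      adjV θ hT i (T.donagi.root E) ((index_root θ E).symm ▸ hE) :=
  Sections.ext' rfl ((sheetH θ i).push_adjSec_comm T.fibresH (sheetV θ i) T.fibresV T.rootMap
    (fun _ => rfl) E (notMem_sheetH θ i hE) (T.donagi.root E) rfl)

theorem bar_adj (E : T.donagi.H) (hE : indexH θ E ≠ i) :
    (outputTower θ hT i).donagi.bar (adjH θ hT i E hE) =
      adjH θ hT i (T.donagi.bar E) ((index_bar θ E).symm ▸ hE) :=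
  Sections.ext' rfl ((sheetH θ i).push_adjSec_comm T.fibresH (sheetH θ i) T.fibresH T.barMap
    (fun _ => rfl) E (notMem_sheetH θ i hE) (T.donagi.bar E) rfl)

theorem vec_or_adjV (p : (outputTower θ hT i).donagi.V) :
    (∃ a, vecV θ hT i a = p) ∨ ∃ E hE, adjV θ hT i E hE = p := by
  rcases (sheetV θ i).vec_or_adj T.fibresV hT.noFixedV p with hp | ⟨E, hE, hp⟩
  · exact Or.inl hp
  · exact Or.inr ⟨E, fun hc => hE ((mem_sheetV θ i E).mpr hc), hp⟩

theorem vec_or_adjH (p : (outputTower θ hT i).donagi.H) :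
    (∃ a, vecH θ hT i a = p) ∨ ∃ E hE, adjH θ hT i E hE = p := by
  rcases (sheetH θ i).vec_or_adj T.fibresH hT.noFixedH p with hp | ⟨E, hE, hp⟩
  · exact Or.inl hp
  · exact Or.inr ⟨E, fun hc => hE ((mem_sheetH θ i E).mpr hc), hp⟩

theorem vecV_ne_adj (a : T.Gt.V) (E : T.donagi.V) (hE : indexV θ E ≠ i) :
    vecV θ hT i a ≠ adjV θ hT i E hE :=
  (sheetV θ i).vec_ne_adj T.fibresV hT.noFixedV a E (notMem_sheetV θ i hE)

theorem vecH_ne_adj (a : T.Gt.H) (E : T.donagi.H) (hE : indexH θ E ≠ i) :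
    vecH θ hT i a ≠ adjH θ hT i E hE :=
  (sheetH θ i).vec_ne_adj T.fibresH hT.noFixedH a E (notMem_sheetH θ i hE)

/-- Being of type `vec` or `adj` is an index constant exactly on parity classes of a fibre, and root
and bar preserve the type. No connectedness is needed. -/
theorem orientable_output : (outputTower θ hT i).Orientable := by
  let iV : (outputTower θ hT i).donagi.V → Fin 2 :=
    fun p => if p ∈ Set.range (vecV θ hT i) then 0 else 1
  let iH : (outputTower θ hT i).donagi.H → Fin 2 :=
    fun p => if p ∈ Set.range (vecH θ hT i) then 0 else 1
  have vV : ∀ a, iV (vecV θ hT i a) = 0 := fun a => if_pos ⟨a, rfl⟩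
  have vH : ∀ a, iH (vecH θ hT i a) = 0 := fun a => if_pos ⟨a, rfl⟩
  have aV : ∀ E hE, iV (adjV θ hT i E hE) = 1 := fun E hE =>
    if_neg (by rintro ⟨a, ha⟩; exact vecV_ne_adj θ hT i a E hE ha)
  have aH : ∀ E hE, iH (adjH θ hT i E hE) = 1 := fun E hE =>
    if_neg (by rintro ⟨a, ha⟩; exact vecH_ne_adj θ hT i a E hE ha)
  refine orientable_of_index _ iV iH ?_ ?_ ?_ ?_
  · intro p q hpq
    rcases vec_or_adjV θ hT i p with ⟨a, rfl⟩ | ⟨E, hE, rfl⟩ <;>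
      rcases vec_or_adjV θ hT i q with ⟨b, rfl⟩ | ⟨F, hF, rfl⟩
    · rw [vV, vV]
      exact iff_of_true rfl ((sheetV θ i).parity_vec_vec T.fibresV hT.noFixedV a b hpq)
    · rw [vV, aV]
      exact iff_of_false (by decide) ((sheetV θ i).not_parity_vec_adj T.fibresV hT.noFixedV a F
        (notMem_sheetV θ i hF))
    · rw [vV, aV]
      exact iff_of_false (by decide) fun hc => (sheetV θ i).not_parity_vec_adj T.fibresV
        hT.noFixedV b E (notMem_sheetV θ i hE) (Setoid.symm' _ hc)
    · rw [aV, aV]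
      exact iff_of_true rfl ((sheetV θ i).parity_adj_adj T.fibresV hT.noFixedV E F
        (notMem_sheetV θ i hE) (notMem_sheetV θ i hF) hpq)
  · intro p q hpq
    rcases vec_or_adjH θ hT i p with ⟨a, rfl⟩ | ⟨E, hE, rfl⟩ <;>
      rcases vec_or_adjH θ hT i q with ⟨b, rfl⟩ | ⟨F, hF, rfl⟩
    · rw [vH, vH]
      exact iff_of_true rfl ((sheetH θ i).parity_vec_vec T.fibresH hT.noFixedH a b hpq)
    · rw [vH, aH]
      exact iff_of_false (by decide) ((sheetH θ i).not_parity_vec_adj T.fibresH hT.noFixedH a F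
        (notMem_sheetH θ i hF))
    · rw [vH, aH]
      exact iff_of_false (by decide) fun hc => (sheetH θ i).not_parity_vec_adj T.fibresH
        hT.noFixedH b E (notMem_sheetH θ i hE) (Setoid.symm' _ hc)
    · rw [aH, aH]
      exact iff_of_true rfl ((sheetH θ i).parity_adj_adj T.fibresH hT.noFixedH E F
        (notMem_sheetH θ i hE) (notMem_sheetH θ i hF) hpq)
  · intro p
    rcases vec_or_adjH θ hT i p with ⟨a, rfl⟩ | ⟨E, hE, rfl⟩
    · rw [root_vec, vV, vH]
    · rw [root_adj, aV, aH]
  · intro p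
    rcases vec_or_adjH θ hT i p with ⟨a, rfl⟩ | ⟨E, hE, rfl⟩
    · rw [bar_vec, vH, vH]
    · rw [bar_adj, aH, aH]

/-! ## Triality -/

variable (hK : K.Connected) (θ' : (outputTower θ hT i).Orientation)

theorem exists_overV (x : K.V) : ∃ a, T.f.onV (T.π.onV a) = x := by
  obtain ⟨l, hl⟩ := T.fibresV.exists_frame x
  exact ⟨l 0, hl.over 0⟩

theorem exists_overH (x : K.H) : ∃ a, T.f.onH (T.π.onH a) = x := by
  obtain ⟨l, hl⟩ := T.fibresH.exists_frame x
  exact ⟨l 0, hl.over 0⟩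

theorem index_vec_eq (a b : T.Gt.V) (hab : T.f.onV (T.π.onV a) = T.f.onV (T.π.onV b)) :
    indexV θ' (vecV θ hT i a) = indexV θ' (vecV θ hT i b) :=
  (indexV_eq_iff θ' _ _ hab).mpr ((sheetV θ i).parity_vec_vec T.fibresV hT.noFixedV a b hab)

include hK in
/-- The sections attached to the points of the top graph all lie on the same sheet. -/
theorem exists_index_vec : ∃ j, (∀ a, indexV θ' (vecV θ hT i a) = j) ∧
    ∀ a, indexH θ' (vecH θ hT i a) = j := by
  obtain ⟨⟨x₀⟩, hconn⟩ := hK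
  obtain ⟨a₀, ha₀⟩ := exists_overV (T := T) x₀
  -- Any lift `c` of the edge gives a half-edge section whose two ends are the sections attached to
  -- the ends of `c`, and the index is invariant under root and bar.
  have hadj : ∀ x y, K.Adj x y → ∀ a b, T.f.onV (T.π.onV a) = x → T.f.onV (T.π.onV b) = y →
      indexV θ' (vecV θ hT i a) = indexV θ' (vecV θ hT i b) := by
    rintro x y ⟨e, rfl, rfl⟩ a b ha hb
    obtain ⟨c, rfl⟩ := exists_overH (T := T) e
    have h1 : T.f.onV (T.π.onV a) = T.f.onV (T.π.onV (T.Gt.root c)) := by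
      rw [ha, T.π.root_comm, T.f.root_comm]
    have h2 : T.f.onV (T.π.onV b) = T.f.onV (T.π.onV (T.Gt.root (T.Gt.bar c))) := by
      rw [hb, T.π.root_comm, T.f.root_comm, T.π.bar_comm, T.f.bar_comm]
    rw [index_vec_eq θ hT i θ' _ _ h1, index_vec_eq θ hT i θ' _ _ h2, ← root_vec, ← root_vec,
      index_root, index_root, ← bar_vec, index_bar]
  have hV : ∀ a, indexV θ' (vecV θ hT i a) = indexV θ' (vecV θ hT i a₀) := by
    intro a
    have := hconn x₀ (T.f.onV (T.π.onV a))
    have key : ∀ y, Relation.ReflTransGen K.Adj x₀ y → ∀ b, T.f.onV (T.π.onV b) = y →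
        indexV θ' (vecV θ hT i b) = indexV θ' (vecV θ hT i a₀) := by
      intro y hy
      induction hy with
      | refl => exact fun b hb => index_vec_eq θ hT i θ' b a₀ (hb.trans ha₀.symm)
      | tail _ hyz ih =>
        intro b hb
        obtain ⟨c, hc⟩ := exists_overV (T := T) _
        exact (hadj _ _ hyz c b hc hb).symm.trans (ih c hc)
    exact key _ this a rfl
  exact ⟨_, hV, fun a => by rw [← index_root, root_vec, hV]⟩

theorem adjV_index (E : T.donagi.V) (hE : indexV θ E ≠ i) (a : T.Gt.V)
    (ha : T.f.onV (T.π.onV a) = E.1.1) :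
    indexV θ' (vecV θ hT i a) ≠ indexV θ' (adjV θ hT i E hE) := fun hc =>
  (sheetV θ i).not_parity_vec_adj T.fibresV hT.noFixedV a E (notMem_sheetV θ i hE)
    ((indexV_eq_iff θ' _ _ ha).mp hc)

theorem adjH_index (E : T.donagi.H) (hE : indexH θ E ≠ i) (a : T.Gt.H)
    (ha : T.f.onH (T.π.onH a) = E.1.1) :
    indexH θ' (vecH θ hT i a) ≠ indexH θ' (adjH θ hT i E hE) := fun hc =>
  (sheetH θ i).not_parity_vec_adj T.fibresH hT.noFixedH a E (notMem_sheetH θ i hE)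
    ((indexH_eq_iff θ' _ _ ha).mp hc)

variable (hT' : (outputTower θ hT i).Generic) {j : Fin 2}
  (hV : ∀ a, indexV θ' (vecV θ hT i a) = j) (hH : ∀ a, indexH θ' (vecH θ hT i a) = j)
include hT' hV hH

/-- Injectivity of `vec` suffices once the whole sheet `j` is covered: a section of type `adj` has
the parity opposite to that of `vec a` for `a` over the same point, so it has the other index. -/
theorem nonempty_iso_vec : Nonempty ((output θ' j).Iso T.toPreTower) := by
  have bV : Function.Bijective fun a => (⟨vecV θ hT i a, hV a⟩ : (sheet θ' j).V) := by
    refine ⟨fun a b hab => (sheetV θ i).vec_injective T.fibresV hT.noFixedV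
      (congrArg Subtype.val hab), fun p => ?_⟩
    rcases vec_or_adjV θ hT i p.1 with ⟨a, ha⟩ | ⟨E, hE, hp⟩
    · exact ⟨a, Subtype.ext ha⟩
    · obtain ⟨a, ha⟩ := exists_overV (T := T) E.1.1
      refine absurd ?_ (adjV_index θ hT i θ' E hE a ha)
      rw [hV, hp]
      exact p.2.symm
  have bH : Function.Bijective fun a => (⟨vecH θ hT i a, hH a⟩ : (sheet θ' j).H) := by
    refine ⟨fun a b hab => (sheetH θ i).vec_injective T.fibresH hT.noFixedH
      (congrArg Subtype.val hab), fun p => ?_⟩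
    rcases vec_or_adjH θ hT i p.1 with ⟨a, ha⟩ | ⟨E, hE, hp⟩
    · exact ⟨a, Subtype.ext ha⟩
    · obtain ⟨a, ha⟩ := exists_overH (T := T) E.1.1
      refine absurd ?_ (adjH_index θ hT i θ' E hE a ha)
      rw [hH, hp]
      exact p.2.symm
  let t : Graph.Iso T.Gt (sheet θ' j) :=
    { onV := Equiv.ofBijective _ bV
      onH := Equiv.ofBijective _ bH
      root_comm := fun a => Subtype.ext (root_vec θ hT i a).symm
      bar_comm := fun a => Subtype.ext (bar_vec θ hT i a).symm }
  refine (nonempty_iso T (outputTower θ' hT' j) t ?_ ?_ ?_ ?_ ?_ ?_).map PreTower.Iso.symm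
  · exact fun a => Subtype.ext ((sheetV θ i).vec_swap T.fibresV hT.noFixedV a)
  · exact fun a => Subtype.ext ((sheetH θ i).vec_swap T.fibresH hT.noFixedH a)
  · exact fun a => rfl
  · exact fun a => rfl
  · exact fun a => (sheetV θ i).degree_vec T.fibresV hT.noFixedV _
      (Function.surjInv_eq (outputTower θ hT i).surjV) a
  · exact fun a => (sheetH θ i).degree_vec T.fibresH hT.noFixedH _
      (Function.surjInv_eq (outputTower θ hT i).surjH) a

/-- The complementary sheet consists of the sections of type `adj`, which are parametrized by the
sheet opposite to `i`. -/
theorem nonempty_iso_adj : Nonempty ((output θ' (1 - j)).Iso (output θ (1 - i))) := by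
  have hsub : ∀ k l : Fin 2, k ≠ l ↔ l = 1 - k := by decide
  have neV : ∀ E : (sheet θ (1 - i)).V, indexV θ E.1 ≠ i := fun E =>
    ((hsub _ _).mpr E.2).symm
  have neH : ∀ E : (sheet θ (1 - i)).H, indexH θ E.1 ≠ i := fun E =>
    ((hsub _ _).mpr E.2).symm
  have hV' : ∀ E hE, indexV θ' (adjV θ hT i E hE) = 1 - j := by
    intro E hE
    obtain ⟨a, ha⟩ := exists_overV (T := T) E.1.1
    rw [← hsub, ← hV a]
    exact adjV_index θ hT i θ' E hE a ha
  have hH' : ∀ E hE, indexH θ' (adjH θ hT i E hE) = 1 - j := by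
    intro E hE
    obtain ⟨a, ha⟩ := exists_overH (T := T) E.1.1
    rw [← hsub, ← hH a]
    exact adjH_index θ hT i θ' E hE a ha
  have bV : Function.Bijective fun E : (sheet θ (1 - i)).V =>
      (⟨adjV θ hT i E.1 (neV E), hV' _ _⟩ : (sheet θ' (1 - j)).V) := by
    refine ⟨fun E F hEF => Subtype.ext ((sheetV θ i).adj_injective T.fibresV hT.noFixedV
      (notMem_sheetV θ i (neV E)) (notMem_sheetV θ i (neV F)) (congrArg Subtype.val hEF)),
      fun p => ?_⟩
    rcases vec_or_adjV θ hT i p.1 with ⟨a, ha⟩ | ⟨E, hE, hp⟩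
    · exact absurd ((hV a).symm.trans ((congrArg _ ha).trans p.2)) ((hsub _ _).mpr rfl)
    · exact ⟨⟨E, (hsub _ _).mp hE.symm⟩, Subtype.ext hp⟩
  have bH : Function.Bijective fun E : (sheet θ (1 - i)).H =>
      (⟨adjH θ hT i E.1 (neH E), hH' _ _⟩ : (sheet θ' (1 - j)).H) := by
    refine ⟨fun E F hEF => Subtype.ext ((sheetH θ i).adj_injective T.fibresH hT.noFixedH
      (notMem_sheetH θ i (neH E)) (notMem_sheetH θ i (neH F)) (congrArg Subtype.val hEF)),
      fun p => ?_⟩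
    rcases vec_or_adjH θ hT i p.1 with ⟨a, ha⟩ | ⟨E, hE, hp⟩
    · exact absurd ((hH a).symm.trans ((congrArg _ ha).trans p.2)) ((hsub _ _).mpr rfl)
    · exact ⟨⟨E, (hsub _ _).mp hE.symm⟩, Subtype.ext hp⟩
  let t : Graph.Iso (sheet θ (1 - i)) (sheet θ' (1 - j)) :=
    { onV := Equiv.ofBijective _ bV
      onH := Equiv.ofBijective _ bH
      root_comm := fun E => Subtype.ext (root_adj θ hT i E.1 (neH E)).symm
      bar_comm := fun E => Subtype.ext (bar_adj θ hT i E.1 (neH E)).symm }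
  refine (nonempty_iso (outputTower θ hT (1 - i)) (outputTower θ' hT' (1 - j)) t
    ?_ ?_ ?_ ?_ ?_ ?_).map PreTower.Iso.symm
  · exact fun E => Subtype.ext ((sheetV θ i).adj_swap T.fibresV hT.noFixedV E.1
      (notMem_sheetV θ i (neV E))
      ((sheetV θ i).swap_notMem T.fibresV E.1 (notMem_sheetV θ i (neV E))))
  · exact fun E => Subtype.ext ((sheetH θ i).adj_swap T.fibresH hT.noFixedH E.1
      (notMem_sheetH θ i (neH E))
      ((sheetH θ i).swap_notMem T.fibresH E.1 (notMem_sheetH θ i (neH E))))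
  · exact fun E => rfl
  · exact fun E => rfl
  · exact fun E => (sheetV θ i).degree_adj T.fibresV hT.noFixedV _
      (Function.surjInv_eq (outputTower θ hT i).surjV) E.1 (notMem_sheetV θ i (neV E))
  · exact fun E => (sheetH θ i).degree_adj T.fibresH hT.noFixedH _
      (Function.surjInv_eq (outputTower θ hT i).surjH) E.1 (notMem_sheetH θ i (neH E))

end output

end Tower

end

end TropDonagi

namespace TropDonagi

open scoped Classical

set_option linter.unusedSectionVars false

noncomputable section

/-! ## Chains and boundaries -/

section push

variable {A B M : Type*} [Fintype A]

theorem push_sub (g : A → B) (D E : A → ℤ) (b : B) :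
    push g (fun a => D a - E a) b = push g D b - push g E b := by
  simp [push]

theorem push_mul (g : A → B) (r : ℤ) (D : A → ℤ) (b : B) :
    push g (fun a => r * D a) b = r * push g D b := by
  simp [push, Finset.mul_sum]

theorem push_sum_mul {I : Type*} [Fintype I] (g : A → B) (c : I → ℤ) (N : I → A → ℤ) (b : B) :
    push g (fun a => ∑ i, c i * N i a) b = ∑ i, c i * push g (N i) b := by
  simp only [push, Finset.mul_sum]
  exact Finset.sum_comm

theorem sum_push_mul [Fintype B] (g : A → B) (c : A → ℤ) (F : B → ℤ) :
    ∑ b, push g c b * F b = ∑ a, c a * F (g a) := by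
  simp only [push, Finset.sum_mul, Finset.sum_filter, ite_mul, zero_mul]
  rw [Finset.sum_comm]
  simp

theorem push_natCast (g : A → B) (D : A → ℕ) (b : B) :
    push g (fun a => (D a : ℤ)) b = ((push g D b : ℕ) : ℤ) := by
  simp [push]

theorem push_single (g : A → B) (a : A) :
    push g (Pi.single a (1 : ℤ)) = Pi.single (g a) 1 := by
  funext b
  simp only [push, Finset.sum_filter, Pi.single_apply]
  rw [Finset.sum_eq_single a]
  · simp [eq_comm]
  · intro c _ hc
    simp [hc]
  · simp

end push

namespace Graph

/-- A zero-chain of degree zero on a connected graph is a boundary. -/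
theorem Connected.exists_boundary {G : Graph.{u}} (hG : G.Connected) (w : G.V → ℤ)
    (hw : ∑ v, w v = 0) :
    ∃ c : G.H → ℤ, (∀ h, c (G.bar h) = - c h) ∧ ∀ v, push G.root c v = w v := by
  obtain ⟨⟨v₀⟩, hconn⟩ := hG
  have key : ∀ v, Relation.ReflTransGen G.Adj v₀ v → ∃ c : G.H → ℤ,
      (∀ h, c (G.bar h) = - c h) ∧
      ∀ x, push G.root c x = (Pi.single v 1 : G.V → ℤ) x - (Pi.single v₀ 1 : G.V → ℤ) x := by
    intro v hv
    induction hv with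
    | refl => exact ⟨fun _ => 0, by simp, fun x => by simp [push]⟩
    | tail _ hyz ih =>
      obtain ⟨c, hc, hc'⟩ := ih
      obtain ⟨e, rfl, rfl⟩ := hyz
      refine ⟨fun h => c h - ((Pi.single e 1 : G.H → ℤ) h - (Pi.single (G.bar e) 1 : G.H → ℤ) h),
        fun h => ?_, fun x => ?_⟩
      · have h1 : G.bar h = e ↔ h = G.bar e := by
          constructor
          · rintro rfl; exact (G.bar_bar h).symm
          · rintro rfl; exact G.bar_bar e
        have h2 : G.bar h = G.bar e ↔ h = e :=
          ⟨fun hh => by rw [← G.bar_bar h, hh, G.bar_bar], fun hh => by rw [hh]⟩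
        simp only [hc, Pi.single_apply, h1, h2]
        ring
      · rw [push_sub, push_sub, hc', push_single, push_single]
        ring
  choose c hc hc' using fun v => key v (hconn v₀ v)
  refine ⟨fun h => ∑ v, w v * c v h, fun h => ?_, fun x => ?_⟩
  · simp only [hc, mul_neg, Finset.sum_neg_distrib]
  · rw [push_sum_mul]
    simp only [hc', mul_sub, Finset.sum_sub_distrib, ← Finset.sum_mul, hw, zero_mul, sub_zero]
    simp [Pi.single_apply]

theorem exists_orientation (G : Graph.{u}) : ∃ o : G.H → Bool, ∀ h, o (G.bar h) = !o h := by
  let φ := Fintype.equivFin G.H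
  refine ⟨fun h => decide (φ h < φ (G.bar h)), fun h => ?_⟩
  have h1 : φ h ≠ φ (G.bar h) := fun hc => G.bar_ne h (φ.injective hc).symm
  simp only [G.bar_bar]
  rcases lt_or_gt_of_ne h1 with h2 | h2
  · simp [h2, h2.le]
  · simp [h2, h2.le]

/-- On a tree, a chain which is a cycle modulo two is even. -/
theorem IsTree.even_of_even {K : Graph.{u}} (hK : K.IsTree) (z : K.H → ℤ)
    (hbar : ∀ h, Even (z (K.bar h) - z h)) (hroot : ∀ v, Even (push K.root z v)) (h : K.H) :
    Even (z h) := by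
  obtain ⟨o, ho⟩ := K.exists_orientation
  -- The chain `z` is antisymmetric only modulo two; an orientation of the edges replaces it by a
  -- genuine chain in the same class modulo two.
  let y : K.H → ℤ := fun h => if o h then z h else - z (K.bar h)
  have hy : ∀ h, y (K.bar h) = - y h := by
    intro h
    simp only [y, ho, K.bar_bar]
    cases o h <;> simp
  have hyz : ∀ h, Even (z h - y h) := by
    intro h
    simp only [y]
    split_ifs
    · simp
    · have h1 := (hbar h).add (even_two_mul (z h))
      have h2 : z h - - z (K.bar h) = z (K.bar h) - z h + 2 * z h := by ring
      rwa [h2]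
  have hyr : ∀ v, Even (push K.root y v) := by
    intro v
    have h1 := push_sub K.root z y v
    have h2 : Even (push K.root (fun h => z h - y h) v) := Finset.even_sum _ fun h _ => hyz h
    have h3 : push K.root y v = push K.root z v - push K.root (fun h => z h - y h) v := by
      rw [h1]; ring
    rw [h3]
    exact (hroot v).sub h2
  choose w hw using hyr
  -- The boundary of `y` is `2w`. As `w` has degree zero it bounds some `c`, so `y - 2c` is a cycle
  -- on a tree and vanishes.
  have hsum : ∑ v, w v = 0 := by
    have h1 : ∑ v, push K.root y v = 0 := by
      rw [sum_push]
      have h2 := Equiv.sum_comp (⟨K.bar, K.bar, K.bar_bar, K.bar_bar⟩ : K.H ≃ K.H) y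
      simp only [Equiv.coe_fn_mk, hy, Finset.sum_neg_distrib] at h2
      omega
    simp only [hw, Finset.sum_add_distrib] at h1
    omega
  obtain ⟨c, hc, hc'⟩ := hK.1.exists_boundary w hsum
  have hmem : (fun h => y h - 2 * c h) ∈ K.cycles := by
    refine ⟨fun h => ?_, fun v => ?_⟩
    · simp only [hy, hc]; ring
    · change push K.root (fun h => y h - 2 * c h) v = 0
      rw [push_sub, push_mul, hc', hw]
      ring
  rw [hK.2, Submodule.mem_bot] at hmem
  have h1 := congrFun hmem h
  have h2 : y h = 2 * c h := by
    simp only [Pi.zero_apply] at h1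
    omega
  have h3 := (hyz h).add (h2 ▸ even_two_mul (c h) : Even (y h))
  rwa [sub_add_cancel] at h3

end Graph

/-! ## Anti-invariant cycles -/

namespace Tower

variable {K : Graph.{u}} (T : Tower K)

/-- Lifts are chosen on one half of each edge and carried to the other half by the bar map. -/
theorem exists_section_bar :
    ∃ σ : T.G.H → T.Gt.H, (∀ y, T.π.onH (σ y) = y) ∧ ∀ y, σ (T.G.bar y) = T.Gt.bar (σ y) := by
  obtain ⟨o, ho⟩ := T.G.exists_orientation
  let m := Function.surjInv T.surjH
  have hm : ∀ y, T.π.onH (m y) = y := Function.surjInv_eq T.surjH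
  refine ⟨fun y => if o y then m y else T.Gt.bar (m (T.G.bar y)), fun y => ?_, fun y => ?_⟩
  · dsimp only
    split_ifs
    · exact hm y
    · rw [T.π.bar_comm, hm, T.G.bar_bar]
  · simp only [ho, T.G.bar_bar]
    cases o y <;> simp [T.Gt.bar_bar]

theorem mem_ker_iff (c : T.Gt.cycles) :
    c ∈ LinearMap.ker T.pushCycles ↔ ∀ h, c.1 (T.swap.onH h) = - c.1 h := by
  rw [LinearMap.mem_ker]
  constructor
  · intro hc h
    have h1 : push T.π.onH c.1 (T.π.onH h) = 0 := congrFun (congrArg Subtype.val hc) _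
    rw [push_double T.cardH T.π_swapH T.swapH_ne] at h1
    omega
  · intro hc
    refine Subtype.ext (funext fun y => ?_)
    obtain ⟨h, rfl⟩ := T.surjH y
    change push T.π.onH c.1 (T.π.onH h) = 0
    rw [push_double T.cardH T.π_swapH T.swapH_ne, hc]
    omega

theorem push_root_swap (c : T.Gt.H → ℤ) (v : T.Gt.V) :
    push T.Gt.root (fun h => c (T.swap.onH h)) v = push T.Gt.root c (T.swap.onV v) := by
  have h1 : (fun h => c (T.swap.onH h)) = push T.swap.onH c :=
    funext fun h => (push_involutive _ T.swap_swapH c h).symm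
  have h2 : T.Gt.root ∘ T.swap.onH = T.swap.onV ∘ T.Gt.root :=
    (funext T.swap.root_comm).symm
  rw [h1, push_push, h2, ← push_push, push_involutive _ T.swap_swapV]

/-- An anti-invariant cycle is of the form `b - ι b` for a chain `b` with invariant boundary. -/
theorem exists_chain_sub_swap (c : T.Gt.H → ℤ) (hc : c ∈ T.Gt.cycles)
    (hs : ∀ h, c (T.swap.onH h) = - c h) :
    ∃ b : T.Gt.H → ℤ, (∀ h, b (T.Gt.bar h) = - b h) ∧ (∀ h, b h - b (T.swap.onH h) = c h) ∧
      ∀ v, push T.Gt.root b (T.swap.onV v) = push T.Gt.root b v := by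
  obtain ⟨σ, hσ, hσb⟩ := T.exists_section_bar
  -- The restriction of `c` to one lift of each edge; the values on the conjugate lifts are
  -- recovered by anti-invariance.
  let b₀ : T.Gt.H → ℤ := fun h => if h = σ (T.π.onH h) then c h else 0
  have hb₀ : ∀ h, b₀ (T.Gt.bar h) = - b₀ h := by
    intro h
    have h1 : T.Gt.bar h = σ (T.π.onH (T.Gt.bar h)) ↔ h = σ (T.π.onH h) := by
      rw [T.π.bar_comm, hσb]
      refine ⟨fun hh => ?_, fun hh => congrArg _ hh⟩
      have h2 := congrArg T.Gt.bar hh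
      rwa [T.Gt.bar_bar, T.Gt.bar_bar] at h2
    simp only [b₀, h1, hc.1]
    split_ifs <;> simp
  have hb₀c : ∀ h, b₀ h - b₀ (T.swap.onH h) = c h := by
    intro h
    have h1 := T.swapH_ne h
    simp only [b₀, T.π_swapH]
    rcases T.fibresH.eq_or (hσ (T.π.onH h)) with h2 | h2
    · rw [h2, if_pos rfl, if_neg h1, sub_zero]
    · rw [h2, if_neg h1.symm, if_pos rfl, hs]
      ring
  refine ⟨b₀, hb₀, hb₀c, fun v => ?_⟩
  have h1 : push T.Gt.root c v =
      push T.Gt.root b₀ v - push T.Gt.root (fun h => b₀ (T.swap.onH h)) v := by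
    rw [← push_sub]
    exact congrArg (fun k => push T.Gt.root k v) (funext fun h => (hb₀c h).symm)
  rw [T.push_root_swap] at h1
  have h2 : push T.Gt.root c v = 0 := hc.2 v
  omega

/-- If the top graph is connected, an anti-invariant cycle is of the form `b - ι b`. -/
theorem exists_sub_swap (hconn : T.Gt.Connected) (c : T.Gt.H → ℤ) (hc : c ∈ T.Gt.cycles)
    (hs : ∀ h, c (T.swap.onH h) = - c h) :
    ∃ b ∈ T.Gt.cycles, ∀ h, c h = b h - b (T.swap.onH h) := by
  obtain ⟨b₀, hb₀, hb₀c, hz⟩ := T.exists_chain_sub_swap c hc hs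
  let z := push T.Gt.root b₀
  change ∀ v, z (T.swap.onV v) = z v at hz
  let τ := Function.surjInv T.surjV
  have hτ : ∀ y, T.π.onV (τ y) = y := Function.surjInv_eq T.surjV
  -- The invariant boundary `z` is split as `w + ι w`, where `w` has degree zero because `z` does.
  let w : T.Gt.V → ℤ := fun v => if v = τ (T.π.onV v) then z v else 0
  have hwz : ∀ v, w v + w (T.swap.onV v) = z v := by
    intro v
    have h1 := T.swapV_ne v
    simp only [w, T.π_swapV, hz]
    rcases T.fibresV.eq_or (hτ (T.π.onV v)) with h2 | h2
    · rw [h2, if_pos rfl, if_neg h1, add_zero]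
    · rw [h2, if_neg h1.symm, if_pos rfl, zero_add]
  have hw : ∑ v, w v = 0 := by
    have h1 : ∑ v, z v = 0 := by
      simp only [z, sum_push]
      have h2 := Equiv.sum_comp (⟨T.Gt.bar, T.Gt.bar, T.Gt.bar_bar, T.Gt.bar_bar⟩ :
        T.Gt.H ≃ T.Gt.H) b₀
      simp only [Equiv.coe_fn_mk, hb₀, Finset.sum_neg_distrib] at h2
      omega
    have h2 := Equiv.sum_comp (⟨T.swap.onV, T.swap.onV, T.swap_swapV, T.swap_swapV⟩ :
        T.Gt.V ≃ T.Gt.V) w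
    simp only [Equiv.coe_fn_mk] at h2
    simp only [← hwz, Finset.sum_add_distrib] at h1
    omega
  obtain ⟨e, he, he'⟩ := hconn.exists_boundary w hw
  -- Subtracting the invariant chain `e + ι e` cancels the boundary and does not affect `b - ι b`.
  refine ⟨fun h => b₀ h - e h - e (T.swap.onH h), ⟨fun h => ?_, fun v => ?_⟩, fun h => ?_⟩
  · simp only [hb₀, he, T.swap.bar_comm]
    ring
  · change push T.Gt.root (fun h => b₀ h - e h - e (T.swap.onH h)) v = 0
    rw [push_sub T.Gt.root (fun h => b₀ h - e h) (fun h => e (T.swap.onH h)), push_sub,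
      T.push_root_swap, he', he']
    have := hwz v
    simp only [z] at this
    omega
  · simp only [T.swap_swapH, ← hb₀c h]
    ring

end Tower

/-! ## Principal polarizations -/

theorem exists_half {M N : Type*} [AddCommGroup M] [AddCommGroup N] (ξ : M →ₗ[ℤ] N)
    (hN : ∀ x y : N, (2 : ℤ) • x = (2 : ℤ) • y → x = y) (h : ∀ c, ∃ x, (2 : ℤ) • x = ξ c) :
    ∃ ζ : M →ₗ[ℤ] N, (2 : ℤ) • ζ = ξ := by
  choose g hg using h
  refine ⟨AddMonoidHom.toIntLinearMap
    { toFun := g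
      map_zero' := hN _ _ (by rw [hg, map_zero, smul_zero])
      map_add' := fun a b => hN _ _ (by rw [hg, map_add, smul_add, hg, hg]) }, ?_⟩
  ext c
  exact hg c

/-- Integral vectors which are linearly independent over `ℤ` are so over `ℝ`. -/
theorem mulVec_injective_intCast {m n : Type*} [Fintype m] [Fintype n] [DecidableEq n]
    (B : Matrix m n ℤ) (hB : Function.Injective B.mulVec) :
    Function.Injective (B.map (fun r : ℤ => (r : ℝ))).mulVec := by
  -- Independence is encoded in the determinant of the Gram matrix, which survives the passage from
  -- `ℤ` to `ℝ`; it is nonzero because `Bᵀ B v = 0` forces `B v` to have length zero.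
  have hdet : (B.transpose * B).det ≠ 0 := by
    intro h0
    obtain ⟨v, hv, hv0⟩ := Matrix.exists_mulVec_eq_zero_iff.mpr h0
    apply hv
    apply hB
    rw [Matrix.mulVec_zero]
    have h1 : B.mulVec v ⬝ᵥ B.mulVec v = 0 := by
      rw [Matrix.dotProduct_mulVec, Matrix.vecMul_mulVec, ← Matrix.dotProduct_mulVec, hv0,
        dotProduct_zero]
    exact dotProduct_self_eq_zero.mp h1
  have hdet' : ((B.map (fun r : ℤ => (r : ℝ))).transpose *
      B.map (fun r : ℤ => (r : ℝ))).det ≠ 0 := by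
    have h1 : (B.map (fun r : ℤ => (r : ℝ))).transpose * B.map (fun r : ℤ => (r : ℝ)) =
        (B.transpose * B).map (Int.castRingHom ℝ) := by
      rw [Matrix.map_mul]
      rfl
    rw [h1, ← RingHom.mapMatrix_apply, ← RingHom.map_det]
    simpa using hdet
  intro x y hxy
  have h2 : ((B.map (fun r : ℤ => (r : ℝ))).transpose *
      B.map (fun r : ℤ => (r : ℝ))).mulVec (x - y) = 0 := by
    rw [← Matrix.mulVec_mulVec, Matrix.mulVec_sub]
    have hxy' : (B.map (fun r : ℤ => (r : ℝ))).mulVec x =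
      (B.map (fun r : ℤ => (r : ℝ))).mulVec y := hxy
    rw [hxy', sub_self, Matrix.mulVec_zero]
  by_contra hne
  exact hdet' (Matrix.exists_mulVec_eq_zero_iff.mp ⟨x - y, sub_ne_zero.mpr hne, h2⟩)

/-- The Gram matrix is `Cᵀ C`, where `C` is the coefficient matrix with rows scaled by the roots of
`w h / 2`; its columns stay independent over `ℝ`. -/
theorem Graph.gram_posDef (G : Graph.{u}) (w : G.H → ℝ) (hw : ∀ h, 0 < w h) {n : ℕ}
    (b : Fin n → G.cycles) (hb : LinearIndependent ℤ b) :
    (Matrix.of fun i j => G.intPair w (b i) (b j)).PosDef := by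
  let B : Matrix G.H (Fin n) ℤ := Matrix.of fun h i => (b i).1 h
  have hB : Function.Injective B.mulVec := by
    intro x y hxy
    have h1 : ∑ i, (x - y) i • b i = 0 := by
      refine Subtype.ext (funext fun h => ?_)
      have h2 := congrFun hxy h
      simp only [Matrix.mulVec, dotProduct, B, Matrix.of_apply] at h2
      simp only [Submodule.coe_sum, Submodule.coe_smul, Finset.sum_apply, Pi.smul_apply,
        Pi.sub_apply, smul_eq_mul, sub_mul, Finset.sum_sub_distrib, Submodule.coe_zero,
        Pi.zero_apply]
      simp only [mul_comm (x _), mul_comm (y _), h2, sub_self]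
    funext i
    exact sub_eq_zero.mp (Fintype.linearIndependent_iff.mp hb (x - y) h1 i)
  have hB' := mulVec_injective_intCast B hB
  let C : Matrix G.H (Fin n) ℝ := Matrix.of fun h i => Real.sqrt (w h / 2) * ((b i).1 h : ℝ)
  have hC : Function.Injective C.mulVec := by
    intro x y hxy
    refine hB' (funext fun h => ?_)
    have h2 := congrFun hxy h
    have h3 : Real.sqrt (w h / 2) ≠ 0 := (Real.sqrt_pos.mpr (half_pos (hw h))).ne'
    simp only [Matrix.mulVec, dotProduct, C, Matrix.of_apply, mul_assoc, ← Finset.mul_sum] at h2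
    exact mul_left_cancel₀ h3 h2
  convert Matrix.PosDef.conjTranspose_mul_self C hC using 1
  ext i j
  simp only [Matrix.of_apply, Matrix.mul_apply, Matrix.conjTranspose_apply, C, star_trivial]
  change (1 / 2 : ℝ) * ∑ h, ((b i).1 h : ℝ) * ((b j).1 h : ℝ) * w h = _
  rw [Finset.mul_sum]
  refine Finset.sum_congr rfl fun h _ => ?_
  have h1 := Real.mul_self_sqrt (half_pos (hw h)).le
  calc _ = (w h / 2) * (((b i).1 h : ℝ) * ((b j).1 h : ℝ)) := by ring
    _ = (Real.sqrt (w h / 2) * Real.sqrt (w h / 2)) *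
        (((b i).1 h : ℝ) * ((b j).1 h : ℝ)) := by rw [h1]
    _ = _ := by ring

namespace Tower

variable {K : Graph.{u}} (T : Tower K) (ℓ : K.EdgeLength)

theorem lenTop_pos (h : T.Gt.H) : 0 < T.lenTop ℓ h := by
  unfold lenTop len
  rw [T.π_free.2]
  have := ℓ.len_pos (T.f.onH (T.π.onH h))
  have := T.f_harmonic.degH_pos (T.π.onH h)
  positivity

theorem prym_two_cancel (x y : (T.prym ℓ).L) (h : (2 : ℤ) • x = (2 : ℤ) • y) : x = y := by
  have : Module.IsTorsionFree ℤ (T.Coker ⧸ Submodule.torsion ℤ T.Coker) :=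
    Submodule.QuotientTorsion.instIsTorsionFree
  exact smul_right_injective (T.Coker ⧸ Submodule.torsion ℤ T.Coker) (two_ne_zero (α := ℤ)) h

/-- The class of a one-form in the cokernel of the pull-back modulo torsion. -/
def prymMk : T.Gt.cycles →ₗ[ℤ] (T.prym ℓ).L :=
  (Submodule.torsion ℤ T.Coker).mkQ ∘ₗ (LinearMap.range T.pullForms).mkQ

theorem prymMk_surjective : Function.Surjective (T.prymMk ℓ) :=
  (Submodule.mkQ_surjective _).comp (Submodule.mkQ_surjective _)

/-- Invariant forms vanish in the Prym variety. -/
theorem prymMk_eq_zero (c : T.Gt.cycles) (hc : ∀ h, c.1 (T.swap.onH h) = c.1 h) :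
    T.prymMk ℓ c = 0 := by
  -- For invariant `c` one has `π^* π_* c = 2c`, so its class is torsion.
  have h2 : (2 : ℤ) • c ∈ LinearMap.range T.pullForms := by
    refine ⟨T.pushCycles c, Subtype.ext (funext fun h => ?_)⟩
    change push T.π.onH c.1 (T.π.onH h) = 2 * c.1 h
    rw [push_double T.cardH T.π_swapH T.swapH_ne, hc]
    ring
  apply T.prym_two_cancel ℓ
  rw [← map_smul, smul_zero]
  have h3 : (LinearMap.range T.pullForms).mkQ ((2 : ℤ) • c) = 0 :=
    (Submodule.Quotient.mk_eq_zero _).mpr h2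
  exact (congrArg (Submodule.torsion ℤ T.Coker).mkQ h3).trans (map_zero _)

/-- Some nonzero multiple of `c` is a pull-back and therefore invariant, while `c` is
anti-invariant. -/
theorem prymMk_ker (c : LinearMap.ker T.pushCycles) (h0 : T.prymMk ℓ c.1 = 0) : c = 0 := by
  have h1 : (LinearMap.range T.pullForms).mkQ c.1 ∈ Submodule.torsion ℤ T.Coker :=
    (Submodule.Quotient.mk_eq_zero _).mp h0
  obtain ⟨r, hr⟩ := (Submodule.mem_torsion_iff _).mp h1
  have hr0 : (r : ℤ) ≠ 0 := nonZeroDivisors.ne_zero r.2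
  have h2 : (LinearMap.range T.pullForms).mkQ ((r : ℤ) • c.1) = 0 := by
    rw [map_smul]; exact hr
  obtain ⟨a, ha⟩ := (Submodule.Quotient.mk_eq_zero _).mp h2
  refine Subtype.ext (Subtype.ext (funext fun h => ?_))
  have h3 : ∀ h, a.1 (T.π.onH h) = (r : ℤ) * c.1.1 h := fun h =>
    congrFun (congrArg Subtype.val ha) h
  have h4 := h3 (T.swap.onH h)
  rw [T.π_swapH, h3, (T.mem_ker_iff c.1).mp c.2] at h4
  have h5 := mul_left_cancel₀ hr0 h4
  change c.1.1 h = 0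
  omega

/-- The involution on cycles. -/
def swapCycle (c : T.Gt.cycles) : T.Gt.cycles :=
  ⟨fun h => c.1 (T.swap.onH h),
    fun h => (congrArg c.1 (T.swap.bar_comm h)).trans (c.2.1 _),
    fun v => (T.push_root_swap c.1 v).trans (c.2.2 _)⟩

/-- Since `c + ι c` dies in the Prym variety, `- ι c` and `c` have the same class. This is the
source of the factor two in the induced polarization. -/
theorem prymMk_sub_swap (c : T.Gt.cycles) :
    T.prymMk ℓ (c - T.swapCycle c) = (2 : ℤ) • T.prymMk ℓ c := by
  have h1 := T.prymMk_eq_zero ℓ (c + T.swapCycle c) fun h => by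
    change c.1 (T.swap.onH h) + c.1 (T.swap.onH (T.swap.onH h)) = c.1 h + c.1 (T.swap.onH h)
    rw [T.swap_swapH]
    ring
  rw [map_add] at h1
  rw [map_sub, two_smul, eq_neg_of_add_eq_zero_right h1, sub_neg_eq_add]

theorem prym_pair_prymMk (a : T.Gt.cycles) (b : LinearMap.ker T.pushCycles) :
    (T.prym ℓ).pair (T.prymMk ℓ a) b = T.Gt.intPair (T.lenTop ℓ) a b.1 := rfl

theorem intPair_comm (a b : T.Gt.cycles) :
    T.Gt.intPair (T.lenTop ℓ) a b = T.Gt.intPair (T.lenTop ℓ) b a := by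
  change (1 / 2 : ℝ) * _ = (1 / 2 : ℝ) * _
  refine congrArg _ (Finset.sum_congr rfl fun h _ => ?_)
  ring

theorem pair_half (ζ : (T.prym ℓ).L' →ₗ[ℤ] (T.prym ℓ).L)
    (hζ : (2 : ℤ) • ζ = T.inducedPolarization ℓ) (a b : LinearMap.ker T.pushCycles) :
    (T.prym ℓ).pair (ζ a) b = (1 / 2) * T.Gt.intPair (T.lenTop ℓ) a.1 b.1 := by
  have h1 : T.prymMk ℓ a.1 = (2 : ℤ) • ζ a := (LinearMap.congr_fun hζ a).symm
  have h2 : (T.prym ℓ).pair ((2 : ℤ) • ζ a) b = (2 : ℤ) • (T.prym ℓ).pair (ζ a) b :=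
    LinearMap.map_smul₂ _ _ _ _
  have h3 : T.Gt.intPair (T.lenTop ℓ) a.1 b.1 = (2 : ℤ) • (T.prym ℓ).pair (ζ a) b :=
    (T.prym_pair_prymMk ℓ a.1 b).symm.trans
      ((congrArg (fun x => (T.prym ℓ).pair x b) h1).trans h2)
  rw [h3, zsmul_eq_mul]
  push_cast
  ring

/-- The class of any `c` is the image of the anti-invariant cycle `c - ι c`, by `prymMk_sub_swap`
and cancellation of two. -/
theorem half_bijective (ζ : (T.prym ℓ).L' →ₗ[ℤ] (T.prym ℓ).L)
    (hζ : (2 : ℤ) • ζ = T.inducedPolarization ℓ) : Function.Bijective ζ := by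
  have h1 : ∀ a : LinearMap.ker T.pushCycles, T.prymMk ℓ a.1 = (2 : ℤ) • ζ a := fun a =>
    (LinearMap.congr_fun hζ a).symm
  constructor
  · refine (injective_iff_map_eq_zero ζ).mpr fun a ha => ?_
    have h2 := h1 a
    rw [ha, smul_zero] at h2
    exact T.prymMk_ker ℓ a h2
  · intro x
    obtain ⟨c, rfl⟩ := T.prymMk_surjective ℓ x
    have hmem : c - T.swapCycle c ∈ LinearMap.ker T.pushCycles := by
      rw [mem_ker_iff]
      intro h
      change c.1 (T.swap.onH h) - c.1 (T.swap.onH (T.swap.onH h)) = -(c.1 h - c.1 (T.swap.onH h))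
      rw [T.swap_swapH]
      ring
    refine ⟨⟨_, hmem⟩, T.prym_two_cancel ℓ _ _ ?_⟩
    rw [← prymMk_sub_swap]
    exact (h1 ⟨_, hmem⟩).symm

theorem half_posDef (ζ : (T.prym ℓ).L' →ₗ[ℤ] (T.prym ℓ).L)
    (hζ : (2 : ℤ) • ζ = T.inducedPolarization ℓ) {n : ℕ}
    (b : Module.Basis (Fin n) ℤ (T.prym ℓ).L') :
    (Matrix.of fun i j => (T.prym ℓ).pair (ζ (b i)) (b j)).PosDef := by
  let b' : Fin n → LinearMap.ker T.pushCycles := b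
  have hli : LinearIndependent ℤ fun i => (b' i).1 :=
    b.linearIndependent.map' (LinearMap.ker T.pushCycles).subtype
      (Submodule.ker_subtype _)
  -- The factor one half coming from `ζ` is absorbed into the edge lengths.
  have h1 := T.Gt.gram_posDef (fun h => (1 / 2) * T.lenTop ℓ h)
    (fun h => mul_pos one_half_pos (T.lenTop_pos ℓ h)) _ hli
  convert h1 using 1
  ext i j
  refine (T.pair_half ℓ ζ hζ (b' i) (b' j)).trans ?_
  change (1 / 2 : ℝ) * ((1 / 2 : ℝ) * _) = (1 / 2 : ℝ) * _
  rw [Finset.mul_sum]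
  refine congrArg _ (Finset.sum_congr rfl fun h _ => ?_)
  ring

/-- Half of the induced polarization is principal as soon as it exists. -/
theorem isPrymPolarization_half (ζ : (T.prym ℓ).L' →ₗ[ℤ] (T.prym ℓ).L)
    (hζ : (2 : ℤ) • ζ = T.inducedPolarization ℓ) : T.IsPrymPolarization ℓ ζ := by
  have hbij := T.half_bijective ℓ ζ hζ
  have hfree : Module.Free ℤ (T.prym ℓ).L' :=
    inferInstanceAs (Module.Free ℤ (LinearMap.ker T.pushCycles))
  have hfin : Module.Finite ℤ (T.prym ℓ).L' :=
    inferInstanceAs (Module.Finite ℤ (LinearMap.ker T.pushCycles))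
  let φ : (T.prym ℓ).L' ≃ₗ[ℤ] (T.prym ℓ).L := LinearEquiv.ofBijective ζ hbij
  refine ⟨⟨Module.Free.of_equiv φ, hfree, Module.Finite.equiv φ, hfin, φ.finrank_eq.symm,
    fun n b b' => ?_⟩, hζ, ⟨hbij.1, fun a b => ?_, fun n b => T.half_posDef ℓ ζ hζ b⟩, hbij⟩
  -- Since `ζ` is an isomorphism, the pairing matrix is a unimodular base change times the positive
  -- definite Gram matrix of `ζ`.
  · have h1 : (Matrix.of fun i j => (T.prym ℓ).pair (b i) (b' j)) =
        ((b'.toMatrix fun i => φ.symm (b i)).transpose.map (Int.castRingHom ℝ)) *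
          (Matrix.of fun i j => (T.prym ℓ).pair (ζ (b' i)) (b' j)) := by
      ext i j
      have h2 : b i = ζ (∑ k, (b'.repr (φ.symm (b i))) k • b' k) := by
        rw [b'.sum_repr]
        exact (φ.apply_symm_apply (b i)).symm
      simp only [Matrix.of_apply, Matrix.mul_apply, Matrix.map_apply, Matrix.transpose_apply,
        Module.Basis.toMatrix_apply]
      conv_lhs => rw [h2]
      simp only [map_sum, map_smul, LinearMap.sum_apply, LinearMap.smul_apply, zsmul_eq_mul]
      rfl
    have h3 : IsUnit (b'.toMatrix fun i => φ.symm (b i)).det := by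
      have h4 := Module.Basis.invertibleToMatrix b' (b.map φ.symm)
      exact Matrix.isUnit_det_of_invertible (b'.toMatrix (b.map φ.symm))
    rw [h1, Matrix.det_mul, ← RingHom.mapMatrix_apply, ← RingHom.map_det, Matrix.det_transpose]
    refine mul_ne_zero ?_ (T.half_posDef ℓ ζ hζ b').det_pos.ne'
    simpa using h3.ne_zero
  · exact (T.pair_half ℓ ζ hζ a b).trans
      ((congrArg _ (T.intPair_comm ℓ _ _)).trans (T.pair_half ℓ ζ hζ b a).symm)

/-- Connectedness serves to write a cycle as `b - ι b`, whose class is twice that of `b`. -/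
theorem exists_isPrymPolarization (hconn : T.Gt.Connected) :
    ∃ ζ, T.IsPrymPolarization ℓ ζ := by
  obtain ⟨ζ, hζ⟩ := exists_half (T.inducedPolarization ℓ) (T.prym_two_cancel ℓ) (by
    intro c
    obtain ⟨b, hb, hcb⟩ := T.exists_sub_swap hconn c.1.1 c.1.2 ((T.mem_ker_iff c.1).mp c.2)
    refine ⟨T.prymMk ℓ ⟨b, hb⟩, ?_⟩
    rw [← prymMk_sub_swap]
    exact congrArg (T.prymMk ℓ) (Subtype.ext (funext fun h => (hcb h).symm)))
  exact ⟨ζ, T.isPrymPolarization_half ℓ ζ hζ⟩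

/-- An isometry of the lattices of anti-invariant cycles is an isomorphism of Prym varieties. -/
theorem nonempty_polarizedIso {T S : Tower K} {ℓ : K.EdgeLength}
    {ζ : (T.prym ℓ).L' →ₗ[ℤ] (T.prym ℓ).L} {η : (S.prym ℓ).L' →ₗ[ℤ] (S.prym ℓ).L}
    (hζ : T.IsPrymPolarization ℓ ζ) (hη : S.IsPrymPolarization ℓ η)
    (φ : LinearMap.ker T.pushCycles ≃ₗ[ℤ] LinearMap.ker S.pushCycles)
    (hφ : ∀ a b, S.Gt.intPair (S.lenTop ℓ) (φ a).1 (φ b).1 =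
      T.Gt.intPair (T.lenTop ℓ) a.1 b.1) :
    Nonempty (Pairing.PolarizedIso (T.prym ℓ) (S.prym ℓ) ζ η) := by
  let φ' : (T.prym ℓ).L' ≃ₗ[ℤ] (S.prym ℓ).L' := φ
  let ζ' := LinearEquiv.ofBijective ζ hζ.2.2.2
  let η' := LinearEquiv.ofBijective η hη.2.2.2
  -- Principality identifies both lattices of each Prym variety, so compatibility with the
  -- polarizations dictates the upper map.
  refine ⟨⟨(η'.symm.trans φ'.symm).trans ζ', φ', fun a b => ?_, fun b => ?_⟩⟩
  · obtain ⟨c, rfl⟩ := η'.surjective a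
    obtain ⟨e, rfl⟩ := φ'.surjective c
    simp only [LinearEquiv.trans_apply, LinearEquiv.symm_apply_apply]
    refine (T.pair_half ℓ ζ hζ.2.1 e b).trans (Eq.trans ?_ (S.pair_half ℓ η hη.2.1 _ _).symm)
    exact congrArg _ (hφ e b).symm
  · simp only [LinearEquiv.trans_apply]
    have : η'.symm (η (φ' b)) = φ' b := η'.symm_apply_apply (φ' b)
    rw [this, LinearEquiv.symm_apply_apply]
    rfl

end Tower

end

end TropDonagi

namespace TropDonagi

open scoped Classical

set_option linter.unusedSectionVars false

noncomputable section

/-! ## The incidence correspondence between a sheet and the points -/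

namespace IsSheet

variable {A B C A' B' : Type*} [Fintype A] [Fintype B] [Fintype A'] [Fintype B'] {π : A → B}
  {s : A → A} {f : B → C} {d : B → ℕ} {m : B → A} {e : A' → Sections π f d} {π' : A' → B'}
  {s' : A' → A'} {f' : B' → C} {d' : B' → ℕ}
  (H : IsSheet π s f d m e π' s' f' d') (h : TetragonalFibres π s f d)
include H h

theorem vecSec_mul_degree (a : A) (p : A') :
    vecSec π d m e a p * d (π a) = sectionDegree m (e p) * (e p).1.2 a := by
  obtain ⟨l, l', D⟩ := H.exists_dualFrame h (f (π a))
  obtain ⟨i, ε, ha⟩ := h.exists_label D.frame a rfl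
  rw [H.vecSec_eq h D i ε a ha]
  exact H.vecSec_mul h D i ε a ha p

theorem vecSec_add (a : A) (p : A') :
    vecSec π d m e a p + vecSec π d m e (s a) p =
      if f (π a) = (e p).1.1 then sectionDegree m (e p) else 0 := by
  have h1 := H.vecSec_mul_degree h a p
  have h2 := H.vecSec_mul_degree h (s a) p
  rw [h.π_swap] at h2
  have h3 := h.apply_add (e p) a
  refine Nat.eq_of_mul_eq_mul_right (h.pos (π a)) ?_
  rw [add_mul, h1, h2, ← mul_add, h3, pull]
  split_ifs <;> simp

theorem vecSec_swap (hn : NoFixed π s f d) (a : A) (p : A') :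
    vecSec π d m e (s a) p = vecSec π d m e a (s' p) :=
  (congrFun (congrArg (fun q => q.1.2) (H.vec_swap h hn a)) p).trans
    (TetragonalFibres.secSwap_apply (H.tetragonalFibres h hn) (H.vec h hn a) p)

/-- The counterpart of `vecSec_signed` for the opposite composition. With `p` as row zero, summing
over the points of `e p` leaves only column zero of the Hadamard matrix. -/
theorem sum_apply_mul_vecSec (hn : NoFixed π s f d) (p q : A') :
    ∑ a, ((e p).1.2 a : ℤ) * ((vecSec π d m e a q : ℤ) - vecSec π d m e a (s' q)) =
      4 * signedInd s' p q := by
  obtain ⟨l, l', D, hp⟩ := H.exists_dualFrame_at h p (e p).1.1 rfl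
  have h1 : (e p).1.2 = push l fun _ => 1 := by
    rw [← hp, D.dual 0]
    change push (twist s l (had 0)) _ = _
    congr 1
    funext i
    fin_cases i <;> rfl
  have h2 : ∀ i, vecSec π d m e (l i) = cube s' l' (had i) := by
    intro i
    rw [H.vecSec_eq h D i false (l i) rfl]
    congr 1
    funext j
    rw [Bool.xor_false, had_symm]
  rw [h1, sum_push_one (M := ℤ)]
  simp only [h2, (H.tetragonalFibres h hn).cube_sub]
  rw [Finset.sum_comm]
  simp only [← Finset.sum_mul]
  have h3 : ∀ j, ∑ i, sgn (had i j) = if j = 0 then 4 else 0 := by decide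
  simp only [h3, ite_mul, zero_mul, Finset.sum_ite_eq', Finset.mem_univ, if_true, hp]

end IsSheet

theorem sum_mul_signedInd {A : Type*} [Fintype A] {s : A → A} (c : A → ℤ)
    (hc : ∀ a, c (s a) = - c a) (b : A) : ∑ a, c a * signedInd s a b = 2 * c b := by
  simp only [signedInd, mul_sub, Finset.sum_sub_distrib, mul_ite, mul_one, mul_zero,
    Finset.sum_ite_eq', Finset.mem_univ, if_true, hc]
  ring

/-- An anti-invariant chain with even fibre sums pairs evenly with every divisor whose sum with its
image under the involution is supported uniformly on a fibre. -/
theorem even_sum_mul {A C : Type*} [Fintype A] {s : A → A} (hs : ∀ a, s (s a) = a) (F : A → C)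
    (b g : A → ℤ) (x : C) (M : ℤ)
    (hg : ∀ a, g a + g (s a) = if F a = x then M else 0) (hb : Even (push F b x)) :
    Even (∑ a, (b a - b (s a)) * g a) := by
  have h1 : ∑ a, b (s a) * g a = ∑ a, b a * g (s a) := by
    rw [← Equiv.sum_comp (⟨s, s, hs, hs⟩ : A ≃ A)]
    simp [hs]
  -- The hypothesis `hg` trades `g` for `- g ∘ s`, up to the constant `M` on the fibre over `x`.
  have h2 : ∑ a, (b a - b (s a)) * g a = M * push F b x - 2 * ∑ a, b a * g (s a) := by
    simp only [sub_mul, Finset.sum_sub_distrib, h1, push, Finset.mul_sum, Finset.sum_filter]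
    rw [← Finset.sum_sub_distrib, ← Finset.sum_sub_distrib]
    refine Finset.sum_congr rfl fun a _ => ?_
    have h3 := hg a
    split_ifs at h3 ⊢
    · rw [← h3]; ring
    · rw [eq_neg_of_add_eq_zero_left h3]; ring
  rw [h2]
  exact (hb.mul_left _).sub (even_two_mul _)

namespace Tower

variable {K : Graph.{u}}

/-- Over a tree, an anti-invariant cycle pairs evenly with every divisor whose sum with its image
under the involution is supported uniformly on a fibre. -/
theorem even_sum_cycle_mul (T : Tower K) (hK : K.IsTree) (c : T.Gt.H → ℤ) (hc : c ∈ T.Gt.cycles)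
    (hs : ∀ h, c (T.swap.onH h) = - c h) (g : T.Gt.H → ℤ) (x : K.H) (M : ℤ)
    (hg : ∀ a, g a + g (T.swap.onH a) = if T.f.onH (T.π.onH a) = x then M else 0) :
    Even (∑ a, c a * g a) := by
  obtain ⟨b, hb, hbc, hbr⟩ := T.exists_chain_sub_swap c hc hs
  simp only [← hbc]
  refine even_sum_mul T.swap_swapH (fun a => T.f.onH (T.π.onH a)) b g x M hg ?_
  -- The image of `b` in `K` is a cycle modulo two: the boundary of `b` is invariant, so each fibre
  -- of `π` contributes twice the same integer.
  refine hK.even_of_even (push (fun a => T.f.onH (T.π.onH a)) b) (fun y => ?_) (fun v => ?_) x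
  · have h1 : push (fun a => T.f.onH (T.π.onH a)) b (K.bar y) =
        - push (fun a => T.f.onH (T.π.onH a)) b y := by
      have e : K.bar ∘ (fun a => T.f.onH (T.π.onH a)) =
          (fun a => T.f.onH (T.π.onH a)) ∘ T.Gt.bar :=
        funext fun a => by simp only [Function.comp, T.π.bar_comm, T.f.bar_comm]
      have h2 : push T.Gt.bar b = fun a => (-1) * b a := funext fun a => by
        rw [push_involutive _ T.Gt.bar_bar, hb]; ring
      rw [← push_involutive K.bar K.bar_bar (push (fun a => T.f.onH (T.π.onH a)) b) y,
        push_push, e, ← push_push, h2, push_mul]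
      ring
    rw [h1]
    exact ⟨- push (fun a => T.f.onH (T.π.onH a)) b y, by ring⟩
  · have e : K.root ∘ (fun a => T.f.onH (T.π.onH a)) = T.f.onV ∘ T.π.onV ∘ T.Gt.root :=
      funext fun a => by simp only [Function.comp, T.π.root_comm, T.f.root_comm]
    rw [push_push, e, ← push_push, ← push_push]
    refine Finset.even_sum _ fun w _ => ?_
    obtain ⟨w, rfl⟩ := T.surjV w
    rw [push_double T.cardV T.π_swapV T.swapV_ne, hbr]
    exact ⟨_, rfl⟩

theorem exists_half_ker (T : Tower K) (c : LinearMap.ker T.pushCycles)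
    (hc : ∀ h, Even (c.1.1 h)) : ∃ x : LinearMap.ker T.pushCycles, (2 : ℤ) • x = c := by
  choose b hb using hc
  have hs := (T.mem_ker_iff c.1).mp c.2
  have h1 : b ∈ T.Gt.cycles := by
    refine ⟨fun h => ?_, fun v => ?_⟩
    · have := c.1.2.1 h
      rw [hb, hb] at this
      omega
    · have := c.1.2.2 v
      simp only [hb, Finset.sum_add_distrib] at this
      omega
  have h2 : (⟨b, h1⟩ : T.Gt.cycles) ∈ LinearMap.ker T.pushCycles := by
    rw [mem_ker_iff]
    intro h
    have := hs h
    rw [hb, hb] at this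
    change b _ = - b h
    omega
  refine ⟨⟨_, h2⟩, Subtype.ext (Subtype.ext (funext fun h => ?_))⟩
  change 2 * b h = c.1.1 h
  rw [hb]
  ring

theorem two_cancel_ker (T : Tower K) (x y : LinearMap.ker T.pushCycles)
    (h : (2 : ℤ) • x = (2 : ℤ) • y) : x = y := by
  refine Subtype.ext (Subtype.ext (funext fun a => ?_))
  have h1 : 2 * x.1.1 a = 2 * y.1.1 a := congrFun (congrArg (fun z => z.1.1) h) a
  omega

/-! ### The incidence correspondence on anti-invariant cycles. -/

section correspondence

variable {T : Tower K} (θ : T.Orientation) (hT : T.Generic) (i : Fin 2)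

/-- The multiplicity of a half-edge of the output in the section attached to a half-edge. -/
def incidence (a : T.Gt.H) (p : (sheet θ i).H) : ℤ :=
  (vecSec T.π.onH T.f.degH (Function.surjInv T.surjH) (sheetValH θ i) a p : ℕ)

/-- The multiplicity of a half-edge in a half-edge of the output. -/
def coeff (p : (sheet θ i).H) (a : T.Gt.H) : ℤ := ((sheetValH θ i p).1.2 a : ℕ)

theorem push_root_incidence (a : T.Gt.H) (v : (sheet θ i).V) :
    push (sheet θ i).root (incidence θ i a) v = (vecSec T.π.onV T.f.degV
      (Function.surjInv T.surjV) (sheetValV θ i) (T.Gt.root a) v : ℕ) :=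
  (push_natCast _ _ _).trans (congrArg _ (congrFun ((sheetH θ i).push_vecSec_comm T.fibresH
    (sheetV θ i) T.fibresV T.rootMap (fun _ => rfl) a) v))

theorem incidence_bar (a : T.Gt.H) (p : (sheet θ i).H) :
    incidence θ i a ((sheet θ i).bar p) = incidence θ i (T.Gt.bar a) p :=
  congrArg Nat.cast ((push_involutive (sheet θ i).bar (sheet θ i).bar_bar _ p).symm.trans
    (congrFun ((sheetH θ i).push_vecSec_comm T.fibresH (sheetH θ i) T.fibresH T.barMap
      (fun _ => rfl) a) p))

include hT in
theorem incidence_swap (a : T.Gt.H) (p : (sheet θ i).H) :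
    incidence θ i a ((sheetSwap θ i).onH p) = incidence θ i (T.swap.onH a) p :=
  congrArg Nat.cast ((sheetH θ i).vecSec_swap T.fibresH hT.noFixedH a p).symm

theorem coeff_bar (p : (sheet θ i).H) (a : T.Gt.H) :
    coeff θ i p (T.Gt.bar a) = coeff θ i ((sheet θ i).bar p) a :=
  congrArg Nat.cast (push_involutive T.Gt.bar T.Gt.bar_bar _ a).symm

theorem coeff_swap (p : (sheet θ i).H) (a : T.Gt.H) :
    coeff θ i p (T.swap.onH a) = coeff θ i ((sheetSwap θ i).onH p) a :=
  congrArg Nat.cast (push_involutive T.swap.onH T.swap_swapH _ a).symm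

theorem sum_comp_involutive {A : Type*} [Fintype A] (s : A → A) (hs : ∀ a, s (s a) = a)
    (c g : A → ℤ) (hc : ∀ a, c (s a) = - c a) : ∑ a, c a * g (s a) = - ∑ a, c a * g a := by
  rw [← Equiv.sum_comp (⟨s, s, hs, hs⟩ : A ≃ A)]
  simp [hs, hc]

theorem sum_incidence_mem (c : T.Gt.H → ℤ) (hc : c ∈ T.Gt.cycles) :
    (fun p => ∑ a, c a * incidence θ i a p) ∈ (sheet θ i).cycles := by
  refine ⟨fun p => ?_, fun v => ?_⟩
  · simp only [incidence_bar]
    exact sum_comp_involutive T.Gt.bar T.Gt.bar_bar c (fun a => incidence θ i a p) hc.1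
  · change push (sheet θ i).root (fun p => ∑ a, c a * incidence θ i a p) v = 0
    rw [push_sum_mul]
    simp only [push_root_incidence]
    rw [← sum_push_mul T.Gt.root c fun w => ((vecSec T.π.onV T.f.degV
      (Function.surjInv T.surjV) (sheetValV θ i) w v : ℕ) : ℤ)]
    exact Finset.sum_eq_zero fun w _ => mul_eq_zero_of_left (hc.2 w) _

include hT in
theorem sum_incidence_swap (c : T.Gt.H → ℤ) (hc : ∀ a, c (T.swap.onH a) = - c a)
    (p : (sheet θ i).H) : ∑ a, c a * incidence θ i a ((sheetSwap θ i).onH p) =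
      - ∑ a, c a * incidence θ i a p := by
  simp only [incidence_swap θ hT]
  exact sum_comp_involutive T.swap.onH T.swap_swapH c (fun a => incidence θ i a p) hc

theorem sum_coeff_mem (c : (sheet θ i).H → ℤ) (hc : c ∈ (sheet θ i).cycles) :
    (fun a => ∑ p, c p * coeff θ i p a) ∈ T.Gt.cycles := by
  refine ⟨fun a => ?_, fun v => ?_⟩
  · simp only [coeff_bar]
    exact sum_comp_involutive (sheet θ i).bar (sheet θ i).bar_bar c (fun p => coeff θ i p a) hc.1
  · change push T.Gt.root (fun a => ∑ p, c p * coeff θ i p a) v = 0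
    rw [push_sum_mul]
    have h1 : ∀ p : (sheet θ i).H, push T.Gt.root (coeff θ i p) v =
        ((sheetValV θ i ((sheet θ i).root p)).1.2 v : ℕ) := fun p => push_natCast _ _ _
    simp only [h1]
    rw [← sum_push_mul (sheet θ i).root c fun w => (((sheetValV θ i w).1.2 v : ℕ) : ℤ)]
    exact Finset.sum_eq_zero fun w _ => mul_eq_zero_of_left (hc.2 w) _

theorem sum_coeff_swap (c : (sheet θ i).H → ℤ) (hc : ∀ p, c ((sheetSwap θ i).onH p) = - c p)
    (a : T.Gt.H) : ∑ p, c p * coeff θ i p (T.swap.onH a) = - ∑ p, c p * coeff θ i p a := by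
  simp only [coeff_swap]
  exact sum_comp_involutive (sheetSwap θ i).onH (sheetSwap_swapH θ i) c
    (fun p => coeff θ i p a) hc

theorem sum_incidence_coeff (c : T.Gt.H → ℤ) (hc : ∀ a, c (T.swap.onH a) = - c a) (a : T.Gt.H) :
    ∑ p, (∑ b, c b * incidence θ i b p) * (coeff θ i p a - coeff θ i p (T.swap.onH a)) =
      8 * c a := by
  simp only [Finset.sum_mul]
  rw [Finset.sum_comm]
  simp only [mul_assoc, ← Finset.mul_sum]
  have h1 : ∀ b, ∑ p, incidence θ i b p * (coeff θ i p a - coeff θ i p (T.swap.onH a)) =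
      4 * signedInd T.swap.onH b a := fun b => (sheetH θ i).vecSec_signed T.fibresH b a
  simp only [h1, mul_left_comm _ (4 : ℤ), ← Finset.mul_sum, sum_mul_signedInd c hc]
  ring

include hT in
theorem sum_coeff_incidence (c : (sheet θ i).H → ℤ)
    (hc : ∀ p, c ((sheetSwap θ i).onH p) = - c p) (p : (sheet θ i).H) :
    ∑ a, (∑ q, c q * coeff θ i q a) *
      (incidence θ i a p - incidence θ i a ((sheetSwap θ i).onH p)) = 8 * c p := by
  simp only [Finset.sum_mul]
  rw [Finset.sum_comm]
  simp only [mul_assoc, ← Finset.mul_sum]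
  have h1 : ∀ q, ∑ a, coeff θ i q a *
      (incidence θ i a p - incidence θ i a ((sheetSwap θ i).onH p)) =
      4 * signedInd (sheetSwap θ i).onH q p :=
    fun q => (sheetH θ i).sum_apply_mul_vecSec T.fibresH hT.noFixedH q p
  simp only [h1, mul_left_comm _ (4 : ℤ), ← Finset.mul_sum, sum_mul_signedInd c hc]
  ring

/-- The map on anti-invariant cycles induced by the incidence correspondence. -/
def incidenceMap :
    LinearMap.ker T.pushCycles →ₗ[ℤ] LinearMap.ker (outputTower θ hT i).pushCycles where
  toFun c := ⟨⟨_, sum_incidence_mem θ i c.1.1 c.1.2⟩, ((outputTower θ hT i).mem_ker_iff _).mpr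
    (sum_incidence_swap θ hT i c.1.1 ((T.mem_ker_iff c.1).mp c.2))⟩
  map_add' c c' := Subtype.ext (Subtype.ext (funext fun p => by
    change ∑ a, (c.1.1 a + c'.1.1 a) * _ = (∑ a, c.1.1 a * _) + ∑ a, c'.1.1 a * _
    rw [← Finset.sum_add_distrib]
    exact Finset.sum_congr rfl fun a _ => add_mul _ _ _))
  map_smul' r c := Subtype.ext (Subtype.ext (funext fun p => by
    change ∑ a, (r * c.1.1 a) * _ = r * ∑ a, c.1.1 a * _
    rw [Finset.mul_sum]
    exact Finset.sum_congr rfl fun a _ => mul_assoc _ _ _))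

/-- The transposed map on anti-invariant cycles. -/
def coeffMap :
    LinearMap.ker (outputTower θ hT i).pushCycles →ₗ[ℤ] LinearMap.ker T.pushCycles where
  toFun c := ⟨⟨_, sum_coeff_mem θ i c.1.1 c.1.2⟩, (T.mem_ker_iff _).mpr
    (sum_coeff_swap θ i c.1.1 (((outputTower θ hT i).mem_ker_iff c.1).mp c.2))⟩
  map_add' c c' := Subtype.ext (Subtype.ext (funext fun a => by
    change ∑ p : (sheet θ i).H, (c.1.1 p + c'.1.1 p) * _ =
      (∑ p : (sheet θ i).H, c.1.1 p * _) + ∑ p : (sheet θ i).H, c'.1.1 p * _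
    rw [← Finset.sum_add_distrib]
    exact Finset.sum_congr rfl fun a _ => add_mul _ _ _))
  map_smul' r c := Subtype.ext (Subtype.ext (funext fun a => by
    change ∑ p : (sheet θ i).H, (r * c.1.1 p) * _ = r * ∑ p : (sheet θ i).H, c.1.1 p * _
    rw [Finset.mul_sum]
    exact Finset.sum_congr rfl fun a _ => mul_assoc _ _ _))

/-- In `sum_incidence_coeff` the two signed terms agree by anti-invariance, so the factor eight
there is twice the factor wanted. -/
theorem coeffMap_incidenceMap (c : LinearMap.ker T.pushCycles) :
    coeffMap θ hT i (incidenceMap θ hT i c) = (4 : ℤ) • c := by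
  have hc := (T.mem_ker_iff c.1).mp c.2
  refine Subtype.ext (Subtype.ext (funext fun a => ?_))
  change ∑ p, (∑ b, c.1.1 b * incidence θ i b p) * coeff θ i p a = 4 * c.1.1 a
  have h1 := sum_incidence_coeff θ i c.1.1 hc a
  simp only [mul_sub, Finset.sum_sub_distrib] at h1
  rw [sum_coeff_swap θ i _ (sum_incidence_swap θ hT i c.1.1 hc)] at h1
  omega

theorem incidenceMap_coeffMap (c : LinearMap.ker (outputTower θ hT i).pushCycles) :
    incidenceMap θ hT i (coeffMap θ hT i c) = (4 : ℤ) • c := by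
  let c' : (sheet θ i).H → ℤ := c.1.1
  have hc : ∀ p, c' ((sheetSwap θ i).onH p) = - c' p :=
    ((outputTower θ hT i).mem_ker_iff c.1).mp c.2
  refine Subtype.ext (Subtype.ext (funext fun (p : (sheet θ i).H) => ?_))
  change ∑ a, (∑ q, c' q * coeff θ i q a) * incidence θ i a p = 4 * c' p
  have h1 := sum_coeff_incidence θ hT i c' hc p
  simp only [mul_sub, Finset.sum_sub_distrib] at h1
  rw [sum_incidence_swap θ hT i _ (sum_coeff_swap θ i c' hc)] at h1
  omega

theorem even_incidenceMap (hK : K.IsTree) (c : LinearMap.ker T.pushCycles) (p : (sheet θ i).H) :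
    Even ((incidenceMap θ hT i c).1.1 p) :=
  T.even_sum_cycle_mul hK c.1.1 c.1.2 ((T.mem_ker_iff c.1).mp c.2)
    (fun a => incidence θ i a p) p.1.1.1
    (sectionDegree (Function.surjInv T.surjH) (sheetValH θ i p) : ℕ) fun a => by
      have h1 := (sheetH θ i).vecSec_add T.fibresH a p
      simp only [incidence]
      exact_mod_cast h1

theorem even_coeffMap (hK : K.IsTree) (c : LinearMap.ker (outputTower θ hT i).pushCycles)
    (a : T.Gt.H) : Even ((coeffMap θ hT i c).1.1 a) := by
  have h1 : ∀ p : (sheet θ i).H, coeff θ i p a + coeff θ i ((sheetSwap θ i).onH p) a =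
      if p.1.1.1 = T.f.onH (T.π.onH a) then (T.f.degH (T.π.onH a) : ℤ) else 0 := by
    intro p
    rw [← coeff_swap]
    have h2 := T.fibresH.apply_add (sheetValH θ i p) a
    simp only [coeff]
    rw [← Nat.cast_add, h2, pull]
    simp only [eq_comm (a := T.f.onH (T.π.onH a))]
    push_cast
    rfl
  exact (outputTower θ hT i).even_sum_cycle_mul hK c.1.1 c.1.2
    (((outputTower θ hT i).mem_ker_iff c.1).mp c.2) (fun p : (sheet θ i).H => coeff θ i p a)
    (T.f.onH (T.π.onH a)) (T.f.degH (T.π.onH a)) h1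

/-- The multiplicities differ by the ratio of the local degrees of `p` and `a`, and the edge
lengths, being inversely proportional to these degrees, compensate exactly. Off the fibre both
multiplicities vanish. -/
theorem incidence_mul_lenTop (ℓ : K.EdgeLength) (a : T.Gt.H) (p : (sheet θ i).H) :
    (incidence θ i a p : ℝ) * (outputTower θ hT i).lenTop ℓ p =
      (coeff θ i p a : ℝ) * T.lenTop ℓ a := by
  have hS : (outputTower θ hT i).lenTop ℓ p = ℓ.len p.1.1.1 /
      (sectionDegree (Function.surjInv T.surjH) (sheetValH θ i p) : ℕ) / (1 : ℕ) := rfl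
  have hT' : T.lenTop ℓ a = ℓ.len (T.f.onH (T.π.onH a)) / T.f.degH (T.π.onH a) := by
    unfold lenTop len
    rw [T.π_free.2, Nat.cast_one, div_one]
  have hd : (T.f.degH (T.π.onH a) : ℝ) ≠ 0 :=
    Nat.cast_ne_zero.mpr (T.f_harmonic.degH_pos _).ne'
  have hD : ((sectionDegree (Function.surjInv T.surjH) (sheetValH θ i p) : ℕ) : ℝ) ≠ 0 :=
    Nat.cast_ne_zero.mpr ((outputTower θ hT i).f_harmonic.degH_pos
      ((outputTower θ hT i).π.onH p)).ne'
  have h1 : (incidence θ i a p : ℝ) * (T.f.degH (T.π.onH a) : ℝ) =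
      ((sectionDegree (Function.surjInv T.surjH) (sheetValH θ i p) : ℕ) : ℝ) *
        (coeff θ i p a : ℝ) := by
    have := (sheetH θ i).vecSec_mul_degree T.fibresH a p
    simp only [incidence, coeff]
    exact_mod_cast this
  have h2 : (incidence θ i a p : ℝ) =
      ((sectionDegree (Function.surjInv T.surjH) (sheetValH θ i p) : ℕ) : ℝ) *
        (coeff θ i p a : ℝ) / (T.f.degH (T.π.onH a) : ℝ) := (eq_div_iff hd).mpr h1
  rw [hS, hT', h2, Nat.cast_one, div_one]
  by_cases hx : T.f.onH (T.π.onH a) = p.1.1.1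
  · rw [hx]
    field_simp
  · have h0 : coeff θ i p a = 0 :=
      congrArg Nat.cast ((sheetH θ i).apply_eq_zero T.fibresH p a hx)
    rw [h0]
    simp

theorem intPair_incidenceMap (ℓ : K.EdgeLength) (c : LinearMap.ker T.pushCycles)
    (c' : LinearMap.ker (outputTower θ hT i).pushCycles) :
    (outputTower θ hT i).Gt.intPair ((outputTower θ hT i).lenTop ℓ)
        (incidenceMap θ hT i c).1 c'.1 =
      T.Gt.intPair (T.lenTop ℓ) c.1 (coeffMap θ hT i c').1 := by
  let e' : (sheet θ i).H → ℤ := c'.1.1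
  let w : (sheet θ i).H → ℝ := (outputTower θ hT i).lenTop ℓ
  change (1 / 2 : ℝ) * ∑ p, ((∑ a, c.1.1 a * incidence θ i a p : ℤ) : ℝ) * (e' p : ℝ) * w p =
    (1 / 2 : ℝ) * ∑ a, (c.1.1 a : ℝ) * ((∑ p, e' p * coeff θ i p a : ℤ) : ℝ) * T.lenTop ℓ a
  have h1 : ∀ a p, (incidence θ i a p : ℝ) * w p = (coeff θ i p a : ℝ) * T.lenTop ℓ a :=
    incidence_mul_lenTop θ hT i ℓ
  congr 1
  push_cast
  simp only [Finset.sum_mul, Finset.mul_sum]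
  rw [Finset.sum_comm]
  refine Finset.sum_congr rfl fun a _ => Finset.sum_congr rfl fun p _ => ?_
  linear_combination (c.1.1 a : ℝ) * (e' p : ℝ) * h1 a p

/-- Over a tree, the tetragonal construction induces an isometry of the lattices of anti-invariant
cycles. -/
theorem exists_isometry_output (hK : K.IsTree) (ℓ : K.EdgeLength) :
    ∃ φ : LinearMap.ker T.pushCycles ≃ₗ[ℤ] LinearMap.ker (outputTower θ hT i).pushCycles,
      ∀ a b, (outputTower θ hT i).Gt.intPair ((outputTower θ hT i).lenTop ℓ) (φ a).1 (φ b).1 =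
        T.Gt.intPair (T.lenTop ℓ) a.1 b.1 := by
  obtain ⟨φ, hφ⟩ := exists_half (incidenceMap θ hT i) (outputTower θ hT i).two_cancel_ker
    fun c => (outputTower θ hT i).exists_half_ker _ (even_incidenceMap θ hT i hK c)
  obtain ⟨ψ, hψ⟩ := exists_half (coeffMap θ hT i) T.two_cancel_ker
    fun c => T.exists_half_ker _ (even_coeffMap θ hT i hK c)
  have hψφ : ∀ c, ψ (φ c) = c := fun c => by
    have h1 := coeffMap_incidenceMap θ hT i c
    rw [← hφ, ← hψ] at h1
    simp only [LinearMap.smul_apply, map_smul, smul_smul] at h1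
    -- The identity `4 ψ φ = 4` is divided by two twice.
    exact T.two_cancel_ker _ _ (T.two_cancel_ker _ _ (by rw [smul_smul, h1, smul_smul]; rfl))
  have hφψ : ∀ c, φ (ψ c) = c := fun c => by
    have h1 := incidenceMap_coeffMap θ hT i c
    rw [← hφ, ← hψ] at h1
    simp only [LinearMap.smul_apply, map_smul, smul_smul] at h1
    exact (outputTower θ hT i).two_cancel_ker _ _
      ((outputTower θ hT i).two_cancel_ker _ _ (by rw [smul_smul, h1, smul_smul]; rfl))
  refine ⟨LinearEquiv.ofLinearMap φ ψ (LinearMap.ext hφψ) (LinearMap.ext hψφ), fun a b => ?_⟩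
  -- Adjointness applied to `φ b` gives `2 [φ a, φ b] = 2 [a, ψ φ b] = 2 [a, b]`.
  have h1 := intPair_incidenceMap θ hT i ℓ a (φ b)
  rw [← hφ, ← hψ] at h1
  simp only [LinearMap.smul_apply, hψφ, Submodule.coe_smul, map_smul] at h1
  simp only [zsmul_eq_mul] at h1
  exact mul_left_cancel₀ (by norm_num : ((2 : ℤ) : ℝ) ≠ 0) h1

end correspondence

end Tower

end

end TropDonagi

open TropDonagi in
theorem theorem1p1 (K : TropDonagi.Graph.{u}) (hK : K.Connected)
    (T : Tower K) (hgen : T.Generic) (θ : T.Orientation) :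
    ∃ T' : Fin 2 → Tower K,
      (∀ i, (T' i).toPreTower = Tower.output θ i ∧ (T' i).Generic ∧ (T' i).Orientable) ∧
      (∀ (i : Fin 2) (θ' : (T' i).Orientation), ∃ j : Fin 2,
        Nonempty ((Tower.output θ' j).Iso T.toPreTower) ∧
        Nonempty ((Tower.output θ' (1 - j)).Iso (Tower.output θ (1 - i)))) ∧
      (T.Gt.Connected → (∀ i, (T' i).Gt.Connected) → K.IsTree →
        ∀ ℓ : K.EdgeLength, ∃ (ζ : (T.prym ℓ).L' →ₗ[ℤ] (T.prym ℓ).L)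
          (ζ' : ∀ i, ((T' i).prym ℓ).L' →ₗ[ℤ] ((T' i).prym ℓ).L),
          T.IsPrymPolarization ℓ ζ ∧ (∀ i, (T' i).IsPrymPolarization ℓ (ζ' i)) ∧
          Nonempty (Pairing.PolarizedIso (T.prym ℓ) ((T' 0).prym ℓ) ζ (ζ' 0)) ∧
          Nonempty (Pairing.PolarizedIso ((T' 0).prym ℓ) ((T' 1).prym ℓ) (ζ' 0) (ζ' 1))) := by
  refine ⟨fun i => Tower.outputTower θ hgen i, fun i => ⟨rfl, Tower.generic_output θ hgen i,
    Tower.orientable_output θ hgen i⟩, fun i θ' => ?_, fun hconn hconn' htree ℓ => ?_⟩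
  · obtain ⟨j, hV, hH⟩ := Tower.exists_index_vec θ hgen i hK θ'
    have hgen' := Tower.generic_output θ hgen i
    exact ⟨j, Tower.nonempty_iso_vec θ hgen i θ' hgen' hV hH,
      Tower.nonempty_iso_adj θ hgen i θ' hgen' hV hH⟩
  · obtain ⟨ζ, hζ⟩ := T.exists_isPrymPolarization ℓ hconn
    choose ζ' hζ' using fun i =>
      (Tower.outputTower θ hgen i).exists_isPrymPolarization ℓ (hconn' i)
    choose φ hφ using fun i => Tower.exists_isometry_output θ hgen i htree ℓ
    -- The two outputs are compared by composing their isometries with the lattice of `T`.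
    refine ⟨ζ, ζ', hζ, hζ', Tower.nonempty_polarizedIso hζ (hζ' 0) (φ 0) (hφ 0),
      Tower.nonempty_polarizedIso (hζ' 0) (hζ' 1) ((φ 0).symm.trans (φ 1)) fun a b => ?_⟩
    obtain ⟨a, rfl⟩ := (φ 0).surjective a
    obtain ⟨b, rfl⟩ := (φ 0).surjective b
    simp only [LinearEquiv.trans_apply, LinearEquiv.symm_apply_apply]
    exact (hφ 1 a b).trans (hφ 0 a b).symm
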